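/- Let $R,\delta>0$ and let $m_+,m_-$ be real functions on $[0,\infty)$ that are continuous on $[0,\delta)$, locally absolutely continuous on $(0,R)$ and on $(R,\infty)$, and have finite one-sided limits at $R$; write $[m]_R:=m(R_+)-m(R_-)$. For almost every $s>0$ put $$W^{\pm,m}(s):=\frac{2m(s)\pm s\,m'(s)-s\,m(s)^2+s}{1+m(s)^2},\qquad W:=\min\big(W^{+,m_+},\,W^{-,m_-}\big),$$ and assume that $W(s)\ge 1$ for almost every $s>0$. Let $$C(R):=-\max\big([m_-]_R,\,-[m_+]_R\big).$$ Then: (i) $m_+(0)=m_-(0)=1$; (ii) $m_+\ge 1$ and $m_-\le 1$ on some interval $(0,\varepsilon)$, $\varepsilon>0$; (iii) $\limsup_{s\to0^+}\big|(m_\pm(s)-1)\log s\big|<+\infty$; (iv) $C(R)\le 0$ and, if moreover $m_+\ge0$ and $m_-\ge 0$ on $(0,\infty)\setminus\{R\}$, then for every $\varphi\in H^1(\mathbb{R}^3,\mathbb{C}^2)$ the function $\frac{W(|x|)}{|x|}|\varphi|^2$ is integrable and $$\int_{\mathbb{R}^3}\left(\frac{|\boldsymbol\sigma\cdot\boldsymbol\nabla\varphi|^2}{1+\frac{W(|x|)}{|x|}}+|\varphi|^2\right)dx\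 \ge\ \int_{\mathbb{R}^3}\frac{W(|x|)}{|x|}\,|\varphi|^2\,dx\;+\;C(R)\int_{S_R}|\varphi|^2\,d\mu_R .$$ Here $\boldsymbol\sigma\cdot\boldsymbol\nabla=\sum_{k=1}^3\sigma_k\partial_k$ with the Pauli matrices $\sigma_k$, $\mu_R$ is the surface measure on the sphere $S_R=\{|x|=R\}$, and $\varphi$ on $S_R$ is understood in the sense of traces. -/

import Mathlib

open MeasureTheory Filter Topology Set
open scoped ContDiff ENNReal

noncomputable section

namespace DiracHardy

/-- Three-dimensional Euclidean space. -/
abbrev Space : Type := EuclideanSpace ℝ (Fin 3)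

/-- The space `ℂ²` of two-spinors, with its Hermitian norm. -/
abbrev Spinor : Type := EuclideanSpace ℂ (Fin 2)

/-- The Pauli matrices `σ₁, σ₂, σ₃`. -/
def pauli : Fin 3 → Matrix (Fin 2) (Fin 2) ℂ :=
  ![!![0, 1; 1, 0], !![0, -Complex.I; Complex.I, 0], !![1, 0; 0, -1]]

/-- The `k`-th vector of the canonical basis of `ℝ³`. -/
def basisVec (k : Fin 3) : Space := EuclideanSpace.single k 1

/-- `φ` belongs to `H¹(ℝ³, ℂ²)` and `G k = ∂ₖ φ` in the weak sense: `φ` and the `G k` are square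
integrable and `∫ (∂ₖ ψ) φ = - ∫ ψ (G k)` for all smooth compactly supported scalar `ψ`. -/
structure IsH1WithGrad (φ : Space → Spinor) (G : Fin 3 → Space → Spinor) : Prop where
  memLp : MemLp φ 2 volume
  memLp_grad : ∀ k, MemLp (G k) 2 volume
  weak_deriv : ∀ (k : Fin 3) (ψ : Space → ℝ), ContDiff ℝ ∞ ψ → HasCompactSupport ψ →
    ∫ x, (fderiv ℝ ψ x (basisVec k)) • φ x = - ∫ x, ψ x • G k x

/-- `(σ · ∇ φ)(x) = ∑ₖ σₖ ∂ₖ φ(x)`, where `G k = ∂ₖ φ`. -/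
def sigmaGrad (G : Fin 3 → Space → Spinor) (x : Space) : Spinor :=
  ∑ k, WithLp.toLp 2 ((pauli k).mulVec (G k x).ofLp)

/-- The surface measure `μ_R` of the sphere `S_R` of radius `R` centred at the origin, as a measure
on `ℝ³`: the image of `R² dω` under `ω ↦ R ω`, where `dω` is the surface measure of the unit
sphere. -/
def sphereMeasure (R : ℝ) : Measure Space :=
  ENNReal.ofReal (R ^ 2) •
    Measure.map (fun y : Metric.sphere (0 : Space) 1 => R • (y : Space))
      (volume : Measure Space).toSphere

/-- `τ` is the trace on `S_R` of the `H¹` spinor `φ` with weak gradient `G`: the value at `φ` of the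
continuous extension to `H¹(ℝ³, ℂ²)` of the restriction map `C_c^∞(ℝ³, ℂ²) → L²(S_R, μ_R)`. -/
def IsSphereTrace (R : ℝ) (φ : Space → Spinor) (G : Fin 3 → Space → Spinor)
    (τ : Space → Spinor) : Prop :=
  MemLp τ 2 (sphereMeasure R) ∧
  ∃ f : ℕ → Space → Spinor,
    (∀ n, ContDiff ℝ ∞ (f n)) ∧ (∀ n, HasCompactSupport (f n)) ∧
    Tendsto (fun n => eLpNorm (fun x => f n x - φ x) 2 volume) atTop (𝓝 0) ∧
    (∀ k, Tendsto (fun n => eLpNorm (fun x => fderiv ℝ (f n) x (basisVec k) - G k x) 2 volume)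
      atTop (𝓝 0)) ∧
    Tendsto (fun n => eLpNorm (fun x => f n x - τ x) 2 (sphereMeasure R)) atTop (𝓝 0)

/-- The inequality
`∫ (|σ·∇φ|² / (1 + W(|x|)/|x|) + |φ|²) dx ≥ ∫ (W(|x|)/|x|) |φ|² dx + C ∫_{S_R} |φ|² dμ_R`
for all `φ ∈ H¹(ℝ³, ℂ²)`, including that the first integral on the right converges and that the
trace of `φ` on `S_R` exists. -/
def HardyDiracInequality (W : ℝ → ℝ) (R C : ℝ) : Prop :=
  ∀ (φ : Space → Spinor) (G : Fin 3 → Space → Spinor), IsH1WithGrad φ G →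
    Integrable (fun x => W ‖x‖ / ‖x‖ * ‖φ x‖ ^ 2) volume ∧
    (∃ τ, IsSphereTrace R φ G τ) ∧
    ∀ τ, IsSphereTrace R φ G τ →
      (∫ x, W ‖x‖ / ‖x‖ * ‖φ x‖ ^ 2) + C * ∫ x, ‖τ x‖ ^ 2 ∂(sphereMeasure R) ≤
        ∫ x, (‖sigmaGrad G x‖ ^ 2 / (1 + W ‖x‖ / ‖x‖) + ‖φ x‖ ^ 2)

/-- `W^{+,m} = (2m + s m' - s m² + s) / (1 + m²)`. -/
def Wplus (m : ℝ → ℝ) (s : ℝ) : ℝ :=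
  (2 * m s + s * deriv m s - s * m s ^ 2 + s) / (1 + m s ^ 2)

/-- `W^{-,m} = (2m - s m' - s m² + s) / (1 + m²)`. -/
def Wminus (m : ℝ → ℝ) (s : ℝ) : ℝ :=
  (2 * m s - s * deriv m s - s * m s ^ 2 + s) / (1 + m s ^ 2)

/-- `W = min (W^{+,m₊}, W^{-,m₋})`. -/
def Wmin (mp mm : ℝ → ℝ) (s : ℝ) : ℝ := min (Wplus mp s) (Wminus mm s)

/-- `m` is locally absolutely continuous on `(0, R)` and on `(R, ∞)`, and has finite one-sided
limits at `R`: it may jump at `R`, and its distributional derivative on `(0, ∞) \ {R}` is its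
almost everywhere derivative. -/
structure IsPiecewiseAC (R : ℝ) (m : ℝ → ℝ) : Prop where
  left : ∀ a b, 0 < a → a ≤ b → b < R → AbsolutelyContinuousOnInterval m a b
  right : ∀ a b, R < a → a ≤ b → AbsolutelyContinuousOnInterval m a b
  leftLim : ∃ l, Tendsto m (𝓝[<] R) (𝓝 l)
  rightLim : ∃ l, Tendsto m (𝓝[>] R) (𝓝 l)

/-- The jump `[m]_R = m(R₊) - m(R₋)`. -/
def jump (m : ℝ → ℝ) (R : ℝ) : ℝ := Function.rightLim m R - Function.leftLim m R

end DiracHardy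

end

/-!
# Hardy–Dirac inequalities with a radial weight

The hypothesis `W ≥ 1` is a pair of Riccati inequalities: cleared of denominators it says
`(m₊ - 1)² + s (m₊² - 1) ≤ s m₊'` and `(m₋ - 1)² + s (m₋² - 1) ≤ - s m₋'`
(`le_mul_deriv_of_one_le_Wplus`, `le_mul_deriv_of_one_le_Wminus`).

*Behaviour at the origin and at `R`.* If `m±(0) ≠ 1`, then `s |m±'|` is bounded below near `0` and
`m±` diverges like `log s`, against continuity (`eq_one_of_tendsto`). Starting from the value `1`,
Gronwall's inequality keeps `m₊ ≥ 1` and `m₋ ≤ 1` on `(0, R)`, and the quadratic term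
`(m± - 1)² / s`, integrated, gives the logarithmic rate (`exists_abs_mul_log_le`). If `m₊ > 1` at a
point beyond `R`, the Riccati inequality makes `m₊` blow up at a finite distance; hence `m₊ ≤ 1`
there, and `C(R) ≤ [m₊]_R ≤ 0` (`jump_nonpos_of_Wplus`).

*The inequality on an eigenspace.* Let `K = 1 + σ · L` be the spin-orbit operator. If `K f = k f`,
the cross term `Re ⟨(σ · ∇) f, (σ · x) f⟩` equals `x · ∇ |f|² / 2 - (k - 1) |f|²`, so that
completing the square in `|(σ · ∇) f|² / (1 + V) + (1 + V) m² |f|²`, where `V = W(|x|) / |x|`,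
leaves a divergence: for `k ≥ 1`, with `m = m₊ ≥ 0`, the definition of `W⁺` gives
`|(σ · ∇) f|² / (1 + V) + |f|² - V |f|² ≥ - div (m(|x|) |f|² x / |x|)`,
and for `k ≤ -1`, with `m = m₋ ≥ 0`, the same holds with the opposite sign on the right. By the
divergence theorem only the jump of `m` across the sphere survives
(`IsRadialProfile.integral_radial`, `smoothHardy_of_pos`, `smoothHardy_of_neg`). The value
`k = 0` does not occur among the eigenvalues that are needed.

*From eigenspaces to all fields.* `K` is symmetric with respect to every rotation-invariant measure,
and `σ · ∇` maps the eigenvalue `k` to `-k`; all the integrals in the inequality are therefore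
additive over eigenspaces (`smoothHardy_sum`). No spectral theory on the sphere is needed to see
that sums of eigenfunctions are dense: by a Fischer decomposition every homogeneous polynomial field
is a sum of eigenfunctions with `k ≠ 0` (`IsHomogeneous.mem_iSup`), and a smooth compactly supported
field is a `C¹` limit of polynomials, obtained by truncating its Fourier integral and expanding the
exponential (`exists_eigenfunctions_approx`). Multiplication by radial cutoff functions preserves
the eigenspaces. Mollification and truncation give the density of smooth compactly supported fields
in `H¹` (`exists_seq_tendsto_H1`), the case of a step function `m` of `integral_radial` gives the
trace inequality (`exists_isSphereTrace`), and Fatou's lemma carries the inequality to the limit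
(`hardy_of_tendsto`, `hardyDiracInequality`).
-/

namespace DiracHardy

/-! ### Clifford multiplication and the Dirac operator -/

/-- The Pauli matrix `σₖ` as an operator on `ℂ²`. -/
noncomputable def pauliOp (k : Fin 3) : Spinor →L[ℂ] Spinor :=
  Matrix.toEuclideanCLM (n := Fin 2) (𝕜 := ℂ) (pauli k)

lemma toLp_mulVec_pauli (k : Fin 3) (v : Spinor) :
    WithLp.toLp 2 ((pauli k).mulVec v.ofLp) = pauliOp k v := by
  simp [pauliOp, ← Matrix.ofLp_toEuclideanCLM]

lemma pauli_anticomm (j k : Fin 3) :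
    pauli j * pauli k + pauli k * pauli j = if j = k then 2 else 0 := by
  fin_cases j <;> fin_cases k <;> ext a b <;> fin_cases a <;> fin_cases b <;>
    norm_num [pauli, Matrix.mul_apply, Fin.sum_univ_two, Matrix.ofNat_apply]

lemma pauli_conjTranspose (k : Fin 3) : star (pauli k) = pauli k := by
  fin_cases k <;> ext a b <;> fin_cases a <;> fin_cases b <;>
    norm_num [pauli, Matrix.star_eq_conjTranspose, Matrix.conjTranspose_apply]

lemma pauliOp_anticomm (j k : Fin 3) (v : Spinor) :
    pauliOp j (pauliOp k v) + pauliOp k (pauliOp j v) = if j = k then (2 : ℝ) • v else 0 := by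
  have h := congrArg (fun M => Matrix.toEuclideanCLM (n := Fin 2) (𝕜 := ℂ) M v)
    (pauli_anticomm j k)
  simp only [map_add, map_mul, add_apply, mul_apply_eq_comp] at h
  simp only [pauliOp]
  rw [h]
  split_ifs with hjk
  · have h2 : (2 : Matrix (Fin 2) (Fin 2) ℂ) = 1 + 1 := one_add_one_eq_two.symm
    rw [h2, map_add, map_one, two_smul]
    rfl
  · simp

lemma pauliOp_sq (k : Fin 3) (v : Spinor) : pauliOp k (pauliOp k v) = v := by
  have h := pauliOp_anticomm k k v
  rw [if_pos rfl, two_smul, ← two_smul ℝ, ← two_smul ℝ] at h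
  exact smul_right_injective _ (two_ne_zero (α := ℝ)) h

lemma pauliOp_swap {j k : Fin 3} (h : j ≠ k) (v : Spinor) :
    pauliOp j (pauliOp k v) = -pauliOp k (pauliOp j v) := by
  have := pauliOp_anticomm j k v
  rw [if_neg h] at this
  exact eq_neg_of_add_eq_zero_left this

lemma inner_pauliOp_left (k : Fin 3) (u v : Spinor) :
    inner ℂ (pauliOp k u) v = inner ℂ u (pauliOp k v) := by
  have : ContinuousLinearMap.adjoint (pauliOp k) = pauliOp k := by
    rw [← ContinuousLinearMap.star_eq_adjoint, pauliOp, ← map_star, pauli_conjTranspose]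
  conv_lhs => rw [← this]
  exact ContinuousLinearMap.adjoint_inner_left _ _ _

lemma pauliOp_real_smul (k : Fin 3) (c : ℝ) (v : Spinor) :
    pauliOp k (c • v) = c • pauliOp k v :=
  (pauliOp k).map_smul_of_tower c v

/-- Clifford multiplication `v ↦ (σ · x) v`. -/
noncomputable def clifford (x : Space) (v : Spinor) : Spinor := ∑ k, x k • pauliOp k v

lemma clifford_add (x : Space) (u v : Spinor) :
    clifford x (u + v) = clifford x u + clifford x v := by
  simp [clifford, Finset.sum_add_distrib]

lemma clifford_smul (x : Space) (c : ℝ) (v : Spinor) :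
    clifford x (c • v) = c • clifford x v := by
  simp [clifford, Finset.smul_sum, smul_comm c]

lemma clifford_clifford (x : Space) (v : Spinor) :
    clifford x (clifford x v) = ‖x‖ ^ 2 • v := by
  have h01 := pauliOp_swap (show (1 : Fin 3) ≠ 0 by decide) v
  have h02 := pauliOp_swap (show (2 : Fin 3) ≠ 0 by decide) v
  have h12 := pauliOp_swap (show (2 : Fin 3) ≠ 1 by decide) v
  rw [EuclideanSpace.real_norm_sq_eq]
  simp only [clifford, Fin.sum_univ_three, map_add, pauliOp_real_smul, pauliOp_sq, h01, h02, h12]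
  module

lemma inner_clifford_left (x : Space) (u v : Spinor) :
    inner ℂ (clifford x u) v = inner ℂ u (clifford x v) := by
  simp [clifford, inner_pauliOp_left, inner_smul_left_eq_smul,
    inner_smul_right_eq_smul]

lemma norm_clifford (x : Space) (v : Spinor) : ‖clifford x v‖ = ‖x‖ * ‖v‖ := by
  have h : inner ℂ (clifford x v) (clifford x v) = inner ℂ v (‖x‖ ^ 2 • v) := by
    rw [inner_clifford_left, clifford_clifford]
  rw [inner_smul_right_eq_smul, inner_self_eq_norm_sq_to_K, inner_self_eq_norm_sq_to_K] at h
  have h2 : ‖clifford x v‖ ^ 2 = (‖x‖ * ‖v‖) ^ 2 := by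
    rw [mul_pow]
    rw [Complex.real_smul] at h
    apply Complex.ofReal_injective
    push_cast at h ⊢
    exact h
  exact (sq_eq_sq₀ (norm_nonneg _) (by positivity)).1 h2

lemma sum_smul_basisVec (x : Space) : ∑ k, x k • basisVec k = x := by
  ext i
  fin_cases i <;> simp [basisVec, Fin.sum_univ_three]

lemma inner_basisVec (x : Space) (k : Fin 3) : inner ℝ x (basisVec k) = x k := by
  simp [basisVec, EuclideanSpace.inner_single_right]

lemma norm_basisVec (k : Fin 3) : ‖basisVec k‖ = 1 := by simp [basisVec]

lemma sum_smul_apply_basisVec {F : Type*} [NormedAddCommGroup F] [NormedSpace ℝ F]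
    (T : Space →L[ℝ] F) (x : Space) : ∑ k, x k • T (basisVec k) = T x := by
  conv_rhs => rw [← sum_smul_basisVec x]
  simp only [map_sum, map_smul]

/-- The Dirac operator `σ · ∇` on differentiable spinor fields. -/
noncomputable def dirac (f : Space → Spinor) (x : Space) : Spinor :=
  ∑ k, pauliOp k (fderiv ℝ f x (basisVec k))

/-- The spin-orbit operator `K = 1 + σ · L`, with `L = -i x ∧ ∇`, written without the vector product
as `K f = f + (x · ∇) f - (σ · x) (σ · ∇) f`. -/
noncomputable def spinOrbit (f : Space → Spinor) (x : Space) : Spinor :=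
  f x + fderiv ℝ f x x - clifford x (dirac f x)

lemma sigmaGrad_eq (G : Fin 3 → Space → Spinor) (x : Space) :
    sigmaGrad G x = ∑ k, pauliOp k (G k x) := by
  simp only [sigmaGrad, toLp_mulVec_pauli]

lemma sigmaGrad_fderiv (f : Space → Spinor) (x : Space) :
    sigmaGrad (fun k x => fderiv ℝ f x (basisVec k)) x = dirac f x := sigmaGrad_eq _ _

lemma norm_pauliOp (k : Fin 3) (v : Spinor) : ‖pauliOp k v‖ = ‖v‖ := by
  have h : inner ℂ (pauliOp k v) (pauliOp k v) = inner ℂ v v := by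
    rw [inner_pauliOp_left, pauliOp_sq]
  rw [inner_self_eq_norm_sq_to_K, inner_self_eq_norm_sq_to_K] at h
  have h2 : ‖pauliOp k v‖ ^ 2 = ‖v‖ ^ 2 := by exact_mod_cast h
  exact (sq_eq_sq₀ (norm_nonneg _) (norm_nonneg _)).1 h2

lemma dirac_add {f g : Space → Spinor} {x : Space} (hf : DifferentiableAt ℝ f x)
    (hg : DifferentiableAt ℝ g x) : dirac (f + g) x = dirac f x + dirac g x := by
  simp [dirac, fderiv_add hf hg, Finset.sum_add_distrib]

lemma dirac_const_smul {f : Space → Spinor} {x : Space} (c : ℝ) :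
    dirac (c • f) x = c • dirac f x := by
  simp [dirac, fderiv_const_smul_field, Finset.smul_sum]

/-- The Dirac operator of a product with a function with radial gradient `c x`. -/
lemma dirac_radial_smul {f : Space → Spinor} {g : Space → ℝ} {x : Space} {c : ℝ}
    (hf : DifferentiableAt ℝ f x) (hg : DifferentiableAt ℝ g x)
    (hc : ∀ v, fderiv ℝ g x v = c * inner ℝ x v) :
    dirac (fun y => g y • f y) x = g x • dirac f x + c • clifford x (f x) := by
  simp only [dirac, clifford, fderiv_fun_smul hg hf]
  simp only [add_apply, smul_apply,
    ContinuousLinearMap.smulRight_apply, hc, inner_basisVec, map_add, pauliOp_real_smul,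
    Finset.sum_add_distrib, Finset.smul_sum, mul_smul]

lemma contDiff_clifford {f : Space → Spinor} {n : WithTop ℕ∞} (hf : ContDiff ℝ n f) :
    ContDiff ℝ n (fun x => clifford x (f x)) := by
  unfold clifford
  refine ContDiff.sum fun k _ => ContDiff.smul
    (EuclideanSpace.proj k : Space →L[ℝ] ℝ).contDiff ?_
  exact ((pauliOp k).restrictScalars ℝ).contDiff.comp hf

lemma contDiff_dirac {f : Space → Spinor} (hf : ContDiff ℝ ∞ f) : ContDiff ℝ ∞ (dirac f) := by
  unfold dirac
  refine ContDiff.sum fun k _ => ?_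
  exact ((pauliOp k).restrictScalars ℝ).contDiff.comp
    ((hf.fderiv_right (by simp)).clm_apply contDiff_const)

lemma fderiv_clifford {f : Space → Spinor} {x : Space} (hf : DifferentiableAt ℝ f x)
    (v : Space) :
    fderiv ℝ (fun y => clifford y (f y)) x v = clifford v (f x) + clifford x (fderiv ℝ f x v) := by
  have hk : ∀ k, HasFDerivAt (fun y : Space => y k • pauliOp k (f y))
      (x k • ((pauliOp k).restrictScalars ℝ).comp (fderiv ℝ f x) +
        (EuclideanSpace.proj k : Space →L[ℝ] ℝ).smulRight (pauliOp k (f x))) x := fun k =>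
    (EuclideanSpace.proj k : Space →L[ℝ] ℝ).hasFDerivAt.smul
      (((pauliOp k).restrictScalars ℝ).hasFDerivAt.comp x hf.hasFDerivAt)
  have h := HasFDerivAt.fun_sum (u := Finset.univ) fun k _ => hk k
  unfold clifford
  rw [h.fderiv]
  simp [Finset.sum_add_distrib, add_comm]

lemma clifford_basisVec (k : Fin 3) (v : Spinor) : clifford (basisVec k) v = pauliOp k v := by
  fin_cases k <;> simp [clifford, basisVec]

/-- The commutation relation `(σ · ∇) (σ · x) + (σ · x) (σ · ∇) = 3 + 2 x · ∇`. -/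
lemma dirac_clifford {f : Space → Spinor} {x : Space} (hf : DifferentiableAt ℝ f x) :
    dirac (fun y => clifford y (f y)) x
      = (3 : ℝ) • f x + (2 : ℝ) • fderiv ℝ f x x - clifford x (dirac f x) := by
  rw [← sum_smul_apply_basisVec (fderiv ℝ f x) x]
  have h01 := fun v => pauliOp_swap (show (1 : Fin 3) ≠ 0 by decide) v
  have h02 := fun v => pauliOp_swap (show (2 : Fin 3) ≠ 0 by decide) v
  have h12 := fun v => pauliOp_swap (show (2 : Fin 3) ≠ 1 by decide) v
  simp only [dirac, fderiv_clifford hf, clifford_basisVec]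
  simp only [clifford, Fin.sum_univ_three, map_add, pauliOp_real_smul, pauliOp_sq, h01, h02, h12]
  module

/-- The scaling commutation relation `[σ · ∇, x · ∇] = σ · ∇`. -/
lemma dirac_euler {f : Space → Spinor} (hf : ContDiff ℝ ∞ f) (x : Space) :
    dirac (fun y => fderiv ℝ f y y) x = dirac f x + fderiv ℝ (dirac f) x x := by
  have hd : Differentiable ℝ (fderiv ℝ f) :=
    (hf.fderiv_right (m := ∞) (by simp)).differentiable (by simp)
  have hsymm : ∀ v w, fderiv ℝ (fderiv ℝ f) x v w = fderiv ℝ (fderiv ℝ f) x w v := by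
    have := (hf.contDiffAt (x := x)).isSymmSndFDerivAt (by simp; exact WithTop.coe_le_coe.2 le_top)
    exact fun v w => this v w
  have h1 : ∀ v, fderiv ℝ (fun y => fderiv ℝ f y y) x v
      = fderiv ℝ f x v + fderiv ℝ (fderiv ℝ f) x v x := by
    intro v
    have h := (hd x).hasFDerivAt.clm_apply (hasFDerivAt_id x)
    simp only [id] at h
    rw [h.fderiv]
    simp
  have h2 : fderiv ℝ (dirac f) x x
      = ∑ k, pauliOp k (fderiv ℝ (fderiv ℝ f) x x (basisVec k)) := by
    have hk : ∀ k, HasFDerivAt (fun y => pauliOp k (fderiv ℝ f y (basisVec k)))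
        (((pauliOp k).restrictScalars ℝ).comp
          ((fderiv ℝ (fderiv ℝ f) x).flip (basisVec k))) x := by
      intro k
      refine ((pauliOp k).restrictScalars ℝ).hasFDerivAt.comp x ?_
      have := (hd x).hasFDerivAt.clm_apply (hasFDerivAt_const (basisVec k) x)
      simpa using this
    have h := HasFDerivAt.fun_sum (u := Finset.univ) fun k _ => hk k
    unfold dirac
    rw [h.fderiv]
    simp
  rw [h2]
  simp only [dirac, h1, map_add, Finset.sum_add_distrib]
  congr 1
  exact Finset.sum_congr rfl fun k _ => by rw [hsymm]

/-! ### Eigenfunctions of the spin-orbit operator -/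

lemma spinOrbit_add {f g : Space → Spinor} {x : Space} (hf : DifferentiableAt ℝ f x)
    (hg : DifferentiableAt ℝ g x) : spinOrbit (f + g) x = spinOrbit f x + spinOrbit g x := by
  simp only [spinOrbit, dirac_add hf hg, fderiv_add hf hg, clifford_add, Pi.add_apply, add_apply]
  abel

lemma spinOrbit_const_smul (f : Space → Spinor) (x : Space) (c : ℝ) :
    spinOrbit (c • f) x = c • spinOrbit f x := by
  simp only [spinOrbit, dirac_const_smul, fderiv_const_smul_field, clifford_smul, Pi.smul_apply,
    smul_apply, smul_add, smul_sub]

/-- The smooth spinor fields `f` on `ℝ³` with `K f = k f`. -/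
noncomputable def spinOrbitEigenspace (k : ℤ) : Submodule ℝ (Space → Spinor) where
  carrier := {f | ContDiff ℝ ∞ f ∧ ∀ x, spinOrbit f x = (k : ℝ) • f x}
  zero_mem' := by
    refine ⟨contDiff_const, fun x => ?_⟩
    have h := spinOrbit_const_smul 0 x 0
    rw [zero_smul, zero_smul] at h
    rw [h, Pi.zero_apply, smul_zero]
  add_mem' := by
    rintro f g ⟨hf, hf'⟩ ⟨hg, hg'⟩
    refine ⟨hf.add hg, fun x => ?_⟩
    rw [spinOrbit_add (hf.differentiable (by simp) x) (hg.differentiable (by simp) x), hf', hg',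
      Pi.add_apply, smul_add]
  smul_mem' := by
    rintro c f ⟨hf, hf'⟩
    refine ⟨contDiff_const.smul hf, fun x => ?_⟩
    rw [spinOrbit_const_smul, hf', Pi.smul_apply, smul_comm]

/-- On an eigenfunction, `σ · ∇` acts as `(σ · x / r) (∂ᵣ - (k - 1) / r)`. -/
lemma clifford_dirac_of_mem {k : ℤ} {f : Space → Spinor} (hf : f ∈ spinOrbitEigenspace k)
    (x : Space) : clifford x (dirac f x) = fderiv ℝ f x x - ((k : ℝ) - 1) • f x := by
  have h := hf.2 x
  rw [spinOrbit, sub_eq_iff_eq_add] at h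
  rw [sub_smul, one_smul, eq_sub_iff_add_eq, ← sub_eq_iff_eq_add.2 h]
  abel

/-- The operator `K` commutes with multiplication by radial functions. -/
lemma radial_smul_mem {k : ℤ} {f : Space → Spinor} {g c : Space → ℝ}
    (hf : f ∈ spinOrbitEigenspace k) (hg : ContDiff ℝ ∞ g)
    (hc : ∀ x v, fderiv ℝ g x v = c x * inner ℝ x v) :
    (fun x => g x • f x) ∈ spinOrbitEigenspace k := by
  refine ⟨hg.smul hf.1, fun x => ?_⟩
  have hfx := hf.1.differentiable (by simp) x
  have hgx := hg.differentiable (by simp) x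
  have h := hf.2 x
  rw [spinOrbit] at h ⊢
  rw [dirac_radial_smul hfx hgx (hc x), fderiv_fun_smul hgx hfx, smul_comm, ← h]
  simp only [add_apply, smul_apply, ContinuousLinearMap.smulRight_apply, hc, clifford_add,
    clifford_smul, clifford_clifford, real_inner_self_eq_norm_sq]
  module

/-- The Dirac operator anticommutes with `K`. -/
lemma dirac_mem {k : ℤ} {f : Space → Spinor} (hf : f ∈ spinOrbitEigenspace k) :
    dirac f ∈ spinOrbitEigenspace (-k) := by
  have hD := contDiff_dirac hf.1
  refine ⟨hD, fun x => ?_⟩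
  have h1 := dirac_clifford (hD.differentiable (by simp) x)
  have hE : ContDiff ℝ ∞ fun y => fderiv ℝ f y y :=
    (hf.1.fderiv_right (m := ∞) (by simp)).clm_apply contDiff_id
  have hfun : (fun y => clifford y (dirac f y))
      = (fun y => fderiv ℝ f y y) + (-((k : ℝ) - 1)) • f := by
    funext y
    rw [clifford_dirac_of_mem hf, Pi.add_apply, Pi.smul_apply, neg_smul, sub_eq_add_neg]
  have hS : ContDiff ℝ ∞ ((-((k : ℝ) - 1)) • f) := contDiff_const.smul hf.1
  rw [hfun, dirac_add (hE.differentiable (by simp) x) (hS.differentiable (by simp) x),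
    dirac_euler hf.1, dirac_const_smul] at h1
  have h2 : clifford x (dirac (dirac f) x) = (3 : ℝ) • dirac f x
      + (2 : ℝ) • fderiv ℝ (dirac f) x x
      - (dirac f x + fderiv ℝ (dirac f) x x + -((k : ℝ) - 1) • dirac f x) := by
    rw [h1]; abel
  rw [spinOrbit, h2]
  push_cast
  module

/-! ### Decomposition of homogeneous fields -/

/-- Smooth fields with `f (t x) = tⁿ f x` for all real `t`; these are the homogeneous polynomials
of degree `n`. -/
def IsHomogeneous (n : ℕ) (f : Space → Spinor) : Prop :=
  ContDiff ℝ ∞ f ∧ ∀ (t : ℝ) x, f (t • x) = t ^ n • f x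

/-- Euler's identity for homogeneous fields. -/
lemma IsHomogeneous.euler {n : ℕ} {f : Space → Spinor} (hf : IsHomogeneous n f) (x : Space) :
    fderiv ℝ f x x = (n : ℝ) • f x := by
  have h1 : HasDerivAt (fun t : ℝ => f (t • x)) (fderiv ℝ f x x) 1 := by
    have hd : HasFDerivAt f (fderiv ℝ f x) ((1 : ℝ) • x) := by
      rw [one_smul]; exact (hf.1.differentiable (by simp) x).hasFDerivAt
    have := hd.comp_hasDerivAt (1 : ℝ) ((hasDerivAt_id (1 : ℝ)).smul_const x)
    simpa [Function.comp_def] using this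
  have h2 : HasDerivAt (fun t : ℝ => f (t • x)) ((n : ℝ) • f x) 1 := by
    simp only [hf.2]
    have := (hasDerivAt_pow n (1 : ℝ)).smul_const (f x)
    simpa using this
  exact h1.unique h2

lemma IsHomogeneous.fderiv_smul {n : ℕ} {f : Space → Spinor} (hf : IsHomogeneous (n + 1) f)
    (t : ℝ) (x v : Space) : fderiv ℝ f (t • x) v = t ^ n • fderiv ℝ f x v := by
  have hcont : Continuous (fderiv ℝ f) := hf.1.continuous_fderiv (by simp)
  have key : (fun t : ℝ => fderiv ℝ f (t • x) v) = fun t => t ^ n • fderiv ℝ f x v := by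
    refine Continuous.ext_on (dense_compl_singleton (0 : ℝ)) (by fun_prop) (by fun_prop) ?_
    intro t (ht : t ≠ 0)
    have h1 : HasFDerivAt (fun y => f (t • y)) (t • fderiv ℝ f (t • x)) x := by
      have := (hf.1.differentiable (by simp) (t • x)).hasFDerivAt.comp x
        ((hasFDerivAt_id x).const_smul t)
      refine this.congr_fderiv ?_
      ext w; simp
    have h2 : HasFDerivAt (fun y => f (t • y)) (t ^ (n + 1) • fderiv ℝ f x) x := by
      simp only [hf.2]
      exact (hf.1.differentiable (by simp) x).hasFDerivAt.const_smul
        (t ^ (n + 1))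
    have h := congrArg (fun T : Space →L[ℝ] Spinor => t⁻¹ • T v) (h1.unique h2)
    simp only [smul_apply, smul_smul, pow_succ'] at h
    rwa [← mul_assoc, inv_mul_cancel₀ ht, one_smul, one_mul] at h
  exact congrFun key t

lemma IsHomogeneous.dirac {n : ℕ} {f : Space → Spinor} (hf : IsHomogeneous (n + 1) f) :
    IsHomogeneous n (dirac f) := by
  refine ⟨contDiff_dirac hf.1, fun t x => ?_⟩
  simp only [DiracHardy.dirac, hf.fderiv_smul, pauliOp_real_smul, Finset.smul_sum]

lemma IsHomogeneous.clifford {n : ℕ} {f : Space → Spinor} (hf : IsHomogeneous n f) :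
    IsHomogeneous (n + 1) fun x => clifford x (f x) := by
  refine ⟨contDiff_clifford hf.1, fun t x => ?_⟩
  simp only [hf.2, DiracHardy.clifford, PiLp.smul_apply, pauliOp_real_smul, Finset.smul_sum,
    smul_smul, smul_eq_mul]
  exact Finset.sum_congr rfl fun k _ => by ring_nf

lemma IsHomogeneous.sub {n : ℕ} {f g : Space → Spinor} (hf : IsHomogeneous n f)
    (hg : IsHomogeneous n g) : IsHomogeneous n (f - g) :=
  ⟨hf.1.sub hg.1, fun t x => by simp [hf.2, hg.2, smul_sub]⟩

lemma IsHomogeneous.add {n : ℕ} {f g : Space → Spinor} (hf : IsHomogeneous n f)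
    (hg : IsHomogeneous n g) : IsHomogeneous n (f + g) :=
  ⟨hf.1.add hg.1, fun t x => by simp [hf.2, hg.2, smul_add]⟩

lemma IsHomogeneous.const_smul {n : ℕ} {f : Space → Spinor} (hf : IsHomogeneous n f) (c : ℝ) :
    IsHomogeneous n (c • f) :=
  ⟨contDiff_const.smul hf.1, fun t x => by simp [hf.2, smul_comm c]⟩

/-- A homogeneous field in the kernel of `σ · ∇` is an eigenfunction of `K`. -/
lemma IsHomogeneous.mem_of_dirac_eq_zero {n : ℕ} {f : Space → Spinor} (hf : IsHomogeneous n f)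
    (h0 : DiracHardy.dirac f = 0) : f ∈ spinOrbitEigenspace (n + 1) := by
  refine ⟨hf.1, fun x => ?_⟩
  rw [spinOrbit, h0, hf.euler]
  have : DiracHardy.clifford x ((0 : Space → Spinor) x) = 0 := by simp [DiracHardy.clifford]
  rw [this]
  push_cast
  module

/-- Homogeneous eigenfunctions of degree `n` with the eigenvalues that occur in that degree. -/
def homogeneousEigenfunctions (n : ℕ) : Set (Space → Spinor) :=
  {f | IsHomogeneous n f ∧ ∃ k : ℤ, k ≠ 0 ∧ |k| ≤ n + 1 ∧ f ∈ spinOrbitEigenspace k}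

lemma isHomogeneous_of_mem_span {n : ℕ} {f : Space → Spinor}
    (hf : f ∈ Submodule.span ℝ (homogeneousEigenfunctions n)) : IsHomogeneous n f := by
  induction hf using Submodule.span_induction with
  | mem f hf => exact hf.1
  | zero => exact ⟨contDiff_const, fun t x => by simp⟩
  | add f g _ _ hf hg => exact hf.add hg
  | smul c f _ hf => exact hf.const_smul c

/-- On an eigenfunction `ψ` of degree `n`, one has `(σ · ∇) (σ · x) ψ = (n + 2 + k) ψ`; as `|k|` is
at most `n + 1`, the factor does not vanish, so `σ · ∇` has a right inverse. -/
lemma exists_dirac_eq {n : ℕ} {f : Space → Spinor}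
    (hf : f ∈ Submodule.span ℝ (homogeneousEigenfunctions n)) :
    ∃ q ∈ Submodule.span ℝ (homogeneousEigenfunctions (n + 1)), dirac q = f := by
  induction hf using Submodule.span_induction with
  | mem f hf =>
    obtain ⟨hf, k, hk0, hkn, hk⟩ := hf
    have hkn' : (-(n + 1 : ℝ)) ≤ k ∧ (k : ℝ) ≤ n + 1 := by
      have h := abs_le.1 hkn
      exact ⟨by exact_mod_cast h.1, by exact_mod_cast h.2⟩
    have hne : (n + 2 + k : ℝ) ≠ 0 := by linarith [hkn'.1]
    have hD : ∀ x, dirac (fun y => clifford y (f y)) x = (n + 2 + k : ℝ) • f x := by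
      intro x
      rw [dirac_clifford (hf.1.differentiable (by simp) x), clifford_dirac_of_mem hk, hf.euler]
      module
    refine ⟨(n + 2 + k : ℝ)⁻¹ • fun y => clifford y (f y), ?_, ?_⟩
    · refine Submodule.smul_mem _ _ (Submodule.subset_span ⟨hf.clifford, -k, by simpa using hk0,
        by rw [abs_neg]; push_cast; linarith, hf.clifford.1, fun x => ?_⟩)
      rw [spinOrbit, hD, hf.clifford.euler, clifford_smul]
      push_cast
      module
    · funext x
      rw [dirac_const_smul, hD, smul_smul, inv_mul_cancel₀ hne, one_smul]
  | zero =>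
    refine ⟨0, Submodule.zero_mem _, ?_⟩
    funext x
    have := dirac_const_smul (f := 0) (x := x) 0
    rwa [zero_smul, zero_smul] at this
  | add f g _ _ hf hg =>
    obtain ⟨p, hp, rfl⟩ := hf
    obtain ⟨q, hq, rfl⟩ := hg
    refine ⟨p + q, Submodule.add_mem _ hp hq, ?_⟩
    funext x
    exact dirac_add ((isHomogeneous_of_mem_span hp).1.differentiable (by simp) x)
      ((isHomogeneous_of_mem_span hq).1.differentiable (by simp) x)
  | smul c f _ hf =>
    obtain ⟨p, hp, rfl⟩ := hf
    exact ⟨c • p, Submodule.smul_mem _ _ hp, funext fun x => dirac_const_smul c⟩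

/-- Fischer decomposition: a homogeneous field is a sum of eigenfunctions of `K`. -/
theorem IsHomogeneous.mem_span {n : ℕ} {p : Space → Spinor} (hp : IsHomogeneous n p) :
    p ∈ Submodule.span ℝ (homogeneousEigenfunctions n) := by
  induction n generalizing p with
  | zero =>
    -- the field is constant, hence in the kernel of `σ · ∇`
    refine Submodule.subset_span ⟨hp, 1, one_ne_zero, by simp, ?_⟩
    have hconst : p = fun _ => p 0 := by
      funext x
      have := hp.2 0 x
      rw [zero_smul, pow_zero, one_smul] at this
      exact this.symm
    have h := hp.mem_of_dirac_eq_zero (by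
      funext x
      rw [hconst]
      simp [DiracHardy.dirac])
    simpa using h
  | succ n ih =>
    -- correct `p` by a sum of eigenfunctions `q` so that `p - q` lies in the kernel of `σ · ∇`
    obtain ⟨q, hq, hqp⟩ := exists_dirac_eq (ih hp.dirac)
    have hqh := isHomogeneous_of_mem_span hq
    have hd : DiracHardy.dirac (p - q) = 0 := by
      funext x
      have := dirac_add (hp.1.differentiable (by simp) x)
        ((hqh.const_smul (-1)).1.differentiable (by simp) x)
      rw [dirac_const_smul, hqp, neg_one_smul, neg_one_smul, ← sub_eq_add_neg] at this
      rw [this]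
      simp
    have := Submodule.add_mem _ hq (Submodule.subset_span (R := ℝ)
      (s := homogeneousEigenfunctions (n + 1)) ⟨hp.sub hqh, ((n + 1 : ℕ) : ℤ) + 1, by positivity,
        le_of_eq (abs_of_nonneg (by positivity)),
        (hp.sub hqh).mem_of_dirac_eq_zero hd⟩)
    simpa using this

/-- The eigenvalue `0` does not occur in the decomposition: degree `0` fields have `k = 1`, and
raising the degree only changes the sign of eigenvalues or adds the kernel of `σ · ∇`, with
`k = n + 1`. -/
theorem IsHomogeneous.mem_iSup {n : ℕ} {p : Space → Spinor} (hp : IsHomogeneous n p) :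
    p ∈ ⨆ k : {k : ℤ // k ≠ 0}, spinOrbitEigenspace k := by
  refine Submodule.span_le.2 ?_ hp.mem_span
  rintro f ⟨-, k, hk0, -, hk⟩
  exact Submodule.mem_iSup_of_mem (⟨k, hk0⟩ : {k : ℤ // k ≠ 0}) hk

/-! ### Rotation-invariant measures and orthogonality of eigenfunctions -/

/-- Measures on `ℝ³` that are invariant under all linear isometries. -/
def IsRotationInvariant (μ : Measure Space) : Prop :=
  ∀ T : Space ≃ₗᵢ[ℝ] Space, MeasurePreserving T μ μ

/-- The velocity field `xⱼ eₖ - xₖ eⱼ` of the rotation in the plane of `eⱼ` and `eₖ`. -/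
noncomputable def rotationField (j k : Fin 3) (x : Space) : Space :=
  x j • basisVec k - x k • basisVec j

/-- The rotation by the angle `t` in the plane of `eⱼ` and `eₖ`. -/
noncomputable def planeRotation (j k : Fin 3) (t : ℝ) (x : Space) : Space :=
  x + (Real.cos t - 1) • (x j • basisVec j + x k • basisVec k) + Real.sin t • rotationField j k x

lemma norm_planeRotation {j k : Fin 3} (h : j ≠ k) (t : ℝ) (x : Space) :
    ‖planeRotation j k t x‖ = ‖x‖ := by
  have hcs := Real.sin_sq_add_cos_sq t
  refine (sq_eq_sq₀ (norm_nonneg _) (norm_nonneg _)).1 ?_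
  rw [EuclideanSpace.real_norm_sq_eq, EuclideanSpace.real_norm_sq_eq]
  have key : ∀ a b s c : ℝ, s ^ 2 + c ^ 2 = 1 →
      (a + (c - 1) * a - s * b) ^ 2 + (b + (c - 1) * b + s * a) ^ 2 = a ^ 2 + b ^ 2 := by
    intro a b s c hsc
    linear_combination (a ^ 2 + b ^ 2) * hsc
  have h1 := key (x j) (x k) _ _ hcs
  fin_cases j <;> fin_cases k <;> first | exact absurd rfl h | skip
  all_goals
    simp [planeRotation, rotationField, basisVec, Fin.sum_univ_three] at h1 ⊢
    linear_combination h1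

/-- The rotation in a coordinate plane as a linear isometry. -/
noncomputable def planeRotationIsometry {j k : Fin 3} (h : j ≠ k) (t : ℝ) :
    Space ≃ₗᵢ[ℝ] Space :=
  LinearIsometry.toLinearIsometryEquiv
    { toFun := planeRotation j k t
      map_add' := fun x y => by
        simp only [planeRotation, rotationField, PiLp.add_apply]
        module
      map_smul' := fun c x => by
        simp only [planeRotation, rotationField, PiLp.smul_apply, smul_eq_mul, RingHom.id_apply]
        module
      norm_map' := norm_planeRotation h t } rfl

lemma hasDerivAt_planeRotation (j k : Fin 3) (t : ℝ) (x : Space) :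
    HasDerivAt (fun t => planeRotation j k t x)
      ((-Real.sin t) • (x j • basisVec j + x k • basisVec k)
        + Real.cos t • rotationField j k x) t := by
  have h1 := ((Real.hasDerivAt_cos t).sub_const 1).smul_const
    (x j • basisVec j + x k • basisVec k)
  have h2 := (Real.hasDerivAt_sin t).smul_const (rotationField j k x)
  have := ((hasDerivAt_const t x).add h1).add h2
  exact HasDerivAt.congr_deriv (f := fun t => planeRotation j k t x) this (by simp)

/-- The velocity of the rotation is bounded uniformly in the angle; this is the domination that
allows differentiation under the integral. -/
lemma norm_deriv_planeRotation_le (j k : Fin 3) (t : ℝ) (x : Space) :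
    ‖(-Real.sin t) • (x j • basisVec j + x k • basisVec k)
        + Real.cos t • rotationField j k x‖ ≤ 4 * ‖x‖ := by
  have hx : ∀ i l, ‖x i • basisVec l‖ ≤ ‖x‖ := fun i l => by
    rw [norm_smul, norm_basisVec, mul_one]
    exact PiLp.norm_apply_le x i
  have h1 : ‖x j • basisVec j + x k • basisVec k‖ ≤ ‖x‖ + ‖x‖ :=
    norm_add_le_of_le (hx _ _) (hx _ _)
  have h2 : ‖rotationField j k x‖ ≤ ‖x‖ + ‖x‖ := norm_sub_le_of_le (hx _ _) (hx _ _)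
  have hs : ‖-Real.sin t‖ ≤ 1 := by rw [norm_neg]; exact Real.abs_sin_le_one t
  have hc : ‖Real.cos t‖ ≤ 1 := Real.abs_cos_le_one t
  calc _ ≤ ‖-Real.sin t‖ * ‖x j • basisVec j + x k • basisVec k‖
        + ‖Real.cos t‖ * ‖rotationField j k x‖ := by
        refine (norm_add_le _ _).trans_eq ?_
        rw [norm_smul, norm_smul]
    _ ≤ 1 * (‖x‖ + ‖x‖) + 1 * (‖x‖ + ‖x‖) := by gcongr
    _ = _ := by ring

lemma continuous_rotationField (j k : Fin 3) : Continuous (rotationField j k) := by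
  unfold rotationField
  fun_prop

lemma continuous_planeRotation (j k : Fin 3) (t : ℝ) : Continuous (planeRotation j k t) := by
  have := continuous_rotationField j k
  unfold planeRotation
  fun_prop

/-- Angular derivatives integrate to zero against rotation-invariant measures. -/
theorem integral_fderiv_rotationField {μ : Measure Space} [IsFiniteMeasureOnCompacts μ]
    (hμ : IsRotationInvariant μ) {j k : Fin 3} (h : j ≠ k) {F : Space → ℂ} (hF : ContDiff ℝ 1 F)
    (hc : HasCompactSupport F) : ∫ x, fderiv ℝ F x (rotationField j k x) ∂μ = 0 := by
  have hdF : Continuous (fderiv ℝ F) := hF.continuous_fderiv (by simp)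
  obtain ⟨C, hC⟩ := (hc.fderiv (𝕜 := ℝ)).exists_bound_of_continuous hdF
  obtain ⟨ρ, hρ⟩ := (hc.fderiv (𝕜 := ℝ)).isCompact.isBounded.subset_closedBall 0
  have hC0 : 0 ≤ C := (norm_nonneg _).trans (hC 0)
  have hzero : ∀ y, y ∉ Metric.closedBall (0 : Space) ρ → fderiv ℝ F y = 0 := fun y hy => by
    by_contra hne
    exact hy (hρ (subset_tsupport _ hne))
  have hder := hasDerivAt_integral_of_dominated_loc_of_deriv_le (μ := μ) (x₀ := (0 : ℝ))
    (F := fun t x => F (planeRotation j k t x))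
    (F' := fun t x => fderiv ℝ F (planeRotation j k t x)
      ((-Real.sin t) • (x j • basisVec j + x k • basisVec k)
        + Real.cos t • rotationField j k x))
    (bound := (Metric.closedBall (0 : Space) ρ).indicator fun _ => C * (4 * ρ))
    (s := univ) univ_mem
    (Eventually.of_forall fun t =>
      (hF.continuous.comp (continuous_planeRotation j k t)).aestronglyMeasurable)
    (by
      have : (fun x => F (planeRotation j k 0 x)) = F := by
        funext x; simp [planeRotation]
      rw [this]
      exact hF.continuous.integrable_of_hasCompactSupport hc)
    (by
      have h1 := continuous_planeRotation j k 0
      have h2 := continuous_rotationField j k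
      exact (Continuous.clm_apply (hdF.comp h1) (by fun_prop)).aestronglyMeasurable)
    (Eventually.of_forall fun x t _ => by
      by_cases hx : x ∈ Metric.closedBall (0 : Space) ρ
      · rw [indicator_of_mem hx]
        refine (ContinuousLinearMap.le_opNorm _ _).trans ?_
        refine mul_le_mul (hC _) ((norm_deriv_planeRotation_le j k t x).trans ?_)
          (norm_nonneg _) hC0
        rw [mem_closedBall_zero_iff] at hx
        linarith
      · rw [indicator_of_notMem hx, hzero]
        · simp
        · rwa [mem_closedBall_zero_iff, norm_planeRotation h, ← mem_closedBall_zero_iff])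
    ((integrable_indicator_iff Metric.isClosed_closedBall.measurableSet).2
      (integrableOn_const (isCompact_closedBall 0 ρ).measure_lt_top.ne))
    (Eventually.of_forall fun x t _ =>
      ((hF.differentiable (by simp) _).hasFDerivAt.comp_hasDerivAt t
        (hasDerivAt_planeRotation j k t x)))
  -- by invariance of `μ` the integral that has just been differentiated does not depend on `t`
  have hconst : (fun t : ℝ => ∫ x, F (planeRotation j k t x) ∂μ) = fun _ => ∫ x, F x ∂μ := by
    funext t
    exact (hμ (planeRotationIsometry h t)).integral_comp
      (planeRotationIsometry h t).toHomeomorph.measurableEmbedding F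
  have h0 := hder.2
  rw [hconst] at h0
  have := h0.unique (hasDerivAt_const (0 : ℝ) (∫ x, F x ∂μ))
  simpa [planeRotation] using this

/-- `K` in terms of the angular derivatives. -/
lemma spinOrbit_eq (f : Space → Spinor) (x : Space) :
    spinOrbit f x = f x - (pauliOp 0 (pauliOp 1 (fderiv ℝ f x (rotationField 0 1 x)))
      + pauliOp 0 (pauliOp 2 (fderiv ℝ f x (rotationField 0 2 x)))
      + pauliOp 1 (pauliOp 2 (fderiv ℝ f x (rotationField 1 2 x)))) := by
  have h01 := fun v => pauliOp_swap (show (1 : Fin 3) ≠ 0 by decide) v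
  have h02 := fun v => pauliOp_swap (show (2 : Fin 3) ≠ 0 by decide) v
  have h12 := fun v => pauliOp_swap (show (2 : Fin 3) ≠ 1 by decide) v
  rw [spinOrbit, ← sum_smul_apply_basisVec (fderiv ℝ f x) x]
  simp only [rotationField, dirac, clifford, Fin.sum_univ_three, map_add, map_sub, map_smul,
    pauliOp_real_smul, pauliOp_sq, h01, h02, h12]
  module

lemma inner_pauliOp_pauliOp {j k : Fin 3} (h : j ≠ k) (u v : Spinor) :
    inner ℂ (pauliOp j (pauliOp k u)) v = -inner ℂ u (pauliOp j (pauliOp k v)) := by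
  rw [inner_pauliOp_left, inner_pauliOp_left, pauliOp_swap h.symm, inner_neg_right]

/-- Eigenfunctions of `K` for different eigenvalues are orthogonal in `L²(μ)` for every
rotation-invariant measure `μ`, because `K` is symmetric there. -/
theorem integral_inner_eq_zero {μ : Measure Space} [IsFiniteMeasureOnCompacts μ]
    (hμ : IsRotationInvariant μ) {k l : ℤ} (hkl : k ≠ l) {f g : Space → Spinor}
    (hf : f ∈ spinOrbitEigenspace k) (hg : g ∈ spinOrbitEigenspace l)
    (hc : HasCompactSupport f) : ∫ x, inner ℂ (f x) (g x) ∂μ = 0 := by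
  have hSg : ∀ i j : Fin 3, ContDiff ℝ ∞ fun x => pauliOp i (pauliOp j (g x)) := fun i j =>
    ((pauliOp i).restrictScalars ℝ).contDiff.comp
      (((pauliOp j).restrictScalars ℝ).contDiff.comp hg.1)
  have hF : ∀ i j : Fin 3, ContDiff ℝ ∞ fun x => inner ℂ (f x) (pauliOp i (pauliOp j (g x))) :=
    fun i j => hf.1.inner ℂ (hSg i j)
  have hFc : ∀ i j : Fin 3,
      HasCompactSupport fun x => inner ℂ (f x) (pauliOp i (pauliOp j (g x))) := fun i j =>
    hc.mono fun x hx => by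
      contrapose! hx
      simp only [Function.mem_support, not_not] at hx ⊢
      rw [hx, inner_zero_left]
  have hderiv : ∀ (i j : Fin 3) (x v : Space),
      fderiv ℝ (fun x => inner ℂ (f x) (pauliOp i (pauliOp j (g x)))) x v
        = inner ℂ (fderiv ℝ f x v) (pauliOp i (pauliOp j (g x)))
          + inner ℂ (f x) (pauliOp i (pauliOp j (fderiv ℝ g x v))) := by
    intro i j x v
    have h1 := (hf.1.differentiable (by simp) x).hasFDerivAt
    have h2 : HasFDerivAt (fun x => pauliOp i (pauliOp j (g x)))
        (((pauliOp i).restrictScalars ℝ).comp (((pauliOp j).restrictScalars ℝ).comp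
          (fderiv ℝ g x))) x :=
      ((pauliOp i).restrictScalars ℝ).hasFDerivAt.comp x
        (((pauliOp j).restrictScalars ℝ).hasFDerivAt.comp x
          (hg.1.differentiable (by simp) x).hasFDerivAt)
    rw [(h1.inner ℂ h2).fderiv]
    simp [add_comm]
  have hint : ∀ i j : Fin 3, Integrable (fun x =>
      fderiv ℝ (fun x => inner ℂ (f x) (pauliOp i (pauliOp j (g x)))) x
        (rotationField i j x)) μ := fun i j =>
    (Continuous.clm_apply ((hF i j).continuous_fderiv (by simp))
      (continuous_rotationField i j)).integrable_of_hasCompactSupport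
        (((hFc i j).fderiv (𝕜 := ℝ)).mono fun x hx => by
          contrapose! hx
          simp only [Function.mem_support, not_not] at hx ⊢
          rw [hx]; simp)
  -- `⟨K f, g⟩ - ⟨f, K g⟩` is a sum of angular derivatives
  have hpt : ∀ x, ((k : ℂ) - l) * inner ℂ (f x) (g x)
      = fderiv ℝ (fun x => inner ℂ (f x) (pauliOp 0 (pauliOp 1 (g x)))) x (rotationField 0 1 x)
        + fderiv ℝ (fun x => inner ℂ (f x) (pauliOp 0 (pauliOp 2 (g x)))) x (rotationField 0 2 x)
        + fderiv ℝ (fun x => inner ℂ (f x) (pauliOp 1 (pauliOp 2 (g x)))) x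
          (rotationField 1 2 x) := by
    intro x
    have h1 : inner ℂ (spinOrbit f x) (g x) - inner ℂ (f x) (spinOrbit g x)
        = ((k : ℂ) - l) * inner ℂ (f x) (g x) := by
      rw [hf.2, hg.2, inner_smul_left_eq_smul, inner_smul_right_eq_smul, Complex.real_smul,
        Complex.real_smul, sub_mul]
      push_cast
      rfl
    rw [← h1, spinOrbit_eq, spinOrbit_eq]
    simp only [hderiv, inner_sub_left, inner_sub_right, inner_add_left, inner_add_right]
    rw [inner_pauliOp_pauliOp (by decide), inner_pauliOp_pauliOp (by decide),
      inner_pauliOp_pauliOp (by decide)]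
    ring
  have h0 : ((k : ℂ) - l) * ∫ x, inner ℂ (f x) (g x) ∂μ = 0 := by
    rw [← integral_const_mul]
    simp only [hpt]
    refine (integral_add ((hint 0 1).add (hint 0 2)) (hint 1 2)).trans ?_
    simp only [Pi.add_apply]
    rw [integral_add (hint 0 1) (hint 0 2),
      integral_fderiv_rotationField hμ (by decide) ((hF 0 1).of_le (by simp)) (hFc 0 1),
      integral_fderiv_rotationField hμ (by decide) ((hF 0 2).of_le (by simp)) (hFc 0 2),
      integral_fderiv_rotationField hμ (by decide) ((hF 1 2).of_le (by simp)) (hFc 1 2)]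
    simp
  refine (mul_eq_zero.1 h0).resolve_left (sub_ne_zero.2 ?_)
  exact_mod_cast hkl

/-- Pythagoras for a finite sum of eigenfunctions with different eigenvalues. -/
theorem integral_norm_sq_sum {μ : Measure Space} [IsFiniteMeasureOnCompacts μ]
    (hμ : IsRotationInvariant μ) {ι : Type*} (s : Finset ι) {e : ι → ℤ}
    (he : Function.Injective e) {P : ι → Space → Spinor}
    (hP : ∀ i, P i ∈ spinOrbitEigenspace (e i)) (hc : ∀ i, HasCompactSupport (P i)) :
    ∫ x, ‖∑ i ∈ s, P i x‖ ^ 2 ∂μ = ∑ i ∈ s, ∫ x, ‖P i x‖ ^ 2 ∂μ := by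
  have hint : ∀ i j, Integrable (fun x => inner ℂ (P i x) (P j x)) μ := fun i j =>
    ((hP i).1.continuous.inner (hP j).1.continuous).integrable_of_hasCompactSupport
      ((hc i).mono fun x hx => by
        contrapose! hx
        simp only [Function.mem_support, not_not] at hx ⊢
        rw [hx, inner_zero_left])
  have hsq : ∀ v : Spinor, ((‖v‖ ^ 2 : ℝ) : ℂ) = inner ℂ v v := fun v => by
    rw [inner_self_eq_norm_sq_to_K]; push_cast; rfl
  apply Complex.ofReal_injective
  rw [← integral_complex_ofReal, Complex.ofReal_sum]
  simp only [← integral_complex_ofReal, hsq, inner_sum, sum_inner]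
  rw [integral_finsetSum _ fun i _ => integrable_finsetSum _ fun j _ => hint j i]
  refine Finset.sum_congr rfl fun i hi => ?_
  rw [integral_finsetSum _ fun j _ => hint j i, Finset.sum_eq_single i]
  · intro j _ hji
    exact integral_inner_eq_zero hμ (fun h => hji (he h)) (hP j) (hP i) (hc j)
  · exact fun h => absurd hi h

lemma isRotationInvariant_volume : IsRotationInvariant volume := fun T => T.measurePreserving

lemma isRotationInvariant_withDensity (w : ℝ → ℝ≥0∞) :
    IsRotationInvariant (volume.withDensity fun x => w ‖x‖) := by
  intro T
  refine ⟨T.continuous.measurable, ?_⟩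
  ext s hs
  rw [Measure.map_apply T.continuous.measurable hs, withDensity_apply _ hs,
    withDensity_apply _ (T.continuous.measurable hs), ← lintegral_indicator hs,
    ← lintegral_indicator (T.continuous.measurable hs),
    ← T.measurePreserving.lintegral_comp_emb T.toHomeomorph.measurableEmbedding
      (s.indicator fun x => w ‖x‖)]
  congr 1
  funext x
  by_cases hx : T x ∈ s
  · rw [indicator_of_mem hx, indicator_of_mem (show x ∈ T ⁻¹' s from hx), T.norm_map]
  · rw [indicator_of_notMem hx, indicator_of_notMem (show x ∉ T ⁻¹' s from hx)]

lemma measurable_smul_sphere (R : ℝ) :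
    Measurable fun y : Metric.sphere (0 : Space) 1 => R • (y : Space) :=
  (continuous_subtype_val.const_smul R).measurable

open scoped Pointwise in
lemma isRotationInvariant_sphereMeasure (R : ℝ) : IsRotationInvariant (sphereMeasure R) := by
  intro T
  refine ⟨T.continuous.measurable, ?_⟩
  ext s hs
  have hm := measurable_smul_sphere R
  rw [Measure.map_apply T.continuous.measurable hs, sphereMeasure, Measure.smul_apply,
    Measure.smul_apply, Measure.map_apply hm hs,
    Measure.map_apply hm (T.continuous.measurable hs),
    Measure.toSphere_apply' _ (hm hs), Measure.toSphere_apply' _ (hm (T.continuous.measurable hs)),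
    ← MeasurePreserving.measure_preimage_equiv (f := T.toHomeomorph.toMeasurableEquiv)
      T.measurePreserving (Ioo (0 : ℝ) 1 •
        (Subtype.val '' ((fun y : Metric.sphere (0 : Space) 1 => R • (y : Space)) ⁻¹' s)))]
  -- both sides are the volume of the cone over `s`, which the isometry maps to itself
  congr 3
  ext x
  simp only [Set.mem_smul, mem_image, mem_preimage, Subtype.exists, mem_sphere_iff_norm, sub_zero,
    exists_and_left, exists_prop, Homeomorph.toMeasurableEquiv_coe]
  constructor
  · rintro ⟨r, hr, y, ⟨z, hz, hz1, rfl⟩, rfl⟩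
    refine ⟨r, hr, T z, ⟨T z, ?_, by simpa using hz1, rfl⟩, ?_⟩
    · simpa using hz
    · simp
  · rintro ⟨r, hr, y, ⟨z, hz, hz1, rfl⟩, hx⟩
    refine ⟨r, hr, T.symm z, ⟨T.symm z, ?_, by simpa using hz1, rfl⟩, ?_⟩
    · simpa using hz
    · have := congrArg T.symm hx
      simpa using this

instance (R : ℝ) : IsFiniteMeasure (sphereMeasure R) := by
  unfold sphereMeasure
  exact Measure.smul_finite _ ENNReal.ofReal_ne_top

/-! ### Differential inequalities for absolutely continuous functions -/

lemma le_of_ae_deriv_nonneg {f : ℝ → ℝ} {a b : ℝ} (hab : a ≤ b)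
    (hf : AbsolutelyContinuousOnInterval f a b)
    (h : ∀ᵐ s, s ∈ Ioo a b → 0 ≤ deriv f s) : f a ≤ f b := by
  have h1 := hf.integral_deriv_eq_sub
  have h2 : 0 ≤ ∫ x in a..b, deriv f x := by
    refine intervalIntegral.integral_nonneg_of_ae_restrict hab ?_
    rw [restrict_Ioo_eq_restrict_Icc.symm, EventuallyLE, ae_restrict_iff' measurableSet_Ioo]
    exact h
  linarith

lemma absolutelyContinuousOnInterval_of_hasDerivAt {f f' : ℝ → ℝ} {a b : ℝ}
    (hf : ∀ s ∈ uIcc a b, HasDerivAt f (f' s) s) (hf' : ContinuousOn f' (uIcc a b)) :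
    AbsolutelyContinuousOnInterval f a b := by
  obtain ⟨C, hC⟩ := isCompact_uIcc.exists_bound_of_continuousOn hf'
  refine LipschitzOnWith.absolutelyContinuousOnInterval (K := Real.toNNReal C) ?_
  refine (convex_uIcc a b).lipschitzOnWith_of_nnnorm_hasDerivWithin_le
    (fun s hs => (hf s hs).hasDerivWithinAt) fun s hs => ?_
  rw [← NNReal.coe_le_coe, coe_nnnorm]
  exact (hC s hs).trans (Real.le_coe_toNNReal C)

/-- Gronwall's inequality for `f' ≥ l f`. -/
lemma exp_mul_le_of_ae_le_deriv {f : ℝ → ℝ} {a b : ℝ} (l : ℝ) (hab : a ≤ b)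
    (hf : AbsolutelyContinuousOnInterval f a b)
    (h : ∀ᵐ s, s ∈ Ioo a b → l * f s ≤ deriv f s) :
    Real.exp (-l * a) * f a ≤ Real.exp (-l * b) * f b := by
  have he : ∀ s, HasDerivAt (fun s => Real.exp (-l * s)) (Real.exp (-l * s) * (-l)) s :=
      fun s => by
    have := ((hasDerivAt_id s).const_mul (-l)).exp
    simpa using this
  have hac : AbsolutelyContinuousOnInterval (fun s => Real.exp (-l * s)) a b :=
    absolutelyContinuousOnInterval_of_hasDerivAt (fun s _ => he s) (by fun_prop)
  refine le_of_ae_deriv_nonneg (f := fun s => Real.exp (-l * s) * f s) hab (hac.fun_mul hf) ?_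
  filter_upwards [h, hf.ae_differentiableAt] with s hs hd hmem
  have hd' := (hd (by rw [uIcc_of_le hab]; exact Ioo_subset_Icc_self hmem)).hasDerivAt
  rw [((he s).fun_mul hd').deriv]
  have := mul_nonneg (Real.exp_pos (-l * s)).le (sub_nonneg.2 (hs hmem))
  linarith

/-- A function with a limit at `0` cannot satisfy `s f'(s) ≥ c > 0`, as it would diverge like
`c log s`. -/
lemma false_of_ae_le_mul_deriv {f : ℝ → ℝ} {l r c : ℝ} (hr : 0 < r) (hc : 0 < c)
    (hf : ∀ a b, 0 < a → a ≤ b → b < r → AbsolutelyContinuousOnInterval f a b)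
    (hlim : Tendsto f (𝓝[>] 0) (𝓝 l))
    (h : ∀ᵐ s, s ∈ Ioo 0 r → c ≤ s * deriv f s) : False := by
  have key : ∀ a ∈ Ioc 0 (r / 2),
      f a ≤ f (r / 2) - c * Real.log (r / 2) + c * Real.log a := by
    intro a ha
    have hacf := hf a (r / 2) ha.1 ha.2 (by linarith)
    have hl : ∀ s ∈ uIcc a (r / 2), HasDerivAt (fun s => c * Real.log s) (c * s⁻¹) s :=
      fun s hs => by
        rw [uIcc_of_le ha.2] at hs
        exact (Real.hasDerivAt_log (ha.1.trans_le hs.1).ne').const_mul c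
    have hlac := absolutelyContinuousOnInterval_of_hasDerivAt hl
      (continuousOn_const.mul (continuousOn_inv₀.mono fun s hs => by
        rw [uIcc_of_le ha.2] at hs
        exact (ha.1.trans_le hs.1).ne'))
    have := le_of_ae_deriv_nonneg (f := fun s => f s - c * Real.log s) ha.2 (hacf.fun_sub hlac) (by
      filter_upwards [h, hacf.ae_differentiableAt] with s hs hd hmem
      have hs0 : 0 < s := ha.1.trans hmem.1
      have hmem' : s ∈ uIcc a (r / 2) := by rw [uIcc_of_le ha.2]; exact Ioo_subset_Icc_self hmem
      rw [((hd hmem').hasDerivAt.fun_sub (hl s hmem')).deriv]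
      have h1 := hs ⟨hs0, by linarith [hmem.2]⟩
      have h2 : c * s⁻¹ ≤ deriv f s := by
        rw [← div_eq_mul_inv, div_le_iff₀ hs0]; linarith
      linarith)
    linarith
  have hbot : Tendsto (fun a => f (r / 2) - c * Real.log (r / 2) + c * Real.log a)
      (𝓝[>] 0) atBot :=
    tendsto_atBot_add_const_left _ _
      ((tendsto_const_mul_atBot_of_pos hc).2 Real.tendsto_log_nhdsGT_zero)
  refine not_tendsto_nhds_of_tendsto_atBot (tendsto_atBot_mono' _ ?_ hbot) l hlim
  filter_upwards [Ioc_mem_nhdsGT (show (0 : ℝ) < r / 2 by linarith)] with a ha using key a ha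

/-- The Riccati inequality `f' ≥ Ω' f²` for positive `f`, integrated. -/
lemma sub_le_inv_sub_inv {f Ω : ℝ → ℝ} {a b : ℝ} (hab : a ≤ b)
    (hf : AbsolutelyContinuousOnInterval f a b) (hΩ : AbsolutelyContinuousOnInterval Ω a b)
    (hpos : ∀ s ∈ Icc a b, 0 < f s)
    (h : ∀ᵐ s, s ∈ Ioo a b → deriv Ω s * f s ^ 2 ≤ deriv f s) :
    Ω b - Ω a ≤ (f a)⁻¹ - (f b)⁻¹ := by
  rw [← uIcc_of_le hab] at hpos
  obtain ⟨s₀, hs₀, hmin⟩ := isCompact_uIcc.exists_isMinOn nonempty_uIcc hf.continuousOn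
  -- inversion is Lipschitz on the range of `f`, which stays above its minimum
  have hinv : AbsolutelyContinuousOnInterval (fun s => (f s)⁻¹) a b := by
    have hm := hpos s₀ hs₀
    have hlip : LipschitzOnWith (Real.toNNReal ((f s₀ ^ 2)⁻¹)) (fun y : ℝ => y⁻¹)
        (Ici (f s₀)) := by
      refine (convex_Ici (f s₀)).lipschitzOnWith_of_nnnorm_hasDerivWithin_le
        (f' := fun y => -(y ^ 2)⁻¹)
        (fun y hy => (hasDerivAt_inv (hm.trans_le hy).ne').hasDerivWithinAt) fun y hy => ?_
      rw [← NNReal.coe_le_coe, coe_nnnorm, Real.coe_toNNReal _ (by positivity), norm_neg,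
        Real.norm_of_nonneg (by positivity)]
      exact inv_anti₀ (by positivity) (pow_le_pow_left₀ hm.le hy 2)
    rw [absolutelyContinuousOnInterval_iff] at hf ⊢
    intro ε hε
    have hK : 0 < (f s₀ ^ 2)⁻¹ := by positivity
    obtain ⟨δ, hδ, hδf⟩ := hf (ε / (f s₀ ^ 2)⁻¹) (by positivity)
    refine ⟨δ, hδ, fun E hE hlen => ?_⟩
    have h1 := hδf E hE hlen
    rw [lt_div_iff₀ hK, Finset.sum_mul] at h1
    refine lt_of_le_of_lt (Finset.sum_le_sum fun i hi => ?_) h1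
    have := hlip.dist_le_mul (f (E.2 i).1) (hmin (hE.1 i hi).1) (f (E.2 i).2) (hmin (hE.1 i hi).2)
    rw [Real.coe_toNNReal _ hK.le] at this
    linarith
  have := le_of_ae_deriv_nonneg (f := fun s => -(f s)⁻¹ - Ω s) hab (hinv.fun_neg.fun_sub hΩ) (by
    filter_upwards [h, hf.ae_differentiableAt, hΩ.ae_differentiableAt] with s hs hd hdΩ hmem
    have hmem' : s ∈ uIcc a b := by rw [uIcc_of_le hab]; exact Ioo_subset_Icc_self hmem
    have hfs := hpos s hmem'
    rw [((hd hmem').hasDerivAt.fun_inv hfs.ne').fun_neg.fun_sub (hdΩ hmem').hasDerivAt |>.deriv]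
    have h1 : deriv Ω s ≤ deriv f s / f s ^ 2 := by
      rw [le_div_iff₀ (by positivity)]; exact hs hmem
    rw [neg_div, neg_neg]
    linarith)
  linarith

/-- A nonnegative solution of `f' ≥ c f² / s` near `0` is `O(1 / |log s|)`. -/
lemma exists_abs_mul_log_le {f : ℝ → ℝ} {r c : ℝ} (hr : 0 < r) (hc : 0 < c)
    (hf : ∀ a b, 0 < a → a ≤ b → b < r → AbsolutelyContinuousOnInterval f a b)
    (h0 : ∀ s ∈ Ioo 0 r, 0 ≤ f s)
    (h : ∀ᵐ s, s ∈ Ioo 0 r → c / s * f s ^ 2 ≤ deriv f s) :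
    ∃ M, ∀ᶠ s in 𝓝[>] (0 : ℝ), |f s * Real.log s| ≤ M := by
  have hmono : ∀ a b, 0 < a → a ≤ b → b < r → f a ≤ f b := fun a b ha hab hb =>
    le_of_ae_deriv_nonneg hab (hf a b ha hab hb) (by
      filter_upwards [h] with s hs hmem
      have hs0 : 0 < s := ha.trans hmem.1
      exact le_trans (by positivity) (hs ⟨hs0, hmem.2.trans hb⟩))
  set t := r / 2 with ht
  have ht0 : 0 < t := by positivity
  have htr : t < r := by linarith
  refine ⟨c⁻¹ + f t * |Real.log t|, ?_⟩
  filter_upwards [Ioc_mem_nhdsGT ht0, Ioc_mem_nhdsGT (zero_lt_one' ℝ)] with s hs hs1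
  have hfs := h0 s ⟨hs.1, by linarith [hs.2]⟩
  have hlog : Real.log s ≤ 0 := Real.log_nonpos hs.1.le hs1.2
  rw [abs_of_nonpos (mul_nonpos_of_nonneg_of_nonpos hfs hlog)]
  have hst := hmono s t hs.1 hs.2 htr
  have hft : f s * |Real.log t| ≤ f t * |Real.log t| := by gcongr
  have hlt := neg_abs_le (Real.log t)
  rcases hfs.eq_or_lt with h00 | hpos
  · rw [← h00]
    have := mul_nonneg (hfs.trans hst) (abs_nonneg (Real.log t))
    have := inv_pos.2 hc
    linarith
  · have hl : ∀ x ∈ uIcc s t, HasDerivAt (fun s => c * Real.log s) (c * x⁻¹) x :=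
      fun x hx => by
        rw [uIcc_of_le hs.2] at hx
        exact (Real.hasDerivAt_log (hs.1.trans_le hx.1).ne').const_mul c
    have hlac := absolutelyContinuousOnInterval_of_hasDerivAt hl
      (continuousOn_const.mul (continuousOn_inv₀.mono fun x hx => by
        rw [uIcc_of_le hs.2] at hx
        exact (hs.1.trans_le hx.1).ne'))
    have hR := sub_le_inv_sub_inv hs.2 (hf s t hs.1 hs.2 htr) hlac
      (fun x hx => hpos.trans_le (hmono s x hs.1 hx.1 (hx.2.trans_lt htr))) (by
        filter_upwards [h] with x hx hmem
        have := hx ⟨hs.1.trans hmem.1, hmem.2.trans htr⟩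
        rw [(hl x (by rw [uIcc_of_le hs.2]; exact Ioo_subset_Icc_self hmem)).deriv]
        simpa [div_eq_mul_inv] using this)
    have hinv : 0 < (f t)⁻¹ := inv_pos.2 (hpos.trans_le hst)
    have h1 : c * (Real.log t - Real.log s) ≤ (f s)⁻¹ := by linarith
    have h2 : f s * (c * (Real.log t - Real.log s)) ≤ 1 := by
      have := mul_le_mul_of_nonneg_left h1 hfs
      rwa [mul_inv_cancel₀ hpos.ne'] at this
    have h3 : f s * (Real.log t - Real.log s) ≤ c⁻¹ := by
      rw [← one_div, le_div_iff₀ hc]; linarith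
    have h4 := mul_le_mul_of_nonneg_left hlt hfs
    linarith

/-! ### Consequences of `W ≥ 1` -/

lemma le_mul_deriv_of_one_le_Wplus {m : ℝ → ℝ} {s : ℝ} (h : 1 ≤ Wplus m s) :
    (m s - 1) ^ 2 + s * (m s ^ 2 - 1) ≤ s * deriv m s := by
  rw [Wplus, le_div_iff₀ (by positivity)] at h
  linarith

lemma le_mul_deriv_of_one_le_Wminus {m : ℝ → ℝ} {s : ℝ} (h : 1 ≤ Wminus m s) :
    (m s - 1) ^ 2 + s * (m s ^ 2 - 1) ≤ -(s * deriv m s) := by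
  rw [Wminus, le_div_iff₀ (by positivity)] at h
  linarith

lemma deriv_ge_of_one_le_Wplus {m : ℝ → ℝ} {s : ℝ} (hs : 0 < s) (h : 1 ≤ Wplus m s) :
    (m s - 1) ^ 2 / s + (m s ^ 2 - 1) ≤ deriv m s := by
  have h1 := le_mul_deriv_of_one_le_Wplus h
  have h2 : (m s - 1) ^ 2 / s + (m s ^ 2 - 1) = ((m s - 1) ^ 2 + s * (m s ^ 2 - 1)) / s := by
    field_simp
  rw [h2, div_le_iff₀ hs]
  linarith

lemma deriv_le_of_one_le_Wminus {m : ℝ → ℝ} {s : ℝ} (hs : 0 < s) (h : 1 ≤ Wminus m s) :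
    (m s - 1) ^ 2 / s + (m s ^ 2 - 1) ≤ -deriv m s := by
  have h1 := le_mul_deriv_of_one_le_Wminus h
  have h2 : (m s - 1) ^ 2 / s + (m s ^ 2 - 1) = ((m s - 1) ^ 2 + s * (m s ^ 2 - 1)) / s := by
    field_simp
  rw [h2, div_le_iff₀ hs]
  linarith

/-- A limit `l ≠ 1` at `0` is excluded by `(m - 1)² + s (m² - 1) ≤ s e m'`, where `e = 1` for `m₊`
and `e = -1` for `m₋`. -/
lemma eq_one_of_tendsto {m : ℝ → ℝ} {l r e : ℝ} (hr : 0 < r)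
    (hm : ∀ a b, 0 < a → a ≤ b → b < r → AbsolutelyContinuousOnInterval m a b)
    (hlim : Tendsto m (𝓝[>] 0) (𝓝 l))
    (h : ∀ᵐ s, s ∈ Ioo 0 r → (m s - 1) ^ 2 + s * (m s ^ 2 - 1) ≤ s * (e * deriv m s)) :
    l = 1 := by
  by_contra hl
  have hpos : 0 < (l - 1) ^ 2 := by
    have := sub_ne_zero.2 hl
    positivity
  have ht : Tendsto (fun s => (m s - 1) ^ 2 + s * (m s ^ 2 - 1)) (𝓝[>] 0)
      (𝓝 ((l - 1) ^ 2 + 0 * (l ^ 2 - 1))) := by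
    have hid : Tendsto (fun s : ℝ => s) (𝓝[>] 0) (𝓝 0) :=
      tendsto_nhdsWithin_of_tendsto_nhds tendsto_id
    exact ((hlim.sub_const 1).pow 2).add (hid.mul ((hlim.pow 2).sub_const 1))
  have hev := ht.eventually_const_lt (show (l - 1) ^ 2 / 2 < (l - 1) ^ 2 + 0 * (l ^ 2 - 1) by
    linarith)
  obtain ⟨r', hr', hsub⟩ := mem_nhdsGT_iff_exists_Ioo_subset.1 hev
  have hr'0 : 0 < r' := hr'
  refine false_of_ae_le_mul_deriv (f := fun s => e * m s) (lt_min hr hr'0)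
    (half_pos hpos) (l := e * l)
    (fun a b ha hab hb => (hm a b ha hab (hb.trans_le (min_le_left _ _))).const_mul e)
    (hlim.const_mul e) ?_
  filter_upwards [h] with s hs hmem
  have h1 := hs ⟨hmem.1, hmem.2.trans_le (min_le_left _ _)⟩
  have h2 : (l - 1) ^ 2 / 2 < _ := hsub ⟨hmem.1, hmem.2.trans_le (min_le_right _ _)⟩
  rw [deriv_const_mul_field]
  linarith

section Profile

variable {R : ℝ} {m : ℝ → ℝ}

/-- Gronwall's inequality started from the limit `0` at the origin. -/
lemma nonneg_of_ae_le_deriv {f : ℝ → ℝ} {l : ℝ}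
    (hf : ∀ a b, 0 < a → a ≤ b → b < R → AbsolutelyContinuousOnInterval f a b)
    (hlim : Tendsto f (𝓝[>] 0) (𝓝 0))
    (h : ∀ᵐ s, s ∈ Ioo 0 R → l * f s ≤ deriv f s) : ∀ s ∈ Ioo 0 R, 0 ≤ f s := by
  intro s hs
  have h1 : ∀ᶠ a in 𝓝[>] (0 : ℝ),
      Real.exp (-l * a) * f a ≤ Real.exp (-l * s) * f s := by
    filter_upwards [Ioc_mem_nhdsGT hs.1] with a ha
    refine exp_mul_le_of_ae_le_deriv l ha.2 (hf a s ha.1 ha.2 hs.2) ?_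
    filter_upwards [h] with x hx hmem
    exact hx ⟨ha.1.trans hmem.1, hmem.2.trans hs.2⟩
  have h2 : Tendsto (fun a => Real.exp (-l * a) * f a) (𝓝[>] 0) (𝓝 (Real.exp (-l * 0) * 0)) := by
    refine Tendsto.mul (tendsto_nhdsWithin_of_tendsto_nhds ?_) hlim
    exact Continuous.tendsto (by fun_prop) 0
  have h3 := le_of_tendsto h2 h1
  rw [mul_zero] at h3
  exact nonneg_of_mul_nonneg_right h3 (Real.exp_pos _)

/-- `m₊ ≥ 1` inside the ball. -/
lemma one_le_of_Wplus (hm : IsPiecewiseAC R m) (h1 : Tendsto m (𝓝[>] 0) (𝓝 1))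
    (hW : ∀ᵐ s, s ∈ Ioi (0 : ℝ) → 1 ≤ Wplus m s) : ∀ s ∈ Ioo 0 R, 1 ≤ m s := by
  have := nonneg_of_ae_le_deriv (R := R) (f := fun s => m s - 1) (l := 2)
    (fun a b ha hab hb => (hm.left a b ha hab hb).fun_sub
      (absolutelyContinuousOnInterval_of_hasDerivAt (fun s _ => hasDerivAt_const s 1)
        (by fun_prop)))
    (by simpa using h1.sub_const 1) (by
      filter_upwards [hW] with s hs hmem
      have h2 := deriv_ge_of_one_le_Wplus hmem.1 (hs hmem.1)
      have h3 : 0 ≤ (m s - 1) ^ 2 / s := div_nonneg (sq_nonneg _) hmem.1.le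
      rw [deriv_sub_const]
      nlinarith [sq_nonneg (m s - 1)])
  exact fun s hs => sub_nonneg.1 (this s hs)

/-- `m₋ ≤ 1` inside the ball. -/
lemma le_one_of_Wminus (hm : IsPiecewiseAC R m) (h1 : Tendsto m (𝓝[>] 0) (𝓝 1))
    (hW : ∀ᵐ s, s ∈ Ioi (0 : ℝ) → 1 ≤ Wminus m s) : ∀ s ∈ Ioo 0 R, m s ≤ 1 := by
  have := nonneg_of_ae_le_deriv (R := R) (f := fun s => 1 - m s) (l := -2)
    (fun a b ha hab hb => (absolutelyContinuousOnInterval_of_hasDerivAt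
      (fun s _ => hasDerivAt_const s 1) (by fun_prop)).fun_sub (hm.left a b ha hab hb))
    (by simpa using h1.const_sub 1) (by
      filter_upwards [hW] with s hs hmem
      have h2 := deriv_le_of_one_le_Wminus hmem.1 (hs hmem.1)
      have h3 : 0 ≤ (m s - 1) ^ 2 / s := div_nonneg (sq_nonneg _) hmem.1.le
      rw [deriv_const_sub]
      nlinarith [sq_nonneg (m s - 1)])
  exact fun s hs => sub_nonneg.1 (this s hs)

/-- `m₊ ≤ 1` outside the ball: otherwise `m₊` would blow up at a finite distance. -/
lemma le_one_of_Wplus (hR : 0 < R) (hm : IsPiecewiseAC R m)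
    (hW : ∀ᵐ s, s ∈ Ioi (0 : ℝ) → 1 ≤ Wplus m s) : ∀ s ∈ Ioi R, m s ≤ 1 := by
  intro s hs
  by_contra! hlt
  have hac : ∀ b, s ≤ b → AbsolutelyContinuousOnInterval (fun s => m s - 1) s b := fun b hb =>
    (hm.right s b hs hb).fun_sub
      (absolutelyContinuousOnInterval_of_hasDerivAt (fun s _ => hasDerivAt_const s 1)
        (by fun_prop))
  have hder : ∀ᵐ x, x ∈ Ioi s →
      2 * (m x - 1) + (m x - 1) ^ 2 ≤ deriv (fun s => m s - 1) x := by
    filter_upwards [hW] with x hx hmem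
    have hx0 : 0 < x := hR.trans ((mem_Ioi.1 hs).trans hmem)
    have h2 := deriv_ge_of_one_le_Wplus hx0 (hx hx0)
    have h3 : 0 ≤ (m x - 1) ^ 2 / x := div_nonneg (sq_nonneg _) hx0.le
    rw [deriv_sub_const]
    nlinarith
  have hpos : ∀ b, s ≤ b → 0 < m b - 1 := by
    intro b hb
    have h1 := exp_mul_le_of_ae_le_deriv 2 hb (hac b hb) (by
      filter_upwards [hder] with x hx hmem
      linarith [hx hmem.1, sq_nonneg (m x - 1)])
    have h2 : 0 < Real.exp (-2 * s) * (m s - 1) := mul_pos (Real.exp_pos _) (by linarith)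
    exact pos_of_mul_pos_right (h2.trans_le h1) (Real.exp_pos _).le
  -- `f = m - 1` satisfies `f' ≥ f²`, so it cannot stay finite up to `s + 1 / f s`
  set b := s + (m s - 1)⁻¹ with hb
  have hsb : s ≤ b := by
    have := inv_pos.2 (hpos s le_rfl)
    linarith
  have h1 := sub_le_inv_sub_inv (Ω := fun x => x) hsb (hac b hsb)
    (absolutelyContinuousOnInterval_of_hasDerivAt (fun x _ => hasDerivAt_id x) (by fun_prop))
    (fun x hx => hpos x hx.1) (by
      filter_upwards [hder] with x hx hmem
      rw [deriv_id'']
      have h4 := hx hmem.1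
      have h5 := hpos x hmem.1.le
      linarith)
  have h2 := inv_pos.2 (hpos b hsb)
  simp only [hb] at h1 h2
  linarith

lemma IsPiecewiseAC.tendsto_left (hm : IsPiecewiseAC R m) :
    Tendsto m (𝓝[<] R) (𝓝 (Function.leftLim m R)) := by
  obtain ⟨l, hl⟩ := hm.leftLim
  rwa [leftLim_eq_of_tendsto hl]

lemma IsPiecewiseAC.tendsto_right (hm : IsPiecewiseAC R m) :
    Tendsto m (𝓝[>] R) (𝓝 (Function.rightLim m R)) := by
  obtain ⟨l, hl⟩ := hm.rightLim
  rwa [rightLim_eq_of_tendsto hl]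

lemma jump_nonpos_of_Wplus (hR : 0 < R) (hm : IsPiecewiseAC R m) (h1 : Tendsto m (𝓝[>] 0) (𝓝 1))
    (hW : ∀ᵐ s, s ∈ Ioi (0 : ℝ) → 1 ≤ Wplus m s) : jump m R ≤ 0 := by
  have hl : 1 ≤ Function.leftLim m R := by
    refine ge_of_tendsto hm.tendsto_left ?_
    filter_upwards [Ioo_mem_nhdsLT hR] with s hs using one_le_of_Wplus hm h1 hW s hs
  have hr : Function.rightLim m R ≤ 1 := by
    refine le_of_tendsto hm.tendsto_right ?_
    filter_upwards [self_mem_nhdsWithin] with s hs using le_one_of_Wplus hR hm hW s hs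
  rw [jump]
  linarith

/-- Here `f = m₊ - 1 ≥ 0` satisfies `f' ≥ f² / s`. -/
lemma exists_abs_mul_log_le_of_Wplus (hR : 0 < R) (hm : IsPiecewiseAC R m)
    (h1 : Tendsto m (𝓝[>] 0) (𝓝 1)) (hW : ∀ᵐ s, s ∈ Ioi (0 : ℝ) → 1 ≤ Wplus m s) :
    ∃ M, ∀ᶠ s in 𝓝[>] (0 : ℝ), |(m s - 1) * Real.log s| ≤ M := by
  have hge := one_le_of_Wplus hm h1 hW
  refine exists_abs_mul_log_le hR zero_lt_one
    (fun a b ha hab hb => (hm.left a b ha hab hb).fun_sub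
      (absolutelyContinuousOnInterval_of_hasDerivAt (fun s _ => hasDerivAt_const s 1)
        (by fun_prop)))
    (fun s hs => sub_nonneg.2 (hge s hs)) ?_
  filter_upwards [hW] with s hs hmem
  have h2 := deriv_ge_of_one_le_Wplus hmem.1 (hs hmem.1)
  rw [deriv_sub_const, one_div_mul_eq_div]
  nlinarith [hge s hmem]

/-- Here `f = 1 - m₋ ≥ 0` satisfies `f' ≥ f² / s - 2 f`; the linear term is removed by passing to
`exp (2 s) f`, for which `f' ≥ exp (-2 R) f² / s`. -/
lemma exists_abs_mul_log_le_of_Wminus (hR : 0 < R) (hm : IsPiecewiseAC R m)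
    (h1 : Tendsto m (𝓝[>] 0) (𝓝 1)) (hW : ∀ᵐ s, s ∈ Ioi (0 : ℝ) → 1 ≤ Wminus m s) :
    ∃ M, ∀ᶠ s in 𝓝[>] (0 : ℝ), |(m s - 1) * Real.log s| ≤ M := by
  have hle := le_one_of_Wminus hm h1 hW
  have he : ∀ s, HasDerivAt (fun s => Real.exp (2 * s)) (Real.exp (2 * s) * 2) s := fun s => by
    have := ((hasDerivAt_id s).const_mul 2).exp
    simpa using this
  have hac1 : ∀ a b, 0 < a → a ≤ b → b < R →
      AbsolutelyContinuousOnInterval (fun s => 1 - m s) a b := fun a b ha hab hb =>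
    (absolutelyContinuousOnInterval_of_hasDerivAt
      (fun s _ => hasDerivAt_const s 1) (by fun_prop)).fun_sub (hm.left a b ha hab hb)
  have hdiff : ∀ᵐ s, s ∈ Ioo 0 R → DifferentiableAt ℝ m s := by
    have hcount : ∀ n : ℕ, ∀ᵐ s, s ∈ uIcc (R / (n + 3)) (R - R / (n + 3)) →
        DifferentiableAt ℝ m s := fun n => by
      refine (hm.left _ _ (by positivity) ?_ ?_).ae_differentiableAt
      · have : R / (n + 3) ≤ R / 2 := by gcongr; linarith [(Nat.cast_nonneg n : (0 : ℝ) ≤ n)]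
        linarith
      · have : 0 < R / (n + 3) := by positivity
        linarith
    filter_upwards [ae_all_iff.2 hcount] with s hs hmem
    have ht : Tendsto (fun n : ℕ => R / ((n : ℝ) + 3)) atTop (𝓝 0) :=
      tendsto_const_nhds.div_atTop
        (tendsto_atTop_add_const_right _ _ tendsto_natCast_atTop_atTop)
    obtain ⟨n, hn⟩ := (ht.eventually_lt_const
      (show 0 < min s (R - s) from lt_min hmem.1 (sub_pos.2 hmem.2))).exists
    refine hs n (Icc_subset_uIcc ⟨(hn.trans_le (min_le_left _ _)).le, ?_⟩)
    linarith [hn.trans_le (min_le_right _ _)]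
  obtain ⟨M, hM⟩ := exists_abs_mul_log_le (f := fun s => Real.exp (2 * s) * (1 - m s)) hR
    (Real.exp_pos (-(2 * R)))
    (fun a b ha hab hb => (absolutelyContinuousOnInterval_of_hasDerivAt (fun s _ => he s)
      (by fun_prop)).fun_mul (hac1 a b ha hab hb))
    (fun s hs => mul_nonneg (Real.exp_pos _).le (sub_nonneg.2 (hle s hs))) (by
      filter_upwards [hW, hdiff] with s hs hd hmem
      have h2 := deriv_le_of_one_le_Wminus hmem.1 (hs hmem.1)
      rw [((he s).fun_mul ((hd hmem).hasDerivAt.const_sub 1)).deriv]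
      have h3 : Real.exp (-(2 * R)) * Real.exp (2 * s) ≤ 1 := by
        rw [← Real.exp_add]
        exact Real.exp_le_one_iff.2 (by linarith [hmem.2])
      have h4 : 0 ≤ (m s - 1) ^ 2 / s := div_nonneg (sq_nonneg _) hmem.1.le
      have h5 : Real.exp (-(2 * R)) / s * (Real.exp (2 * s) * (1 - m s)) ^ 2
          = (Real.exp (-(2 * R)) * Real.exp (2 * s)) *
            (Real.exp (2 * s) * ((m s - 1) ^ 2 / s)) := by ring
      rw [h5]
      have h6 := mul_le_mul_of_nonneg_right h3 (mul_nonneg (Real.exp_pos (2 * s)).le h4)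
      have h7 : Real.exp (2 * s) * ((m s - 1) ^ 2 / s)
          ≤ Real.exp (2 * s) * (-deriv m s + 2 * (1 - m s)) := by
        gcongr
        nlinarith [sq_nonneg (m s - 1)]
      linarith)
  refine ⟨M, ?_⟩
  filter_upwards [hM, Ioo_mem_nhdsGT hR] with s hs hmem
  refine le_trans ?_ hs
  rw [abs_mul, abs_mul, abs_mul, abs_sub_comm, abs_of_pos (Real.exp_pos _)]
  have : 1 ≤ Real.exp (2 * s) := Real.one_le_exp (by linarith [hmem.1])
  gcongr
  exact le_mul_of_one_le_left (abs_nonneg _) this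

end Profile

/-! ### Integration by parts across a jump -/

/-- A locally absolutely continuous function on an open interval whose derivative is bounded from
below and which has limits at both ends has an integrable derivative: the integrals of
`|f' - c| = f' - c` over compact subintervals are differences of values of `f`, hence bounded. -/
lemma integrableOn_deriv_of_le {f : ℝ → ℝ} {a b la lb c : ℝ} (hab : a < b)
    (hf : ∀ s t, a < s → s ≤ t → t < b → AbsolutelyContinuousOnInterval f s t)
    (ha : Tendsto f (𝓝[>] a) (𝓝 la)) (hb : Tendsto f (𝓝[<] b) (𝓝 lb))
    (h : ∀ᵐ s, s ∈ Ioo a b → c ≤ deriv f s) : IntegrableOn (deriv f) (Ioc a b) := by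
  set d := b - a with hd
  have hd0 : 0 < d := sub_pos.2 hab
  set A : ℕ → ℝ := fun n => a + d / (n + 3) with hA
  set B : ℕ → ℝ := fun n => b - d / (n + 3) with hB
  have hpos : ∀ n : ℕ, 0 < d / ((n : ℝ) + 3) := fun n => by positivity
  have hle : ∀ n : ℕ, d / ((n : ℝ) + 3) ≤ d / 3 := fun n => by
    gcongr; linarith [(Nat.cast_nonneg n : (0 : ℝ) ≤ n)]
  have hAB : ∀ n, A n ≤ B n := fun n => by simp only [hA, hB]; linarith [hle n]
  have ht : Tendsto (fun n : ℕ => d / ((n : ℝ) + 3)) atTop (𝓝 0) :=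
    tendsto_const_nhds.div_atTop (tendsto_atTop_add_const_right _ _ tendsto_natCast_atTop_atTop)
  have hAt : Tendsto A atTop (𝓝 a) := by simpa using ht.const_add a
  have hBt : Tendsto B atTop (𝓝 b) := by simpa using ht.const_sub b
  have hAt' : Tendsto A atTop (𝓝[>] a) := tendsto_nhdsWithin_iff.2
    ⟨hAt, Eventually.of_forall fun n => by simp only [hA, mem_Ioi]; linarith [hpos n]⟩
  have hBt' : Tendsto B atTop (𝓝[<] b) := tendsto_nhdsWithin_iff.2
    ⟨hBt, Eventually.of_forall fun n => by simp only [hB, mem_Iio]; linarith [hpos n]⟩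
  have hac : ∀ n, AbsolutelyContinuousOnInterval f (A n) (B n) := fun n =>
    hf _ _ (by simp only [hA]; linarith [hpos n]) (hAB n) (by simp only [hB]; linarith [hpos n])
  have hint : ∀ n, IntegrableOn (fun s => deriv f s - c) (Ioc (A n) (B n)) := fun n =>
    (((intervalIntegrable_iff_integrableOn_Ioc_of_le (hAB n)).1
      (hac n).intervalIntegrable_deriv)).sub (integrableOn_const measure_Ioc_lt_top.ne)
  have hval : ∀ n, ∫ s in Ioc (A n) (B n), ‖deriv f s - c‖
      = f (B n) - f (A n) - (B n - A n) * c := by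
    intro n
    have h1 : ∫ s in Ioc (A n) (B n), ‖deriv f s - c‖
        = ∫ s in Ioc (A n) (B n), (deriv f s - c) := by
      refine setIntegral_congr_ae measurableSet_Ioc ?_
      filter_upwards [h] with s hs hmem
      refine Real.norm_of_nonneg (sub_nonneg.2 (hs ⟨?_, ?_⟩))
      · have := hmem.1; simp only [hA] at this; linarith [hpos n]
      · have := hmem.2; simp only [hB] at this; linarith [hpos n]
    rw [h1, ← intervalIntegral.integral_of_le (hAB n), intervalIntegral.integral_sub
      (hac n).intervalIntegrable_deriv intervalIntegrable_const, (hac n).integral_deriv_eq_sub]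
    simp
  have hlim : Tendsto (fun n => f (B n) - f (A n) - (B n - A n) * c) atTop
      (𝓝 (lb - la - (b - a) * c)) :=
    ((hb.comp hBt').sub (ha.comp hAt')).sub ((hBt.sub hAt).mul_const c)
  have := integrableOn_Ioc_of_intervalIntegral_norm_bounded hint hAt hBt
    (I := lb - la - (b - a) * c + 1) (by
      filter_upwards [hlim.eventually_le_const (lt_add_one _)] with n hn
      rw [hval]
      exact hn)
  have h2 := this.add (integrableOn_const (μ := volume) (s := Ioc a b) (C := c)
    measure_Ioc_lt_top.ne)
  refine h2.congr (Eventually.of_forall fun s => ?_)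
  simp

/-- The continuous extension to the closed interval is absolutely continuous. -/
lemma exists_absolutelyContinuous_extension {f : ℝ → ℝ} {a b la lb : ℝ} (hab : a < b)
    (hf : ∀ s t, a < s → s ≤ t → t < b → AbsolutelyContinuousOnInterval f s t)
    (ha : Tendsto f (𝓝[>] a) (𝓝 la)) (hb : Tendsto f (𝓝[<] b) (𝓝 lb))
    (hint : IntegrableOn (deriv f) (Ioc a b)) :
    ∃ g, AbsolutelyContinuousOnInterval g a b ∧ EqOn g f (Ioo a b) ∧ g a = la ∧ g b = lb := by
  set c := (a + b) / 2
  have hc : c ∈ Ioo a b := ⟨by simp only [c]; linarith, by simp only [c]; linarith⟩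
  have hII := (intervalIntegrable_iff_integrableOn_Ioc_of_le hab.le).2 hint
  set g : ℝ → ℝ := fun x => f c + ∫ v in c..x, deriv f v with hg
  have hgac : AbsolutelyContinuousOnInterval g a b :=
    (absolutelyContinuousOnInterval_of_hasDerivAt (fun s _ => hasDerivAt_const s (f c))
      (by fun_prop)).fun_add (hII.absolutelyContinuousOnInterval_intervalIntegral
        (Icc_subset_uIcc (Ioo_subset_Icc_self hc)))
  have heq : EqOn g f (Ioo a b) := by
    intro x hx
    simp only [hg]
    rcases le_total c x with h | h
    · rw [(hf c x hc.1 h hx.2).integral_deriv_eq_sub]; ring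
    · rw [(hf x c hx.1 h hc.2).symm.integral_deriv_eq_sub]; ring
  have hcont := hgac.continuousOn
  rw [uIcc_of_le hab.le] at hcont
  refine ⟨g, hgac, heq, ?_, ?_⟩
  · have h1 : Tendsto g (𝓝[>] a) (𝓝 (g a)) := by
      have := (hcont a (left_mem_Icc.2 hab.le)).mono (Ioo_subset_Icc_self)
      rwa [ContinuousWithinAt, nhdsWithin_Ioo_eq_nhdsGT hab] at this
    refine tendsto_nhds_unique h1 (ha.congr' ?_)
    filter_upwards [Ioo_mem_nhdsGT hab] with x hx using (heq hx).symm
  · have h1 : Tendsto g (𝓝[<] b) (𝓝 (g b)) := by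
      have := (hcont b (right_mem_Icc.2 hab.le)).mono (Ioo_subset_Icc_self)
      rwa [ContinuousWithinAt, nhdsWithin_Ioo_eq_nhdsLT hab] at this
    refine tendsto_nhds_unique h1 (hb.congr' ?_)
    filter_upwards [Ioo_mem_nhdsLT hab] with x hx using (heq hx).symm

/-- Integration by parts on an interval at whose ends `f` has only one-sided limits. -/
lemma integral_deriv_mul_add_of_tendsto {f H : ℝ → ℝ} {a b la lb : ℝ} (hab : a < b)
    (hf : ∀ s t, a < s → s ≤ t → t < b → AbsolutelyContinuousOnInterval f s t)
    (ha : Tendsto f (𝓝[>] a) (𝓝 la)) (hb : Tendsto f (𝓝[<] b) (𝓝 lb))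
    (hint : IntegrableOn (deriv f) (Ioc a b)) (hH : ContDiff ℝ 1 H) :
    IntegrableOn (fun s => deriv f s * H s + f s * deriv H s) (Ioc a b) ∧
    ∫ s in Ioc a b, (deriv f s * H s + f s * deriv H s) = lb * H b - la * H a := by
  obtain ⟨g, hg, heq, rfl, rfl⟩ := exists_absolutelyContinuous_extension hab hf ha hb hint
  have hHac : AbsolutelyContinuousOnInterval H a b := hH.contDiffOn.absolutelyContinuousOnInterval
  have h1 := hg.integral_deriv_mul_eq_sub hHac
  have h2 : IntervalIntegrable (fun s => deriv g s * H s + g s * deriv H s) volume a b :=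
    (hg.intervalIntegrable_deriv.mul_continuousOn hHac.continuousOn).add
      (hHac.intervalIntegrable_deriv.continuousOn_mul hg.continuousOn)
  rw [intervalIntegral.integral_of_le hab.le, integral_Ioc_eq_integral_Ioo] at h1
  rw [intervalIntegrable_iff_integrableOn_Ioc_of_le hab.le, integrableOn_Ioc_iff_integrableOn_Ioo]
    at h2
  have hfun : EqOn (fun s => deriv g s * H s + g s * deriv H s)
      (fun s => deriv f s * H s + f s * deriv H s) (Ioo a b) := by
    intro s hs
    have : g =ᶠ[𝓝 s] f := by
      filter_upwards [Ioo_mem_nhds hs.1 hs.2] with x hx using heq hx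
    simp only [this.deriv_eq, heq hs]
  rw [integrableOn_Ioc_iff_integrableOn_Ioo, integral_Ioc_eq_integral_Ioo]
  exact ⟨h2.congr_fun hfun measurableSet_Ioo,
    (setIntegral_congr_fun measurableSet_Ioo hfun).symm.trans h1⟩

lemma exists_bound_of_tendsto {f : ℝ → ℝ} {a b la lb : ℝ} (hab : a < b)
    (hf : ∀ s t, a < s → s ≤ t → t < b → AbsolutelyContinuousOnInterval f s t)
    (ha : Tendsto f (𝓝[>] a) (𝓝 la)) (hb : Tendsto f (𝓝[<] b) (𝓝 lb))
    (hint : IntegrableOn (deriv f) (Ioc a b)) : ∃ C, ∀ s ∈ Ioo a b, |f s| ≤ C := by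
  obtain ⟨g, hg, heq, -⟩ := exists_absolutelyContinuous_extension hab hf ha hb hint
  obtain ⟨C, hC⟩ := hg.exists_bound
  refine ⟨C, fun s hs => ?_⟩
  rw [← heq hs]
  exact hC s (Icc_subset_uIcc (Ioo_subset_Icc_self hs))

lemma IsPiecewiseAC.tendsto_of_lt {R : ℝ} {m : ℝ → ℝ} (hm : IsPiecewiseAC R m) {b : ℝ}
    (hb : R < b) : Tendsto m (𝓝[<] b) (𝓝 (m b)) := by
  have h1 := (hm.right ((R + b) / 2) (b + 1) (by linarith) (by linarith)).continuousOn
  rw [uIcc_of_le (by linarith)] at h1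
  exact (h1.continuousAt (Icc_mem_nhds (by linarith) (by linarith))).tendsto.mono_left
    nhdsWithin_le_nhds

/-- The regularity of a radial profile that integration by parts needs: on top of the piecewise
absolute continuity, a limit at `0` and a derivative that is integrable on bounded intervals. -/
structure IsRadialProfile (R : ℝ) (m : ℝ → ℝ) : Prop extends IsPiecewiseAC R m where
  zeroLim : ∃ l, Tendsto m (𝓝[>] 0) (𝓝 l)
  integrableOn_deriv : ∀ b, IntegrableOn (deriv m) (Ioc 0 b)

namespace IsRadialProfile

variable {R : ℝ} {m : ℝ → ℝ}

/-- The one-dimensional integration by parts across the jump of `m` at `R`. -/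
lemma integral_mul_add (hm : IsRadialProfile R m) (hR : 0 < R) {H : ℝ → ℝ} (hH : ContDiff ℝ 1 H)
    (h0 : H 0 = 0) {b : ℝ} (hb : ∀ s, b ≤ s → H s = 0) :
    ∫ s in Ioi 0, (deriv m s * H s + m s * deriv H s) = -(jump m R * H R) := by
  wlog hbR : R < b generalizing b
  · exact this (b := R + 1) (fun s hs => hb s (by linarith)) (by linarith)
  obtain ⟨l, hl⟩ := hm.zeroLim
  have hint := hm.integrableOn_deriv b
  have h1 := integral_deriv_mul_add_of_tendsto hR hm.left hl hm.tendsto_left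
    (hint.mono_set (Ioc_subset_Ioc_right hbR.le)) hH
  have h2 := integral_deriv_mul_add_of_tendsto hbR (fun s t hs hst _ => hm.right s t hs hst)
    hm.tendsto_right (hm.tendsto_of_lt hbR) (hint.mono_set (Ioc_subset_Ioc_left hR.le)) hH
  have h3 : ∫ s in Ioi 0, (deriv m s * H s + m s * deriv H s)
      = ∫ s in Ioc 0 b, (deriv m s * H s + m s * deriv H s) := by
    refine setIntegral_eq_of_subset_of_forall_sdiff_eq_zero measurableSet_Ioi Ioc_subset_Ioi_self ?_
    intro s hs
    have hs' : b < s := by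
      by_contra! h
      exact hs.2 ⟨hs.1, h⟩
    have hd : deriv H s = 0 := by
      have : H =ᶠ[𝓝 s] fun _ => 0 := by
        filter_upwards [Ioi_mem_nhds hs'] with x hx using hb x (mem_Ioi.1 hx).le
      rw [this.deriv_eq, deriv_const]
    simp [hb s hs'.le, hd]
  rw [h3, ← Ioc_union_Ioc_eq_Ioc hR.le hbR.le, setIntegral_union
    (Ioc_disjoint_Ioc_of_le le_rfl) measurableSet_Ioc h1.1 h2.1, h1.2, h2.2, h0, hb b le_rfl, jump]
  ring

lemma exists_bound (hm : IsRadialProfile R m) (hR : 0 < R) (b : ℝ) :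
    ∃ C, ∀ s ∈ Ioc 0 b, s ≠ R → |m s| ≤ C := by
  wlog hbR : R < b generalizing b
  · obtain ⟨C, hC⟩ := this (R + 1) (by linarith)
    exact ⟨C, fun s hs => hC s ⟨hs.1, by linarith [hs.2]⟩⟩
  obtain ⟨l, hl⟩ := hm.zeroLim
  have hint := hm.integrableOn_deriv (b + 1)
  obtain ⟨C₁, hC₁⟩ := exists_bound_of_tendsto hR hm.left hl hm.tendsto_left
    (hint.mono_set (Ioc_subset_Ioc_right (by linarith)))
  obtain ⟨C₂, hC₂⟩ := exists_bound_of_tendsto (show R < b + 1 by linarith)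
    (fun s t hs hst _ => hm.right s t hs hst)
    hm.tendsto_right (hm.tendsto_of_lt (by linarith)) (hint.mono_set (Ioc_subset_Ioc_left hR.le))
  refine ⟨max C₁ C₂, fun s hs hsR => ?_⟩
  rcases lt_or_gt_of_ne hsR with h | h
  · exact (hC₁ s ⟨hs.1, h⟩).trans (le_max_left _ _)
  · exact (hC₂ s ⟨h, by linarith [hs.2]⟩).trans (le_max_right _ _)

end IsRadialProfile

lemma IsPiecewiseAC.aestronglyMeasurable {R : ℝ} {m : ℝ → ℝ} (hm : IsPiecewiseAC R m) :
    AEStronglyMeasurable m (volume.restrict (Ioi 0)) := by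
  have h1 : ContinuousOn m (Ioo 0 R) := fun s hs => by
    have h := (hm.left (s / 2) ((s + R) / 2) (by linarith [hs.1]) (by linarith [hs.1, hs.2])
      (by linarith [hs.2])).continuousOn
    rw [uIcc_of_le (by linarith [hs.1, hs.2])] at h
    exact (h.continuousAt
      (Icc_mem_nhds (by linarith [hs.1]) (by linarith [hs.2]))).continuousWithinAt
  have h2 : ContinuousOn m (Ioi R) := fun s hs => by
    have hs' : R < s := hs
    have h := (hm.right ((s + R) / 2) (s + 1) (by linarith) (by linarith)).continuousOn
    rw [uIcc_of_le (by linarith)] at h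
    exact (h.continuousAt (Icc_mem_nhds (by linarith) (by linarith))).continuousWithinAt
  have h3 := aestronglyMeasurable_union_iff.2 ⟨h1.aestronglyMeasurable (μ := volume)
    measurableSet_Ioo, h2.aestronglyMeasurable (μ := volume) measurableSet_Ioi⟩
  have h4 : AEStronglyMeasurable m (volume.restrict ({R} : Set ℝ)) := by
    rw [Measure.restrict_eq_zero.2 (by simp)]
    exact aestronglyMeasurable_zero_measure m
  refine (aestronglyMeasurable_union_iff.2 ⟨h3, h4⟩).mono_measure (Measure.restrict_mono ?_ le_rfl)
  intro s hs
  rcases lt_trichotomy s R with h | h | h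
  · exact Or.inl (Or.inl ⟨hs, h⟩)
  · exact Or.inr h
  · exact Or.inl (Or.inr h)

/-! ### Polar coordinates -/

lemma finrank_space : Module.finrank ℝ Space = 3 := by simp

lemma integrableOn_radial {w : ℝ → ℝ} (hw : ∀ b, IntegrableOn (fun r => r ^ 2 * w r) (Ioc 0 b))
    (b : ℝ) : IntegrableOn (fun x : Space => w ‖x‖) (Metric.closedBall 0 b) := by
  have h1 : Integrable (fun x : Space => (Iic b).indicator w ‖x‖) volume := by
    rw [integrable_fun_norm_addHaar volume (f := (Iic b).indicator w), finrank_space]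
    have : EqOn (fun r : ℝ => r ^ 2 • (Iic b).indicator w r)
        ((Ioc 0 b).indicator fun r => r ^ 2 * w r) (Ioi 0) := by
      intro r hr
      by_cases hrb : r ≤ b
      · simp only [indicator_of_mem (show r ∈ Iic b from hrb),
          indicator_of_mem (show r ∈ Ioc 0 b from ⟨hr, hrb⟩), smul_eq_mul]
      · simp only [indicator_of_notMem (show r ∉ Iic b from hrb),
          indicator_of_notMem (show r ∉ Ioc 0 b from fun h => hrb h.2), smul_zero]
    refine IntegrableOn.congr_fun ?_ this.symm measurableSet_Ioi
    exact ((integrable_indicator_iff measurableSet_Ioc).2 (hw b)).integrableOn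
  refine h1.integrableOn.congr_fun (fun x hx => ?_) Metric.isClosed_closedBall.measurableSet
  exact indicator_of_mem (show ‖x‖ ∈ Iic b from mem_closedBall_zero_iff.1 hx) w

lemma locallyIntegrable_radial {w : ℝ → ℝ}
    (hw : ∀ b, IntegrableOn (fun r => r ^ 2 * w r) (Ioc 0 b)) :
    LocallyIntegrable (fun x : Space => w ‖x‖) volume := by
  refine locallyIntegrable_iff.2 fun K hK => ?_
  obtain ⟨b, hb⟩ := hK.isBounded.subset_closedBall 0
  exact (integrableOn_radial hw b).mono_set hb

lemma integrable_radial_mul {w : ℝ → ℝ}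
    (hw : ∀ b, IntegrableOn (fun r => r ^ 2 * w r) (Ioc 0 b))
    {c : Space → ℝ} (hc : Continuous c) (hcs : HasCompactSupport c) :
    Integrable (fun x => w ‖x‖ * c x) volume :=
  (locallyIntegrable_radial hw).integrable_smul_right_of_hasCompactSupport hc hcs

/-- The norm pulls null sets of radii in `(0, ∞)` back to null sets of `ℝ³`. -/
lemma ae_norm_of_ae {P : ℝ → Prop} (h : ∀ᵐ s, s ∈ Ioi (0 : ℝ) → P s) :
    ∀ᵐ x : Space, P ‖x‖ := by
  have hnull : volume {s : ℝ | ¬(s ∈ Ioi (0 : ℝ) → P s)} = 0 := h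
  obtain ⟨N, hsub, hNm, hN⟩ := exists_measurable_superset_of_null hnull
  have hzero : (fun y : ℝ => y ^ 2 • N.indicator (fun _ => (1 : ℝ)) y)
      =ᵐ[volume.restrict (Ioi 0)] fun _ => 0 := by
    refine ae_restrict_of_ae ?_
    have : ∀ᵐ y, y ∉ N := measure_eq_zero_iff_ae_notMem.1 hN
    filter_upwards [this] with y hy
    simp [indicator_of_notMem hy]
  have hint : Integrable (fun x : Space => N.indicator (fun _ => (1 : ℝ)) ‖x‖) volume := by
    rw [integrable_fun_norm_addHaar volume (f := N.indicator fun _ => (1 : ℝ)), finrank_space]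
    exact (integrable_congr hzero).2 (integrable_zero _ _ _)
  have hval : ∫ x : Space, N.indicator (fun _ => (1 : ℝ)) ‖x‖ = 0 := by
    rw [integral_fun_norm_addHaar volume (N.indicator fun _ => (1 : ℝ)), finrank_space,
      integral_congr_ae hzero]
    simp
  have hae := (integral_eq_zero_iff_of_nonneg
    (fun x => indicator_nonneg (fun _ _ => zero_le_one) _) hint).1 hval
  filter_upwards [hae, measure_eq_zero_iff_ae_notMem.1
    (measure_singleton (μ := volume) (0 : Space))] with x hx hx0
  by_contra hP
  have hxN : ‖x‖ ∈ N := hsub fun h => hP (h (norm_pos_iff.2 (by simpa using hx0)))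
  simp [indicator_of_mem hxN] at hx

lemma integral_polar {f : Space → ℝ} (hf : Integrable f volume) :
    ∫ x, f x = ∫ y : Metric.sphere (0 : Space) 1,
      (∫ r in Ioi (0 : ℝ), r ^ 2 * f (r • (y : Space))) ∂(volume : Measure Space).toSphere := by
  have hmp := (volume : Measure Space).measurePreserving_homeomorphUnitSphereProd
  have hemb := (homeomorphUnitSphereProd Space).measurableEmbedding
  set g : Metric.sphere (0 : Space) 1 × Ioi (0 : ℝ) → ℝ :=
    fun p => f (p.2.1 • (p.1 : Space)) with hg
  have hcomp : ∀ x : ({0}ᶜ : Set Space), g (homeomorphUnitSphereProd Space x) = f x := by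
    intro x
    have hx : (x : Space) ≠ 0 := x.2
    simp [hg, smul_smul, hx]
  have h1 : ∫ x, f x = ∫ p, g p ∂((volume : Measure Space).toSphere.prod
      (Measure.volumeIoiPow (Module.finrank ℝ Space - 1))) := by
    rw [← hmp.integral_comp hemb]
    simp only [hcomp]
    rw [integral_subtype_comap (measurableSet_singleton _).compl f, restrict_compl_singleton]
  have hgint : Integrable g ((volume : Measure Space).toSphere.prod
      (Measure.volumeIoiPow (Module.finrank ℝ Space - 1))) := by
    rw [← hmp.integrable_comp_emb hemb]
    have : g ∘ homeomorphUnitSphereProd Space = f ∘ Subtype.val := funext hcomp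
    rw [this, ← integrableOn_iff_comap_subtypeVal (measurableSet_singleton _).compl]
    exact hf.integrableOn
  rw [h1, integral_prod _ hgint]
  refine integral_congr_ae (Eventually.of_forall fun y => ?_)
  rw [finrank_space]
  simp only [Measure.volumeIoiPow, ENNReal.ofReal, hg]
  rw [integral_withDensity_eq_integral_smul,
    integral_subtype_comap measurableSet_Ioi fun a : ℝ =>
      Real.toNNReal (a ^ (3 - 1)) • f (a • (y : Space))]
  · refine setIntegral_congr_fun measurableSet_Ioi fun x hx => ?_
    simp only [NNReal.smul_def, Real.coe_toNNReal _ (pow_nonneg (mem_Ioi.1 hx).le _), smul_eq_mul]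
  · exact (measurable_subtype_coe.pow_const _).real_toNNReal

lemma integral_sphereMeasure (R : ℝ) {F : Type*} [NormedAddCommGroup F] [NormedSpace ℝ F]
    {f : Space → F} (hf : Continuous f) :
    ∫ x, f x ∂(sphereMeasure R) = R ^ 2 • ∫ y : Metric.sphere (0 : Space) 1, f (R • (y : Space))
      ∂(volume : Measure Space).toSphere := by
  rw [sphereMeasure, integral_smul_measure, integral_map (measurable_smul_sphere R).aemeasurable
    hf.aestronglyMeasurable, ENNReal.toReal_ofReal (sq_nonneg R)]

namespace IsRadialProfile

variable {R : ℝ} {m : ℝ → ℝ}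

lemma integrableOn_continuous_mul (hm : IsRadialProfile R m) (hR : 0 < R) {p : ℝ → ℝ}
    (hp : Continuous p) (b : ℝ) : IntegrableOn (fun r => p r * m r) (Ioc 0 b) := by
  obtain ⟨C, hC⟩ := hm.exists_bound hR b
  have hpi : IntegrableOn p (Ioc 0 b) := (hp.integrableOn_Icc).mono_set Ioc_subset_Icc_self
  refine Integrable.mul_bdd (c := C) hpi (hm.aestronglyMeasurable.mono_measure
    (Measure.restrict_mono Ioc_subset_Ioi_self le_rfl)) ?_
  have : ∀ᵐ s : ℝ, s ≠ R := by simp [ae_iff, measure_singleton]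
  filter_upwards [ae_restrict_mem measurableSet_Ioc, ae_restrict_of_ae this] with s hs hsR
  exact hC s hs hsR

lemma integrableOn_continuous_mul_deriv (hm : IsRadialProfile R m) {p : ℝ → ℝ}
    (hp : Continuous p) (b : ℝ) : IntegrableOn (fun r => p r * deriv m r) (Ioc 0 b) := by
  obtain ⟨C, hC⟩ := isCompact_Icc.exists_bound_of_continuousOn (hp.continuousOn (s := Icc 0 b))
  refine Integrable.bdd_mul (c := C) (hm.integrableOn_deriv b) hp.aestronglyMeasurable ?_
  filter_upwards [ae_restrict_mem measurableSet_Ioc] with s hs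
  exact hC s (Ioc_subset_Icc_self hs)

lemma integrable_mul_div (hm : IsRadialProfile R m) (hR : 0 < R) {c : Space → ℝ}
    (hc : Continuous c) (hcs : HasCompactSupport c) :
    Integrable (fun x => m ‖x‖ / ‖x‖ * c x) volume := by
  refine integrable_radial_mul (w := fun r => m r / r) (fun b => ?_) hc hcs
  refine (hm.integrableOn_continuous_mul hR (p := fun r => r) continuous_id b).congr_fun ?_
    measurableSet_Ioc
  intro r hr
  have := hr.1.ne'
  field_simp

lemma integrable_deriv_mul (hm : IsRadialProfile R m) {c : Space → ℝ}
    (hc : Continuous c) (hcs : HasCompactSupport c) :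
    Integrable (fun x => deriv m ‖x‖ * c x) volume :=
  integrable_radial_mul
    (fun b => hm.integrableOn_continuous_mul_deriv (p := fun r => r ^ 2) (by fun_prop) b) hc hcs

/-- Integration by parts in `ℝ³` against the radial vector field `m(|x|) x / |x|`; its divergence is
`m' + 2 m / r` and it jumps across the sphere of radius `R`. -/
theorem integral_radial (hm : IsRadialProfile R m) (hR : 0 < R) {F : Space → ℝ}
    (hF : ContDiff ℝ 1 F) (hFc : HasCompactSupport F) :
    Integrable (fun x => m ‖x‖ / ‖x‖ * fderiv ℝ F x x
      + (deriv m ‖x‖ + 2 * (m ‖x‖ / ‖x‖)) * F x) volume ∧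
    ∫ x, (m ‖x‖ / ‖x‖ * fderiv ℝ F x x + (deriv m ‖x‖ + 2 * (m ‖x‖ / ‖x‖)) * F x)
      = -(jump m R * ∫ x, F x ∂(sphereMeasure R)) := by
  have hdF : Continuous fun x => fderiv ℝ F x x := (hF.continuous_fderiv (by simp)).clm_apply
    continuous_id
  have hdFc : HasCompactSupport fun x => fderiv ℝ F x x :=
    (hFc.fderiv (𝕜 := ℝ)).mono fun x hx => by
      contrapose! hx
      simp only [Function.mem_support, not_not] at hx ⊢
      rw [hx]; rfl
  have hint : Integrable (fun x => m ‖x‖ / ‖x‖ * fderiv ℝ F x x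
      + (deriv m ‖x‖ + 2 * (m ‖x‖ / ‖x‖)) * F x) volume := by
    refine (hm.integrable_mul_div hR hdF hdFc).add
      (((hm.integrable_deriv_mul hF.continuous hFc).add
        ((hm.integrable_mul_div hR hF.continuous hFc).const_mul 2)).congr
          (Eventually.of_forall fun x => ?_))
    simp only [Pi.add_apply]
    ring
  refine ⟨hint, ?_⟩
  obtain ⟨b, hb⟩ := hFc.isCompact.isBounded.subset_closedBall 0
  rw [integral_polar hint, integral_sphereMeasure R hF.continuous, smul_eq_mul,
    ← integral_const_mul, ← integral_const_mul, ← integral_neg]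
  refine integral_congr_ae (Eventually.of_forall fun y => ?_)
  have hy : ‖(y : Space)‖ = 1 := by simp
  have hline : ∀ r : ℝ, HasDerivAt (fun r : ℝ => F (r • (y : Space)))
      (fderiv ℝ F (r • (y : Space)) y) r := fun r => by
    have := (hF.differentiable (by simp) (r • (y : Space))).hasFDerivAt.comp_hasDerivAt r
      ((hasDerivAt_id r).smul_const (y : Space))
    simpa [Function.comp_def] using this
  -- along the ray through `y` the integrand is `m' H + m H'` with `H = r² F`
  have hH : ContDiff ℝ 1 fun r : ℝ => r ^ 2 * F (r • (y : Space)) :=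
    (contDiff_id.pow 2).mul (hF.comp (contDiff_id.smul contDiff_const))
  have h := hm.integral_mul_add hR hH (by simp) (b := max b 0 + 1) (fun s hs => by
    have : F (s • (y : Space)) = 0 := by
      by_contra hne
      have h1 := mem_closedBall_zero_iff.1 (hb (subset_tsupport _ hne))
      have h0 : 0 ≤ s := by linarith [le_max_right b 0]
      rw [norm_smul, hy, mul_one, Real.norm_of_nonneg h0] at h1
      linarith [le_max_left b 0]
    rw [this, mul_zero])
  refine Eq.trans (setIntegral_congr_fun measurableSet_Ioi fun r hr => ?_) (h.trans (by ring))
  have hr0 : 0 < r := hr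
  have hn : ‖r • (y : Space)‖ = r := by rw [norm_smul, hy, mul_one, Real.norm_of_nonneg hr0.le]
  have hd : deriv (fun r : ℝ => r ^ 2 * F (r • (y : Space))) r
      = 2 * r * F (r • (y : Space)) + r ^ 2 * fderiv ℝ F (r • (y : Space)) y := by
    have := (hasDerivAt_pow 2 r).fun_mul (hline r)
    rw [this.deriv]
    simp
  simp only [hn, hd, map_smul, smul_eq_mul]
  field_simp
  ring

end IsRadialProfile

/-! ### The inequality on eigenfunctions of the spin-orbit operator -/

lemma hasCompactSupport_dirac {f : Space → Spinor} (hf : HasCompactSupport f) :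
    HasCompactSupport (dirac f) :=
  (hf.fderiv (𝕜 := ℝ)).mono fun x hx => by
    contrapose! hx
    simp only [Function.mem_support, not_not] at hx ⊢
    simp [dirac, hx]

lemma hasCompactSupport_norm_sq {f : Space → Spinor} (hf : HasCompactSupport f) :
    HasCompactSupport fun x => ‖f x‖ ^ 2 :=
  hf.mono fun x hx => by
    contrapose! hx
    simp only [Function.mem_support, not_not] at hx ⊢
    simp [hx]

lemma norm_sq_eq_re_inner (v : Spinor) : ‖v‖ ^ 2 = (inner ℂ v v).re := by
  rw [inner_self_eq_norm_sq_to_K]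
  norm_cast

lemma contDiff_norm_sq {f : Space → Spinor} {n : WithTop ℕ∞} (hf : ContDiff ℝ n f) :
    ContDiff ℝ n fun x => ‖f x‖ ^ 2 := by
  simp only [norm_sq_eq_re_inner]
  exact Complex.reCLM.contDiff.comp (hf.inner ℂ hf)

lemma fderiv_norm_sq {f : Space → Spinor} {x : Space} (hf : DifferentiableAt ℝ f x) (v : Space) :
    fderiv ℝ (fun x => ‖f x‖ ^ 2) x v = 2 * (inner ℂ (fderiv ℝ f x v) (f x)).re := by
  simp only [norm_sq_eq_re_inner]
  have h := Complex.reCLM.hasFDerivAt.comp x (hf.hasFDerivAt.inner ℂ hf.hasFDerivAt)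
  have h' : HasFDerivAt (fun x => (inner ℂ (f x) (f x)).re) _ x := h
  rw [h'.fderiv]
  have hs : (inner ℂ (f x) (fderiv ℝ f x v)).re = (inner ℂ (fderiv ℝ f x v) (f x)).re := by
    rw [← inner_conj_symm, Complex.conj_re]
  simp [hs]
  ring

/-- On an eigenfunction, the cross term `Re ⟨(σ · ∇) f, (σ · x) f⟩` is a radial derivative. -/
lemma re_inner_dirac_clifford {k : ℤ} {f : Space → Spinor} (hf : f ∈ spinOrbitEigenspace k)
    (x : Space) : (inner ℂ (dirac f x) (clifford x (f x))).re
      = fderiv ℝ (fun x => ‖f x‖ ^ 2) x x / 2 - ((k : ℝ) - 1) * ‖f x‖ ^ 2 := by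
  rw [← inner_clifford_left, clifford_dirac_of_mem hf, inner_sub_left, inner_smul_left_eq_smul,
    fderiv_norm_sq (hf.1.differentiable (by simp) x), norm_sq_eq_re_inner, Complex.sub_re,
    Complex.smul_re, smul_eq_mul]
  ring

lemma abs_re_inner_clifford_le (x : Space) (u v : Spinor) :
    |(inner ℂ u (clifford x v)).re| ≤ ‖x‖ * (‖u‖ * ‖v‖) := by
  refine (Complex.abs_re_le_norm _).trans ((norm_inner_le_norm _ _).trans_eq ?_)
  rw [norm_clifford]
  ring

/-- Completing the square, with `t = |(σ · ∇) f|`, `u = |f|`, `V = V(r)` and `m = m(r)`; `p` is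
`∓ Re ⟨(σ · ∇) f, (σ · x) f⟩ / r` and `q = 2 m / r ± m'`. -/
lemma two_mul_sub_le_sq_div_add {t u V m p q : ℝ} (hV : 0 ≤ V) (hm : 0 ≤ m) (hp : p ≤ t * u)
    (hVm : V * (1 + m ^ 2) ≤ q - m ^ 2 + 1) :
    2 * m * p - q * u ^ 2 ≤ t ^ 2 / (1 + V) + u ^ 2 - V * u ^ 2 := by
  have h1V : 0 < 1 + V := by linarith
  have h1 : 2 * m * (t * u) ≤ t ^ 2 / (1 + V) + (1 + V) * m ^ 2 * u ^ 2 := by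
    have : t ^ 2 / (1 + V) + (1 + V) * m ^ 2 * u ^ 2 - 2 * m * (t * u)
        = (t - (1 + V) * m * u) ^ 2 / (1 + V) := by
      field_simp
      ring
    have h2 : 0 ≤ (t - (1 + V) * m * u) ^ 2 / (1 + V) := by positivity
    linarith
  have h3 := mul_le_mul_of_nonneg_left hp (show 0 ≤ 2 * m by linarith)
  have h4 := mul_le_mul_of_nonneg_right hVm (sq_nonneg u)
  linarith

lemma integrable_radial_mul_norm_sq {w : ℝ → ℝ}
    (hw : LocallyIntegrable (fun x : Space => w ‖x‖) volume) {f : Space → Spinor}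
    (hf : Continuous f) (hfc : HasCompactSupport f) :
    Integrable (fun x => w ‖x‖ * ‖f x‖ ^ 2) volume :=
  hw.integrable_smul_right_of_hasCompactSupport (by fun_prop) (hasCompactSupport_norm_sq hfc)

lemma locallyIntegrable_inv {V : ℝ → ℝ} (hV : LocallyIntegrable (fun x : Space => V ‖x‖) volume)
    (hV0 : ∀ᵐ x : Space, 0 ≤ V ‖x‖) :
    LocallyIntegrable (fun x : Space => (1 + V ‖x‖)⁻¹) volume := by
  have hm : AEStronglyMeasurable (fun x : Space => (1 + V ‖x‖)⁻¹) volume :=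
    ((hV.aestronglyMeasurable.aemeasurable.const_add 1).inv).aestronglyMeasurable
  refine (locallyIntegrable_const (1 : ℝ)).mono hm ?_
  filter_upwards [hV0] with x hx
  rw [norm_one, Real.norm_of_nonneg (by positivity)]
  exact inv_le_one_of_one_le₀ (by linarith)

/-- The Hardy–Dirac inequality for a smooth compactly supported field, with the weight
`V = W(|x|) / |x|` and the constant `C` in front of the integral over the sphere. -/
def SmoothHardy (V : ℝ → ℝ) (R C : ℝ) (f : Space → Spinor) : Prop :=
  (∫ x, V ‖x‖ * ‖f x‖ ^ 2) + C * ∫ x, ‖f x‖ ^ 2 ∂(sphereMeasure R) ≤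
    ∫ x, (‖dirac f x‖ ^ 2 / (1 + V ‖x‖) + ‖f x‖ ^ 2)

section Sector

variable {R : ℝ} {m V : ℝ → ℝ} {k : ℤ} {f : Space → Spinor}

lemma integrable_energy (hV : LocallyIntegrable (fun x : Space => V ‖x‖) volume)
    (hV0 : ∀ᵐ x : Space, 0 ≤ V ‖x‖) (hf : ContDiff ℝ ∞ f) (hfc : HasCompactSupport f) :
    Integrable (fun x => ‖dirac f x‖ ^ 2 / (1 + V ‖x‖)) volume ∧
    Integrable (fun x => ‖f x‖ ^ 2) volume ∧ Integrable (fun x => V ‖x‖ * ‖f x‖ ^ 2) volume := by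
  refine ⟨?_, ?_, integrable_radial_mul_norm_sq hV hf.continuous hfc⟩
  · have := integrable_radial_mul_norm_sq (w := fun s => (1 + V s)⁻¹)
      (locallyIntegrable_inv hV hV0) (contDiff_dirac hf).continuous (hasCompactSupport_dirac hfc)
    refine this.congr (Eventually.of_forall fun x => ?_)
    simp only [div_eq_inv_mul]
  · exact (contDiff_norm_sq hf).continuous.integrable_of_hasCompactSupport
      (hasCompactSupport_norm_sq hfc)

/-- A lower bound of the energy density by `-e` times the divergence of `m(|x|) |f|² x / |x|` gives
the inequality with the constant `e [m]_R`. -/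
lemma smoothHardy_of_ae_le (hR : 0 < R) (hm : IsRadialProfile R m)
    (hV : LocallyIntegrable (fun x : Space => V ‖x‖) volume) (hV0 : ∀ᵐ x : Space, 0 ≤ V ‖x‖)
    (hf : ContDiff ℝ ∞ f) (hfc : HasCompactSupport f) (e : ℝ)
    (h : ∀ᵐ x, -e * (m ‖x‖ / ‖x‖ * fderiv ℝ (fun x => ‖f x‖ ^ 2) x x
      + (deriv m ‖x‖ + 2 * (m ‖x‖ / ‖x‖)) * ‖f x‖ ^ 2)
        ≤ ‖dirac f x‖ ^ 2 / (1 + V ‖x‖) + ‖f x‖ ^ 2 - V ‖x‖ * ‖f x‖ ^ 2) :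
    SmoothHardy V R (e * jump m R) f := by
  obtain ⟨i1, i2, i3⟩ := integrable_energy hV hV0 hf hfc
  have hrad := hm.integral_radial hR ((contDiff_norm_sq hf).of_le (by simp))
    (hasCompactSupport_norm_sq hfc)
  have h1 := integral_mono_ae (hrad.1.const_mul (-e)) ((i1.add i2).sub i3) h
  rw [integral_const_mul, hrad.2] at h1
  have h2 : ∫ x, (((fun x => ‖dirac f x‖ ^ 2 / (1 + V ‖x‖)) + (fun x => ‖f x‖ ^ 2)
      - fun x => V ‖x‖ * ‖f x‖ ^ 2 : Space → ℝ) x)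
      = (∫ x, (‖dirac f x‖ ^ 2 / (1 + V ‖x‖) + ‖f x‖ ^ 2)) - ∫ x, V ‖x‖ * ‖f x‖ ^ 2 :=
    integral_sub (i1.add i2) i3
  rw [h2] at h1
  rw [SmoothHardy]
  linarith

/-- Positive spin-orbit eigenvalues are controlled by `m₊`: the term with `(k - 1) m` that remains
after completing the square is nonnegative. -/
lemma smoothHardy_of_pos (hR : 0 < R) (hm : IsRadialProfile R m)
    (hV : LocallyIntegrable (fun x : Space => V ‖x‖) volume) (hV0 : ∀ᵐ x : Space, 0 ≤ V ‖x‖)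
    (hm0 : ∀ᵐ x : Space, 0 ≤ m ‖x‖)
    (hVm : ∀ᵐ x : Space, V ‖x‖ * (1 + m ‖x‖ ^ 2)
      ≤ 2 * (m ‖x‖ / ‖x‖) + deriv m ‖x‖ - m ‖x‖ ^ 2 + 1)
    (hk : 1 ≤ k) (hf : f ∈ spinOrbitEigenspace k) (hfc : HasCompactSupport f) :
    SmoothHardy V R (jump m R) f := by
  have := smoothHardy_of_ae_le hR hm hV hV0 hf.1 hfc 1 (by
    filter_upwards [hV0, hm0, hVm, measure_eq_zero_iff_ae_notMem.1
      (measure_singleton (μ := volume) (0 : Space))] with x hx0 hxm hxV hne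
    have hs : 0 < ‖x‖ := norm_pos_iff.2 (by simpa using hne)
    have h1 := re_inner_dirac_clifford hf x
    have h2 := abs_le.1 (abs_re_inner_clifford_le x (dirac f x) (f x))
    have hk' : (1 : ℝ) ≤ k := by exact_mod_cast hk
    have h3 : -(inner ℂ (dirac f x) (clifford x (f x))).re / ‖x‖ ≤ ‖dirac f x‖ * ‖f x‖ := by
      rw [div_le_iff₀ hs]; linarith [h2.1]
    have h4 := two_mul_sub_le_sq_div_add hx0 hxm h3 (q := 2 * (m ‖x‖ / ‖x‖) + deriv m ‖x‖) hxV
    have h5 : 0 ≤ m ‖x‖ / ‖x‖ * (((k : ℝ) - 1) * ‖f x‖ ^ 2) :=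
      mul_nonneg (div_nonneg hxm hs.le) (mul_nonneg (by linarith) (sq_nonneg _))
    have h6 : 2 * m ‖x‖ * (-(inner ℂ (dirac f x) (clifford x (f x))).re / ‖x‖)
        = -(m ‖x‖ / ‖x‖ * fderiv ℝ (fun x => ‖f x‖ ^ 2) x x)
          + 2 * (m ‖x‖ / ‖x‖ * (((k : ℝ) - 1) * ‖f x‖ ^ 2)) := by
      rw [h1]; ring
    linarith)
  rwa [one_mul] at this

/-- Negative spin-orbit eigenvalues are controlled by `m₋`: the term with `-(k + 1) m` that remains
after completing the square is nonnegative. -/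
lemma smoothHardy_of_neg (hR : 0 < R) (hm : IsRadialProfile R m)
    (hV : LocallyIntegrable (fun x : Space => V ‖x‖) volume) (hV0 : ∀ᵐ x : Space, 0 ≤ V ‖x‖)
    (hm0 : ∀ᵐ x : Space, 0 ≤ m ‖x‖)
    (hVm : ∀ᵐ x : Space, V ‖x‖ * (1 + m ‖x‖ ^ 2)
      ≤ 2 * (m ‖x‖ / ‖x‖) - deriv m ‖x‖ - m ‖x‖ ^ 2 + 1)
    (hk : k ≤ -1) (hf : f ∈ spinOrbitEigenspace k) (hfc : HasCompactSupport f) :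
    SmoothHardy V R (-jump m R) f := by
  have := smoothHardy_of_ae_le hR hm hV hV0 hf.1 hfc (-1) (by
    filter_upwards [hV0, hm0, hVm, measure_eq_zero_iff_ae_notMem.1
      (measure_singleton (μ := volume) (0 : Space))] with x hx0 hxm hxV hne
    have hs : 0 < ‖x‖ := norm_pos_iff.2 (by simpa using hne)
    have h1 := re_inner_dirac_clifford hf x
    have h2 := abs_le.1 (abs_re_inner_clifford_le x (dirac f x) (f x))
    have hk' : (k : ℝ) ≤ -1 := by exact_mod_cast hk
    have h3 : (inner ℂ (dirac f x) (clifford x (f x))).re / ‖x‖ ≤ ‖dirac f x‖ * ‖f x‖ := by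
      rw [div_le_iff₀ hs]; linarith [h2.2]
    have h4 := two_mul_sub_le_sq_div_add hx0 hxm h3 (q := 2 * (m ‖x‖ / ‖x‖) - deriv m ‖x‖) hxV
    have h5 : 0 ≤ m ‖x‖ / ‖x‖ * ((-1 - (k : ℝ)) * ‖f x‖ ^ 2) :=
      mul_nonneg (div_nonneg hxm hs.le) (mul_nonneg (by linarith) (sq_nonneg _))
    have h6 : 2 * m ‖x‖ * ((inner ℂ (dirac f x) (clifford x (f x))).re / ‖x‖)
        = m ‖x‖ / ‖x‖ * fderiv ℝ (fun x => ‖f x‖ ^ 2) x x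
          + 2 * (m ‖x‖ / ‖x‖ * ((-1 - (k : ℝ)) * ‖f x‖ ^ 2))
          + 4 * (m ‖x‖ / ‖x‖ * ‖f x‖ ^ 2) := by
      rw [h1]; ring
    linarith)
  rwa [neg_one_mul] at this

end Sector

/-! ### Summation over the eigenvalues -/

lemma isFiniteMeasureOnCompacts_withDensity {w : Space → ℝ} (hw : LocallyIntegrable w volume) :
    IsFiniteMeasureOnCompacts (volume.withDensity fun x => ENNReal.ofReal (w x)) := by
  refine ⟨fun K hK => ?_⟩
  rw [withDensity_apply _ hK.measurableSet]
  exact (hw.integrableOn_isCompact hK).lintegral_lt_top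

/-- Pythagoras for the measure with density `w(|x|)`. -/
lemma integral_radial_mul_norm_sq_sum {w : ℝ → ℝ}
    (hw : LocallyIntegrable (fun x : Space => w ‖x‖) volume) (hw0 : ∀ᵐ x : Space, 0 ≤ w ‖x‖)
    {ι : Type*} (s : Finset ι) {e : ι → ℤ} (he : Function.Injective e) {P : ι → Space → Spinor}
    (hP : ∀ i, P i ∈ spinOrbitEigenspace (e i)) (hc : ∀ i, HasCompactSupport (P i)) :
    ∫ x, w ‖x‖ * ‖∑ i ∈ s, P i x‖ ^ 2 = ∑ i ∈ s, ∫ x, w ‖x‖ * ‖P i x‖ ^ 2 := by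
  have hfin := isFiniteMeasureOnCompacts_withDensity hw
  have hconv : ∀ g : Space → ℝ, ∫ x, w ‖x‖ * g x
      = ∫ x, g x ∂(volume.withDensity fun x : Space => ENNReal.ofReal (w ‖x‖)) := by
    intro g
    rw [integral_withDensity_eq_integral_toReal_smul₀
      hw.aestronglyMeasurable.aemeasurable.ennreal_ofReal
      (Eventually.of_forall fun x => ENNReal.ofReal_lt_top)]
    refine integral_congr_ae ?_
    filter_upwards [hw0] with x hx
    rw [ENNReal.toReal_ofReal hx, smul_eq_mul]
  simp only [hconv]
  exact integral_norm_sq_sum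
    (isRotationInvariant_withDensity fun r => ENNReal.ofReal (w r)) s he hP hc

lemma dirac_sum {ι : Type*} (s : Finset ι) {P : ι → Space → Spinor}
    (hP : ∀ i, ContDiff ℝ ∞ (P i)) (x : Space) :
    dirac (fun x => ∑ i ∈ s, P i x) x = ∑ i ∈ s, dirac (P i) x := by
  simp only [dirac]
  rw [fderiv_fun_sum fun i _ => (hP i).differentiable (by simp) x, Finset.sum_comm]
  simp

/-- Every integral in the inequality is additive over eigenspaces: the terms in `f` by
orthogonality, and the term in `(σ · ∇) f` because `σ · ∇` maps different eigenspaces to different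
eigenspaces. -/
theorem smoothHardy_sum {V : ℝ → ℝ} {R C : ℝ}
    (hV : LocallyIntegrable (fun x : Space => V ‖x‖) volume) (hV0 : ∀ᵐ x : Space, 0 ≤ V ‖x‖)
    {ι : Type*} (s : Finset ι) {e : ι → ℤ} (he : Function.Injective e) {P : ι → Space → Spinor}
    (hP : ∀ i, P i ∈ spinOrbitEigenspace (e i)) (hc : ∀ i, HasCompactSupport (P i))
    (h : ∀ i, SmoothHardy V R C (P i)) : SmoothHardy V R C fun x => ∑ i ∈ s, P i x := by
  have hsm : ContDiff ℝ ∞ fun x => ∑ i ∈ s, P i x := ContDiff.sum fun i _ => (hP i).1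
  have hcs : HasCompactSupport fun x => ∑ i ∈ s, P i x := by
    classical
    induction s using Finset.induction_on with
    | empty =>
      simp only [Finset.sum_empty]
      exact HasCompactSupport.zero
    | insert a s ha ih =>
      simp only [Finset.sum_insert ha]
      exact (hc a).add (ih (ContDiff.sum fun i _ => (hP i).1))
  have hneg : Function.Injective fun i => -e i := neg_injective.comp he
  have hinv : ∀ᵐ x : Space, 0 ≤ (1 + V ‖x‖)⁻¹ := by
    filter_upwards [hV0] with x hx
    positivity
  have e1 := integral_radial_mul_norm_sq_sum hV hV0 s he hP hc
  have e2 := integral_radial_mul_norm_sq_sum (w := fun s => (1 + V s)⁻¹)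
    (locallyIntegrable_inv hV hV0) hinv s hneg (fun i => dirac_mem (hP i))
    fun i => hasCompactSupport_dirac (hc i)
  have e3 := integral_norm_sq_sum isRotationInvariant_volume s he hP hc
  have e4 := integral_norm_sq_sum (isRotationInvariant_sphereMeasure R) s he hP hc
  have hsplit : ∀ f : Space → Spinor, ContDiff ℝ ∞ f → HasCompactSupport f →
      ∫ x, (‖dirac f x‖ ^ 2 / (1 + V ‖x‖) + ‖f x‖ ^ 2)
        = (∫ x, (1 + V ‖x‖)⁻¹ * ‖dirac f x‖ ^ 2) + ∫ x, ‖f x‖ ^ 2 := by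
    intro f hf hfc
    obtain ⟨i1, i2, -⟩ := integrable_energy hV hV0 hf hfc
    rw [integral_add i1 i2]
    simp only [div_eq_inv_mul]
  rw [SmoothHardy, hsplit _ hsm hcs]
  simp only [dirac_sum s fun i => (hP i).1]
  rw [e1, e2, e3, e4, Finset.mul_sum, ← Finset.sum_add_distrib, ← Finset.sum_add_distrib]
  refine Finset.sum_le_sum fun i _ => ?_
  rw [← hsplit _ (hP i).1 (hc i)]
  exact h i

lemma SmoothHardy.mono {V : ℝ → ℝ} {R C C' : ℝ} {f : Space → Spinor} (h : SmoothHardy V R C f)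
    (hC : C' ≤ C) : SmoothHardy V R C' f := by
  rw [SmoothHardy] at h ⊢
  have : 0 ≤ ∫ x, ‖f x‖ ^ 2 ∂(sphereMeasure R) := integral_nonneg fun x => sq_nonneg _
  have := mul_le_mul_of_nonneg_right hC this
  linarith

/-! ### Approximation by polynomials in `C¹` -/

/-- The homogeneous polynomials `∫_{|ξ| ≤ A} ⟨ξ, x⟩ⁿ h(ξ) dξ`. -/
noncomputable def powerIntegral {F : Type} [NormedAddCommGroup F] [NormedSpace ℝ F] (A : ℝ) (n : ℕ)
    (h : Space → F) (x : Space) : F :=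
  ∫ ξ in Metric.closedBall (0 : Space) A, (inner ℝ ξ x) ^ n • h ξ

lemma integrableOn_closedBall_of_continuous {F : Type} [NormedAddCommGroup F] {u : Space → F}
    (hu : Continuous u) (A : ℝ) : IntegrableOn u (Metric.closedBall (0 : Space) A) :=
  hu.continuousOn.integrableOn_compact (isCompact_closedBall 0 A)

section PowerIntegral

variable {F : Type} [NormedAddCommGroup F] [NormedSpace ℝ F] {A : ℝ} {h : Space → F}

lemma hasFDerivAt_powerIntegral (hh : Continuous h) (n : ℕ) (x : Space) :
    HasFDerivAt (powerIntegral A n h)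
      (powerIntegral A (n - 1) (fun ξ => (n : ℝ) • (innerSL ℝ ξ).smulRight (h ξ)) x) x := by
  have hcont : Continuous fun p : Space × Space =>
      (inner ℝ p.1 p.2) ^ (n - 1) • ((n : ℝ) • (innerSL ℝ p.1).smulRight (h p.1)) := by fun_prop
  obtain ⟨C, hC⟩ := ((isCompact_closedBall (0 : Space) A).prod
    (isCompact_closedBall x 1)).exists_bound_of_continuousOn hcont.continuousOn
  refine hasFDerivAt_integral_of_dominated_of_fderiv_le (s := Metric.closedBall x 1)
    (F := fun x ξ => (inner ℝ ξ x) ^ n • h ξ)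
    (F' := fun x ξ => (inner ℝ ξ x) ^ (n - 1) • ((n : ℝ) • (innerSL ℝ ξ).smulRight (h ξ)))
    (bound := fun _ => C) (Metric.closedBall_mem_nhds x one_pos)
    (Eventually.of_forall fun y => Continuous.aestronglyMeasurable (by fun_prop))
    (integrableOn_closedBall_of_continuous (by fun_prop) A)
    (Continuous.aestronglyMeasurable (by fun_prop)) ?_
    (integrableOn_const (isCompact_closedBall 0 A).measure_lt_top.ne) ?_
  · filter_upwards [ae_restrict_mem Metric.isClosed_closedBall.measurableSet] with ξ hξ y hy
    exact hC (ξ, y) ⟨hξ, hy⟩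
  · refine Eventually.of_forall fun ξ y _ => ?_
    have h1 := ((innerSL ℝ ξ).hasFDerivAt (x := y)).pow n
    have h2 := h1.smul_const (h ξ)
    refine h2.congr_fderiv ?_
    ext v
    simp [smul_smul]
    ring_nf

lemma contDiff_powerIntegral (hh : Continuous h) (n : ℕ) : ContDiff ℝ ∞ (powerIntegral A n h) := by
  induction n generalizing F with
  | zero =>
    have : powerIntegral A 0 h = fun _ => ∫ ξ in Metric.closedBall (0 : Space) A, h ξ := by
      funext x
      simp [powerIntegral]
    rw [this]
    exact contDiff_const
  | succ n ih =>
    rw [contDiff_infty_iff_fderiv]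
    refine ⟨fun x => (hasFDerivAt_powerIntegral hh (n + 1) x).differentiableAt, ?_⟩
    have : fderiv ℝ (powerIntegral A (n + 1) h)
        = powerIntegral A n fun ξ => ((n + 1 : ℕ) : ℝ) • (innerSL ℝ ξ).smulRight (h ξ) := by
      funext x
      exact (hasFDerivAt_powerIntegral hh (n + 1) x).fderiv
    rw [this]
    exact ih (by fun_prop)

lemma fderiv_powerIntegral [CompleteSpace F] (hh : Continuous h) (n : ℕ) (x v : Space) :
    fderiv ℝ (powerIntegral A n h) x v
      = powerIntegral A (n - 1) (fun ξ => (n : ℝ) • inner ℝ ξ v • h ξ) x := by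
  have hi : Integrable (fun ξ => (inner ℝ ξ x) ^ (n - 1) •
      ((n : ℝ) • (innerSL ℝ ξ).smulRight (h ξ))) (volume.restrict (Metric.closedBall 0 A)) :=
    integrableOn_closedBall_of_continuous (by fun_prop) A
  rw [(hasFDerivAt_powerIntegral hh n x).fderiv, powerIntegral, powerIntegral,
    ContinuousLinearMap.integral_apply hi]
  simp

lemma isHomogeneous_powerIntegral {h : Space → Spinor} (hh : Continuous h) (n : ℕ) :
    IsHomogeneous n (powerIntegral A n h) := by
  refine ⟨contDiff_powerIntegral hh n, fun t x => ?_⟩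
  simp only [powerIntegral, inner_smul_right, mul_pow, mul_smul]
  rw [integral_smul]

end PowerIntegral

/-- The exponent `2π i ⟨ξ, x⟩` of the Fourier kernel. -/
noncomputable def phase (ξ x : Space) : ℂ := ((2 * Real.pi * inner ℝ ξ x : ℝ) : ℂ) * Complex.I

lemma continuous_phase : Continuous fun p : Space × Space => phase p.1 p.2 := by
  unfold phase
  fun_prop

lemma continuous_phase_left (x : Space) : Continuous fun ξ => phase ξ x :=
  continuous_phase.comp (continuous_id.prodMk continuous_const)

/-- The Taylor polynomial of the exponential, evaluated at the phase. -/
noncomputable def expTaylor (N : ℕ) (ξ x : Space) : ℂ :=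
  ∑ n ∈ Finset.range N, phase ξ x ^ n / (n.factorial : ℂ)

lemma continuous_expTaylor (N : ℕ) (x : Space) : Continuous fun ξ => expTaylor N ξ x :=
  continuous_finsetSum _ fun n _ => ((continuous_phase_left x).pow n).div_const _

lemma norm_phase_le (ξ x : Space) : ‖phase ξ x‖ ≤ 2 * Real.pi * (‖ξ‖ * ‖x‖) := by
  rw [phase, norm_mul, Complex.norm_I, mul_one, Complex.norm_real, norm_mul,
    Real.norm_of_nonneg (by positivity)]
  gcongr
  exact norm_inner_le_norm ξ x

lemma norm_exp_phase (ξ x : Space) : ‖Complex.exp (phase ξ x)‖ = 1 := by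
  rw [phase, Complex.norm_exp_ofReal_mul_I]

/-- Fourier inversion for a smooth compactly supported field and its partial derivatives, with
`g` the Fourier transform. -/
lemma exists_fourier_integral {f : Space → Spinor} (hf : ContDiff ℝ ∞ f)
    (hc : HasCompactSupport f) : ∃ g : Space → Spinor, Continuous g ∧ Integrable g ∧
      (∀ k, Integrable fun ξ => phase ξ (basisVec k) • g ξ) ∧
      (∀ x, f x = ∫ ξ, Complex.exp (phase ξ x) • g ξ) ∧
      ∀ k x, fderiv ℝ f x (basisVec k)
        = ∫ ξ, Complex.exp (phase ξ x) • phase ξ (basisVec k) • g ξ := by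
  open scoped FourierTransform SchwartzMap LineDeriv in
  set s : 𝓢(Space, Spinor) := hc.toSchwartzMap hf with hs
  have hinv : ∀ (u : 𝓢(Space, Spinor)) (x : Space),
      u x = ∫ ξ, Complex.exp (phase ξ x) • (𝓕 u) ξ := by
    intro u x
    have h1 : 𝓕⁻ (𝓕 u) x = u x := by rw [FourierTransform.fourierInv_fourier_eq]
    rw [← h1, SchwartzMap.fourierInv_coe, Real.fourierInv_eq']
    rfl
  have hk : ∀ (k : Fin 3) (ξ : Space), (𝓕 (∂_{basisVec k} s)) ξ
      = phase ξ (basisVec k) • (𝓕 s) ξ := by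
    intro k ξ
    have ht : (inner ℝ · (basisVec k) : Space → ℝ).HasTemperateGrowth :=
      ((innerSL ℝ).flip (basisVec k)).hasTemperateGrowth
    rw [SchwartzMap.fourier_lineDerivOp_eq, smul_apply,
      SchwartzMap.smulLeftCLM_apply_apply ht, phase, RCLike.real_smul_eq_coe_smul (K := ℂ),
      smul_smul]
    congr 1
    push_cast
    simp only [Complex.coe_algebraMap]
    ring
  refine ⟨((𝓕 s : 𝓢(Space, Spinor)) : Space → Spinor), (𝓕 s).continuous, (𝓕 s).integrable,
    fun k => ?_, fun x => hinv s x, fun k x => ?_⟩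
  · simp only [← hk]
    exact (𝓕 (∂_{basisVec k} s)).integrable
  · have h1 := hinv (∂_{basisVec k} s) x
    rw [SchwartzMap.lineDerivOp_apply_eq_fderiv] at h1
    simp only [hk] at h1
    exact h1

/-- Uniformly on balls, the Fourier integral is approximated by integrating a Taylor polynomial of
the exponential over a large ball: the tail of the integral is small because `g` is integrable, and
on the ball the Taylor series converges uniformly. The degree depends on the radius `A`, and both
can be enlarged, so that one choice serves several functions `g`. -/
lemma exists_truncation {g : Space → Spinor} (hg : Continuous g) (hgi : Integrable g)
    (ρ : ℝ) {ε : ℝ} (hε : 0 < ε) : ∃ A₀ : ℝ, ∀ A, A₀ ≤ A → ∃ N₀ : ℕ, ∀ N, N₀ ≤ N →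
      ∀ x : Space, ‖x‖ ≤ ρ → ‖(∫ ξ, Complex.exp (phase ξ x) • g ξ)
        - ∫ ξ in Metric.closedBall (0 : Space) A,
          expTaylor N ξ x • g ξ‖ ≤ ε := by
  have htail := (aecover_closedBall (μ := (volume : Measure Space)) (x := 0)
    (tendsto_id (α := ℝ) (x := atTop))).integral_tendsto_of_countably_generated hgi.norm
  obtain ⟨A₀, hA₀⟩ := eventually_atTop.1
    (htail.eventually_const_lt (show (∫ ξ, ‖g ξ‖) - ε / 2 < ∫ ξ, ‖g ξ‖ by linarith))
  refine ⟨A₀, fun A hA => ?_⟩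
  set B := Metric.closedBall (0 : Space) A with hB
  have hBm : MeasurableSet B := Metric.isClosed_closedBall.measurableSet
  have hAt : (∫ ξ, ‖g ξ‖) - ε / 2 < ∫ ξ in B, ‖g ξ‖ := hA₀ A hA
  set I := ∫ ξ in B, ‖g ξ‖ with hI
  have hI0 : 0 ≤ I := integral_nonneg fun _ => norm_nonneg _
  set M := 2 * Real.pi * (max A 0 * max ρ 0) with hM
  have hM0 : 0 ≤ M := by positivity
  have hpow : Tendsto (fun N : ℕ => M ^ N / (N.factorial : ℝ) * 2) atTop (𝓝 0) := by
    simpa using (FloorSemiring.tendsto_pow_div_factorial_atTop M).mul_const 2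
  have hquot : Tendsto (fun N : ℕ => M / ((N.succ : ℕ) : ℝ)) atTop (𝓝 0) :=
    (tendsto_const_nhds (x := M)).div_atTop
      (tendsto_natCast_atTop_atTop.comp (tendsto_add_atTop_nat 1))
  obtain ⟨N₀, hN₀⟩ := eventually_atTop.1
    ((hpow.eventually_lt_const (show 0 < ε / 2 / (I + 1) by positivity)).and
      (hquot.eventually_lt_const (show (0 : ℝ) < 1 / 2 by norm_num)))
  refine ⟨N₀, fun N hN x hx => ?_⟩
  obtain ⟨hN1, hN2⟩ := hN₀ N hN
  have hFc : Continuous fun ξ => Complex.exp (phase ξ x) • g ξ :=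
    (Complex.continuous_exp.comp (continuous_phase_left x)).smul hg
  have hSc : Continuous fun ξ => expTaylor N ξ x • g ξ := (continuous_expTaylor N x).smul hg
  have hnF : ∀ ξ, ‖Complex.exp (phase ξ x) • g ξ‖ = ‖g ξ‖ := fun ξ => by
    rw [norm_smul, norm_exp_phase, one_mul]
  have hFi : Integrable fun ξ => Complex.exp (phase ξ x) • g ξ :=
    hgi.norm.mono' hFc.aestronglyMeasurable (Eventually.of_forall fun ξ => (hnF ξ).le)
  have hsplit := integral_add_compl hBm hFi
  have hsplitn := integral_add_compl hBm hgi.norm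
  have hout : ‖∫ ξ in Bᶜ, Complex.exp (phase ξ x) • g ξ‖ ≤ ε / 2 := by
    refine (norm_integral_le_integral_norm _).trans ?_
    simp only [hnF]
    linarith
  have hin : ‖∫ ξ in B, (Complex.exp (phase ξ x) • g ξ
      - expTaylor N ξ x • g ξ)‖ ≤ ε / 2 := by
    have hb : ∀ᵐ ξ ∂volume.restrict B, ‖Complex.exp (phase ξ x) • g ξ
        - expTaylor N ξ x • g ξ‖
        ≤ ε / 2 / (I + 1) * ‖g ξ‖ := by
      filter_upwards [ae_restrict_mem hBm] with ξ hξ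
      rw [← sub_smul, norm_smul]
      have hp : ‖phase ξ x‖ ≤ M := by
        refine (norm_phase_le ξ x).trans ?_
        simp only [hM]
        gcongr
        · exact (mem_closedBall_zero_iff.1 hξ).trans (le_max_left _ _)
        · exact hx.trans (le_max_left _ _)
      have h2 : ‖phase ξ x‖ / (N.succ : ℕ) ≤ 1 / 2 :=
        (div_le_div_of_nonneg_right hp (by positivity)).trans hN2.le
      have h3 := Complex.exp_bound' h2
      gcongr
      refine h3.trans (le_trans ?_ hN1.le)
      gcongr
    refine (norm_integral_le_of_norm_le (hgi.norm.integrableOn.const_mul _) hb).trans ?_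
    rw [integral_const_mul, ← hI, div_mul_eq_mul_div, div_le_iff₀ (by positivity)]
    nlinarith
  have hsub : (∫ ξ, Complex.exp (phase ξ x) • g ξ)
      - ∫ ξ in B, expTaylor N ξ x • g ξ
      = (∫ ξ in B, (Complex.exp (phase ξ x) • g ξ
        - expTaylor N ξ x • g ξ))
        + ∫ ξ in Bᶜ, Complex.exp (phase ξ x) • g ξ := by
    rw [integral_sub hFi.integrableOn (integrableOn_closedBall_of_continuous hSc A), ← hsplit]
    abel
  rw [hsub]
  refine (norm_add_le _ _).trans ?_
  linarith

/-- The coefficient `(2π i)ⁿ / n! g(ξ)` of the `n`-th term of the expanded Fourier integral. -/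
noncomputable def fourierMoment (g : Space → Spinor) (n : ℕ) (ξ : Space) : Spinor :=
  ((2 * Real.pi * Complex.I) ^ n / (n.factorial : ℂ)) • g ξ

lemma inner_pow_smul_eq (g : Space → Spinor) (n : ℕ) (ξ x : Space) :
    (inner ℝ ξ x) ^ n • fourierMoment g n ξ = (phase ξ x ^ n / (n.factorial : ℂ)) • g ξ := by
  rw [fourierMoment, RCLike.real_smul_eq_coe_smul (K := ℂ), smul_smul]
  congr 1
  simp only [phase]
  push_cast
  simp only [Complex.coe_algebraMap]
  ring

/-- The derivative of the term of degree `n + 1` is the term of degree `n` of the expansion of the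
differentiated Fourier integral. -/
lemma inner_pow_smul_deriv_eq (g : Space → Spinor) (n : ℕ) (ξ x v : Space) :
    (inner ℝ ξ x) ^ n • (((n + 1 : ℕ) : ℝ) • inner ℝ ξ v • fourierMoment g (n + 1) ξ)
      = (phase ξ x ^ n / (n.factorial : ℂ)) • phase ξ v • g ξ := by
  rw [fourierMoment, RCLike.real_smul_eq_coe_smul (K := ℂ), RCLike.real_smul_eq_coe_smul (K := ℂ),
    RCLike.real_smul_eq_coe_smul (K := ℂ), smul_smul, smul_smul, smul_smul, smul_smul]
  congr 1
  simp only [phase, Nat.factorial_succ]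
  have hn : ((n : ℂ) + 1) ≠ 0 := by exact_mod_cast Nat.succ_ne_zero n
  have hn' : (n.factorial : ℂ) ≠ 0 := by exact_mod_cast n.factorial_ne_zero
  push_cast
  simp only [Complex.coe_algebraMap]
  field_simp
  ring

lemma continuous_fourierMoment {g : Space → Spinor} (hg : Continuous g) (n : ℕ) :
    Continuous (fourierMoment g n) := by
  have : Continuous fun ξ => ((2 * Real.pi * Complex.I) ^ n / (n.factorial : ℂ)) • g ξ := by
    fun_prop
  exact this

/-- Smooth compactly supported fields are approximated, with their derivatives, uniformly on balls
by sums of homogeneous polynomials: truncate the Fourier integral and expand the exponential. -/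
lemma exists_homogeneous_approx {f : Space → Spinor} (hf : ContDiff ℝ ∞ f)
    (hc : HasCompactSupport f) (ρ : ℝ) {ε : ℝ} (hε : 0 < ε) :
    ∃ (N : ℕ) (p : ℕ → Space → Spinor), (∀ n, IsHomogeneous n (p n)) ∧ ∀ x : Space, ‖x‖ ≤ ρ →
      ‖f x - ∑ n ∈ Finset.range N, p n x‖ ≤ ε ∧
      ∀ k, ‖fderiv ℝ f x (basisVec k)
        - ∑ n ∈ Finset.range N, fderiv ℝ (p n) x (basisVec k)‖ ≤ ε := by
  obtain ⟨g, hg, hgi, hki, hfx, hfk⟩ := exists_fourier_integral hf hc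
  have hphk : ∀ k, Continuous fun ξ => phase ξ (basisVec k) • g ξ := fun k =>
    (continuous_phase_left (basisVec k)).smul hg
  obtain ⟨A₀, hA₀⟩ := exists_truncation hg hgi ρ hε
  choose A₁ hA₁ using fun k => exists_truncation (hphk k) (hki k) ρ hε
  set A := A₀ ⊔ Finset.univ.sup' Finset.univ_nonempty A₁ with hA
  obtain ⟨N₀, hN₀⟩ := hA₀ A le_sup_left
  choose N₁ hN₁ using fun k => hA₁ k A
    ((Finset.le_sup' A₁ (Finset.mem_univ k)).trans le_sup_right)
  set N := N₀ ⊔ Finset.univ.sup' Finset.univ_nonempty N₁ with hN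
  have hhc : ∀ n, Continuous (fourierMoment g n) := continuous_fourierMoment hg
  have hterm := inner_pow_smul_eq g
  have hterm' := inner_pow_smul_deriv_eq g
  -- differentiating lowers the degree, so `N + 1` terms of the field give `N` of its derivatives
  refine ⟨N + 1, fun n => powerIntegral A n (fourierMoment g n),
    fun n => isHomogeneous_powerIntegral (hhc n) n, fun x hx => ⟨?_, fun k => ?_⟩⟩
  · have h1 := hN₀ (N + 1) (le_sup_left.trans (Nat.le_succ _)) x hx
    rw [hfx]
    have hsum : ∑ n ∈ Finset.range (N + 1), powerIntegral A n (fourierMoment g n) x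
        = ∫ ξ in Metric.closedBall (0 : Space) A, expTaylor (N + 1) ξ x • g ξ := by
      simp only [powerIntegral, hterm, expTaylor, Finset.sum_smul]
      exact (integral_finsetSum _ fun n _ => integrableOn_closedBall_of_continuous
        ((((continuous_phase_left x).pow n).div_const _).smul hg) A).symm
    rw [hsum]
    exact h1
  · have h1 := hN₁ k N ((Finset.le_sup' N₁ (Finset.mem_univ k)).trans le_sup_right) x hx
    rw [hfk]
    have h0 : fderiv ℝ (powerIntegral A 0 (fourierMoment g 0)) x (basisVec k) = 0 := by
      rw [fderiv_powerIntegral (hhc 0)]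
      simp [powerIntegral]
    have hsum : ∑ n ∈ Finset.range (N + 1),
        fderiv ℝ (powerIntegral A n (fourierMoment g n)) x (basisVec k)
          = ∫ ξ in Metric.closedBall (0 : Space) A,
          expTaylor N ξ x • phase ξ (basisVec k) • g ξ := by
      rw [Finset.sum_range_succ', h0, add_zero]
      simp only [fderiv_powerIntegral (hhc _), Nat.add_sub_cancel, powerIntegral, hterm',
        expTaylor, Finset.sum_smul]
      exact (integral_finsetSum _ fun n _ => integrableOn_closedBall_of_continuous
        ((((continuous_phase_left x).pow n).div_const _).smul (hphk k)) A).symm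
    rw [hsum]
    exact h1

/-! ### Density of sums of eigenfunctions in `C¹` -/

/-- A smooth radial cutoff function, equal to `1` on the ball of radius `ρ` and to `0` outside the
ball of radius `|ρ| + 1`. -/
noncomputable def cutoff (ρ : ℝ) (x : Space) : ℝ := Real.smoothTransition (ρ ^ 2 + 1 - ‖x‖ ^ 2)

lemma contDiff_cutoff (ρ : ℝ) : ContDiff ℝ ∞ (cutoff ρ) := by
  have h : ContDiff ℝ ∞ fun x : Space => ρ ^ 2 + 1 - ‖x‖ ^ 2 :=
    contDiff_const.sub (_root_.contDiff_norm_sq ℝ)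
  exact (Real.smoothTransition.contDiff (n := ⊤)).comp h

lemma cutoff_nonneg (ρ : ℝ) (x : Space) : 0 ≤ cutoff ρ x := Real.smoothTransition.nonneg _

lemma cutoff_le_one (ρ : ℝ) (x : Space) : cutoff ρ x ≤ 1 := Real.smoothTransition.le_one _

lemma norm_cutoff_le (ρ : ℝ) (x : Space) : ‖cutoff ρ x‖ ≤ 1 := by
  rw [Real.norm_of_nonneg (cutoff_nonneg ρ x)]
  exact cutoff_le_one ρ x

lemma cutoff_eq_one {ρ : ℝ} {x : Space} (hx : ‖x‖ ≤ ρ) : cutoff ρ x = 1 := by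
  refine Real.smoothTransition.one_of_one_le ?_
  have := pow_le_pow_left₀ (norm_nonneg x) hx 2
  linarith

lemma cutoff_eq_zero {ρ : ℝ} {x : Space} (hx : |ρ| + 1 ≤ ‖x‖) : cutoff ρ x = 0 := by
  refine Real.smoothTransition.zero_of_nonpos ?_
  have := pow_le_pow_left₀ (by positivity) hx 2
  nlinarith [abs_nonneg ρ, sq_abs ρ]

lemma hasCompactSupport_cutoff (ρ : ℝ) : HasCompactSupport (cutoff ρ) :=
  HasCompactSupport.intro (isCompact_closedBall (0 : Space) (|ρ| + 1)) fun x hx =>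
    cutoff_eq_zero (by simpa using (not_le.1 (by simpa using hx)).le)

lemma fderiv_cutoff (ρ : ℝ) (x v : Space) : fderiv ℝ (cutoff ρ) x v
    = (-2 * deriv Real.smoothTransition (ρ ^ 2 + 1 - ‖x‖ ^ 2)) * inner ℝ x v := by
  have h1 : HasFDerivAt (fun x : Space => ρ ^ 2 + 1 - ‖x‖ ^ 2) _ x :=
    (hasStrictFDerivAt_norm_sq x).hasFDerivAt.const_sub (ρ ^ 2 + 1)
  have h2 : HasDerivAt Real.smoothTransition _ (ρ ^ 2 + 1 - ‖x‖ ^ 2) :=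
    ((Real.smoothTransition.contDiff (n := 1)).differentiable (by simp) _).hasDerivAt
  have h3 : HasFDerivAt (cutoff ρ) _ x := h2.comp_hasFDerivAt x h1
  rw [h3.fderiv]
  simp
  ring

lemma exists_norm_fderiv_cutoff_le (ρ : ℝ) : ∃ M, 0 ≤ M ∧ ∀ x v, ‖v‖ ≤ 1 →
    ‖fderiv ℝ (cutoff ρ) x v‖ ≤ M := by
  obtain ⟨M, hM⟩ :=
    ((contDiff_cutoff ρ).continuous_fderiv (by simp)).bounded_above_of_compact_support
    ((hasCompactSupport_cutoff ρ).fderiv (𝕜 := ℝ))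
  refine ⟨M, (norm_nonneg _).trans (hM 0), fun x v hv => ?_⟩
  refine ((fderiv ℝ (cutoff ρ) x).le_opNorm v).trans ?_
  exact (mul_le_of_le_one_right (norm_nonneg _) hv).trans (hM x)

/-- Sums of compactly supported eigenfunctions, with eigenvalues `k ≠ 0`, are dense in the smooth
compactly supported fields with respect to the `C¹` norm. -/
theorem exists_eigenfunctions_approx {f : Space → Spinor} (hf : ContDiff ℝ ∞ f)
    (hc : HasCompactSupport f) : ∃ b : ℝ, ∀ ε : ℝ, 0 < ε →
      ∃ (s : Finset {k : ℤ // k ≠ 0}) (P : {k : ℤ // k ≠ 0} → Space → Spinor),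
        (∀ i, P i ∈ spinOrbitEigenspace i.1) ∧ (∀ i, HasCompactSupport (P i)) ∧
        (∀ x, b < ‖x‖ → ∑ i ∈ s, P i x - f x = 0 ∧
          ∀ k, fderiv ℝ (fun x => ∑ i ∈ s, P i x) x (basisVec k)
            - fderiv ℝ f x (basisVec k) = 0) ∧
        ∀ x, ‖∑ i ∈ s, P i x - f x‖ ≤ ε ∧
          ∀ k, ‖fderiv ℝ (fun x => ∑ i ∈ s, P i x) x (basisVec k)
            - fderiv ℝ f x (basisVec k)‖ ≤ ε := by
  obtain ⟨ρ, hρ0, hρ⟩ := hc.isCompact.isBounded.subset_closedBall_lt 0 (0 : Space)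
  obtain ⟨M, hM0, hM⟩ := exists_norm_fderiv_cutoff_le ρ
  have hχ := contDiff_cutoff ρ
  have hχf : ∀ x, cutoff ρ x • f x = f x := fun x => by
    by_cases hx : ‖x‖ ≤ ρ
    · rw [cutoff_eq_one hx, one_smul]
    · have : f x = 0 := image_eq_zero_of_notMem_tsupport fun h => hx (by simpa using hρ h)
      rw [this, smul_zero]
  refine ⟨ρ + 1, fun ε hε => ?_⟩
  obtain ⟨N, p, hp, hpf⟩ := exists_homogeneous_approx hf hc (ρ + 1)
    -- room for the derivative of the cutoff function, which is at most `M`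
    (show 0 < ε / (1 + M) by positivity)
  set q : Space → Spinor := ∑ n ∈ Finset.range N, p n with hq
  have hqs : ContDiff ℝ ∞ q := by
    rw [hq, show (∑ n ∈ Finset.range N, p n) = fun x => ∑ n ∈ Finset.range N, p n x by
      ext1 x; simp]
    exact ContDiff.sum fun n _ => (hp n).1
  have hqm : q ∈ ⨆ k : {k : ℤ // k ≠ 0}, spinOrbitEigenspace k :=
    Submodule.sum_mem _ fun n _ => (hp n).mem_iSup
  obtain ⟨c, hcm, hcq⟩ := (Submodule.mem_iSup_iff_exists_finsupp _ _).1 hqm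
  have hsum : ∀ x, ∑ i ∈ c.support, cutoff ρ x • c i x = cutoff ρ x • q x := fun x => by
    rw [← hcq, Finsupp.sum, Finset.sum_apply, Finset.smul_sum]
  have hd : ∀ x, ∑ i ∈ c.support, cutoff ρ x • c i x - f x = cutoff ρ x • (q - f) x := fun x => by
    rw [hsum, Pi.sub_apply, smul_sub, hχf]
  have hqd := fun x => hqs.differentiable (by simp) x
  have hfd := fun x => hf.differentiable (by simp) x
  have hχd := fun x => hχ.differentiable (by simp) x
  have hgd : ∀ x, DifferentiableAt ℝ (fun x => ∑ i ∈ c.support, cutoff ρ x • c i x) x :=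
      fun x => by
    simp only [hsum]
    exact (hχd x).smul (hqd x)
  have hd' : ∀ x v, fderiv ℝ (fun x => ∑ i ∈ c.support, cutoff ρ x • c i x) x v - fderiv ℝ f x v
      = cutoff ρ x • (fderiv ℝ q x v - fderiv ℝ f x v)
        + fderiv ℝ (cutoff ρ) x v • (q - f) x := fun x v => by
    have h1 := fderiv_fun_sub (hgd x) (hfd x)
    simp only [hd] at h1
    rw [fderiv_fun_smul (hχd x) ((hqd x).sub (hfd x)), fderiv_sub (hqd x) (hfd x)] at h1
    have h2 := congrArg (fun T : Space →L[ℝ] Spinor => T v) h1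
    simpa using h2.symm
  have hχ0 : ∀ x : Space, ρ + 1 < ‖x‖ → cutoff ρ x = 0 ∧ ∀ v, fderiv ℝ (cutoff ρ) x v = 0 := by
    intro x hx
    refine ⟨cutoff_eq_zero (by rw [abs_of_pos hρ0]; exact hx.le), fun v => ?_⟩
    have h0 : cutoff ρ =ᶠ[𝓝 x] fun _ => (0 : ℝ) := by
      filter_upwards [(isOpen_lt continuous_const continuous_norm).mem_nhds hx] with y hy
      exact cutoff_eq_zero (by rw [abs_of_pos hρ0]; exact le_of_lt hy)
    rw [h0.fderiv_eq]
    simp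
  refine ⟨c.support, fun i x => cutoff ρ x • c i x,
    fun i : {k : ℤ // k ≠ 0} => radial_smul_mem (hcm i) hχ (fderiv_cutoff ρ),
    fun i => (hasCompactSupport_cutoff ρ).smul_right, fun x hx => ?_, fun x => ?_⟩
  · obtain ⟨h0, h0'⟩ := hχ0 x hx
    refine ⟨by rw [hd, h0, zero_smul], fun k => ?_⟩
    rw [hd', h0, h0', zero_smul, zero_smul, add_zero]
  · by_cases hx : ρ + 1 < ‖x‖
    · obtain ⟨h0, h0'⟩ := hχ0 x hx
      refine ⟨by rw [hd, h0, zero_smul, norm_zero]; exact hε.le, fun k => ?_⟩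
      rw [hd', h0, h0', zero_smul, zero_smul, add_zero, norm_zero]
      exact hε.le
    · obtain ⟨h1, h2⟩ := hpf x (not_lt.1 hx)
      have e1 : ‖(q - f) x‖ ≤ ε / (1 + M) := by
        rw [Pi.sub_apply, norm_sub_rev, hq, Finset.sum_apply]
        exact h1
      have e2 : ∀ k, ‖fderiv ℝ q x (basisVec k) - fderiv ℝ f x (basisVec k)‖ ≤ ε / (1 + M) := by
        intro k
        rw [norm_sub_rev, hq, fderiv_sum fun n _ => (hp n).1.differentiable (by simp) x,
          sum_apply]
        exact h2 k
      have e3 : ε / (1 + M) * (1 + M) = ε := div_mul_cancel₀ _ (by positivity)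
      have e4 : 0 ≤ ε / (1 + M) := by positivity
      refine ⟨?_, fun k => ?_⟩
      · rw [hd, norm_smul]
        have := mul_le_mul (norm_cutoff_le ρ x) e1 (norm_nonneg _) zero_le_one
        nlinarith
      · rw [hd']
        refine (norm_add_le _ _).trans ?_
        rw [norm_smul, norm_smul]
        have h3 := mul_le_mul (norm_cutoff_le ρ x) (e2 k) (norm_nonneg _) zero_le_one
        have h4 := mul_le_mul (hM x (basisVec k) (norm_basisVec k).le) e1 (norm_nonneg _) hM0
        linarith

/-! ### Passing to the limit in the inequality -/

section Limits

variable {α : Type*} [MeasurableSpace α] {μ : Measure α}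

lemma integral_norm_sq_eq_norm_toLp_sq {u : α → Spinor} (hu : MemLp u 2 μ) :
    ∫ x, ‖u x‖ ^ 2 ∂μ = ‖hu.toLp u‖ ^ 2 := by
  rw [Lp.norm_toLp, hu.eLpNorm_eq_integral_rpow_norm two_ne_zero ENNReal.ofNat_ne_top]
  have h0 : 0 ≤ ∫ x, ‖u x‖ ^ 2 ∂μ := integral_nonneg fun _ => sq_nonneg _
  simp only [ENNReal.toReal_ofNat, Real.rpow_ofNat]
  rw [ENNReal.toReal_ofReal (by positivity), ← Real.rpow_natCast, ← Real.rpow_mul h0]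
  norm_num

lemma tendsto_integral_norm_sq {u : ℕ → α → Spinor} {v : α → Spinor} (hu : ∀ n, MemLp (u n) 2 μ)
    (hv : MemLp v 2 μ) (h : Tendsto (fun n => eLpNorm (fun x => u n x - v x) 2 μ) atTop (𝓝 0)) :
    Tendsto (fun n => ∫ x, ‖u n x‖ ^ 2 ∂μ) atTop (𝓝 (∫ x, ‖v x‖ ^ 2 ∂μ)) := by
  have h1 := (Lp.tendsto_Lp_iff_tendsto_eLpNorm'' u hu v hv).2 h
  simp only [integral_norm_sq_eq_norm_toLp_sq hv, fun n => integral_norm_sq_eq_norm_toLp_sq (hu n)]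
  exact h1.norm.pow 2

/-- Fatou's lemma for weighted integrals of an `L²`-convergent sequence. -/
lemma integrable_and_integral_le_of_tendsto {u : ℕ → α → Spinor} {v : α → Spinor} {w : α → ℝ}
    (hw : AEStronglyMeasurable w μ) (hw0 : ∀ᵐ x ∂μ, 0 ≤ w x)
    (hu : ∀ n, AEStronglyMeasurable (u n) μ) (hv : AEStronglyMeasurable v μ)
    (h : Tendsto (fun n => eLpNorm (fun x => u n x - v x) 2 μ) atTop (𝓝 0))
    (hi : ∀ n, Integrable (fun x => w x * ‖u n x‖ ^ 2) μ) {a : ℕ → ℝ} {l : ℝ}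
    (ha : Tendsto a atTop (𝓝 l)) (hle : ∀ n, ∫ x, w x * ‖u n x‖ ^ 2 ∂μ ≤ a n) :
    Integrable (fun x => w x * ‖v x‖ ^ 2) μ ∧ ∫ x, w x * ‖v x‖ ^ 2 ∂μ ≤ l := by
  obtain ⟨ns, hns, hae⟩ :=
    (tendstoInMeasure_of_tendsto_eLpNorm two_ne_zero hu hv h).exists_seq_tendsto_ae
  have hvm : AEStronglyMeasurable (fun x => w x * ‖v x‖ ^ 2) μ := hw.mul (hv.norm.pow 2)
  have hv0 : 0 ≤ᵐ[μ] fun x => w x * ‖v x‖ ^ 2 := by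
    filter_upwards [hw0] with x hx
    positivity
  have hun0 : ∀ n, 0 ≤ᵐ[μ] fun x => w x * ‖u n x‖ ^ 2 := fun n => by
    filter_upwards [hw0] with x hx
    positivity
  have hfatou : ∫⁻ x, ENNReal.ofReal (w x * ‖v x‖ ^ 2) ∂μ ≤ ENNReal.ofReal l := by
    have h1 : ∫⁻ x, ENNReal.ofReal (w x * ‖v x‖ ^ 2) ∂μ
        = ∫⁻ x, liminf (fun i => ENNReal.ofReal (w x * ‖u (ns i) x‖ ^ 2)) atTop ∂μ := by
      refine lintegral_congr_ae ?_
      filter_upwards [hae] with x hx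
      exact (ENNReal.tendsto_ofReal ((hx.norm.pow 2).const_mul (w x))).liminf_eq.symm
    rw [h1]
    refine (lintegral_liminf_le'
      fun i => (hi (ns i)).aestronglyMeasurable.aemeasurable.ennreal_ofReal).trans ?_
    have h2 : Tendsto (fun i => ENNReal.ofReal (a (ns i))) atTop (𝓝 (ENNReal.ofReal l)) :=
      ENNReal.tendsto_ofReal (ha.comp hns.tendsto_atTop)
    rw [← h2.liminf_eq]
    refine liminf_le_liminf (Eventually.of_forall fun i => ?_)
    rw [← ofReal_integral_eq_lintegral_ofReal (hi _) (hun0 _)]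
    exact ENNReal.ofReal_le_ofReal (hle _)
  have hint : Integrable (fun x => w x * ‖v x‖ ^ 2) μ :=
    ⟨hvm, (hasFiniteIntegral_iff_ofReal hv0).2 (hfatou.trans_lt ENNReal.ofReal_lt_top)⟩
  refine ⟨hint, ?_⟩
  have hl : 0 ≤ l := ge_of_tendsto' ha fun n => (integral_nonneg_of_ae (hun0 n)).trans (hle n)
  rw [← ofReal_integral_eq_lintegral_ofReal hint hv0] at hfatou
  exact (ENNReal.ofReal_le_ofReal_iff hl).1 hfatou

lemma tendsto_eLpNorm_smul {u : ℕ → α → Spinor} {v : α → Spinor} {w : α → ℝ}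
    (hw : ∀ᵐ x ∂μ, ‖w x‖ ≤ 1)
    (h : Tendsto (fun n => eLpNorm (fun x => u n x - v x) 2 μ) atTop (𝓝 0)) :
    Tendsto (fun n => eLpNorm (fun x => w x • u n x - w x • v x) 2 μ) atTop (𝓝 0) := by
  refine tendsto_of_tendsto_of_tendsto_of_le_of_le tendsto_const_nhds h (fun _ => zero_le)
    fun n => eLpNorm_mono_ae ?_
  filter_upwards [hw] with x hx
  rw [← smul_sub, norm_smul]
  exact mul_le_of_le_one_left (norm_nonneg _) hx

end Limits

lemma memLp_of_hasCompactSupport {μ : Measure Space} [IsFiniteMeasureOnCompacts μ]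
    {f : Space → Spinor} (hf : Continuous f) (hc : HasCompactSupport f) : MemLp f 2 μ :=
  hf.memLp_of_hasCompactSupport hc

lemma memLp_sigmaGrad {G : Fin 3 → Space → Spinor} (hG : ∀ k, MemLp (G k) 2 volume) :
    MemLp (sigmaGrad G) 2 volume := by
  have : sigmaGrad G = fun x => ∑ k, pauliOp k (G k x) := funext (sigmaGrad_eq G)
  rw [this]
  exact memLp_finsetSum _ fun k _ => (pauliOp k).comp_memLp' (hG k)

lemma tendsto_eLpNorm_dirac {f : ℕ → Space → Spinor} {G : Fin 3 → Space → Spinor}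
    (hf : ∀ n, ContDiff ℝ ∞ (f n)) (hG : ∀ k, MemLp (G k) 2 volume)
    (h : ∀ k, Tendsto (fun n => eLpNorm (fun x => fderiv ℝ (f n) x (basisVec k) - G k x) 2 volume)
      atTop (𝓝 0)) :
    Tendsto (fun n => eLpNorm (fun x => dirac (f n) x - sigmaGrad G x) 2 volume) atTop (𝓝 0) := by
  have hs : Tendsto
      (fun n => ∑ k, eLpNorm (fun x => fderiv ℝ (f n) x (basisVec k) - G k x) 2 volume)
      atTop (𝓝 0) := by
    simpa using tendsto_finsetSum Finset.univ fun k _ => h k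
  refine tendsto_of_tendsto_of_tendsto_of_le_of_le tendsto_const_nhds hs (fun _ => zero_le)
    fun n => ?_
  have hd : ∀ k, AEStronglyMeasurable (fun x => fderiv ℝ (f n) x (basisVec k) - G k x) volume :=
    fun k => (((hf n).continuous_fderiv (by simp)).clm_apply
      continuous_const).aestronglyMeasurable.sub (hG k).1
  have e : (fun x => dirac (f n) x - sigmaGrad G x)
      = ∑ k, fun x => pauliOp k (fderiv ℝ (f n) x (basisVec k) - G k x) := by
    funext x
    simp [dirac, sigmaGrad_eq, Finset.sum_sub_distrib]
  rw [e]
  refine (eLpNorm_sum_le (fun k _ => (pauliOp k).continuous.comp_aestronglyMeasurable (hd k))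
    one_le_two).trans (Finset.sum_le_sum fun k _ => eLpNorm_mono fun x => ?_)
  rw [norm_pauliOp]

/-- The sequence `f` converges to `(φ, G)` in `H¹`, and its restrictions to the sphere converge to
`τ` in `L²(S_R)`. -/
structure TendstoWithTrace (R : ℝ) (f : ℕ → Space → Spinor) (φ : Space → Spinor)
    (G : Fin 3 → Space → Spinor) (τ : Space → Spinor) : Prop where
  tendsto : Tendsto (fun n => eLpNorm (fun x => f n x - φ x) 2 volume) atTop (𝓝 0)
  tendsto_grad : ∀ k, Tendsto (fun n => eLpNorm (fun x => fderiv ℝ (f n) x (basisVec k) - G k x)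
    2 volume) atTop (𝓝 0)
  tendsto_trace : Tendsto (fun n => eLpNorm (fun x => f n x - τ x) 2 (sphereMeasure R)) atTop (𝓝 0)

/-- The inequality passes to limits: Fatou's lemma controls the term with the weight `V`, and all
other terms are continuous. -/
theorem hardy_of_tendsto {V : ℝ → ℝ} {R C : ℝ}
    (hV : LocallyIntegrable (fun x : Space => V ‖x‖) volume) (hV0 : ∀ᵐ x : Space, 0 ≤ V ‖x‖)
    {f : ℕ → Space → Spinor} (hf : ∀ n, ContDiff ℝ ∞ (f n)) (hc : ∀ n, HasCompactSupport (f n))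
    (h : ∀ n, SmoothHardy V R C (f n)) {φ τ : Space → Spinor} {G : Fin 3 → Space → Spinor}
    (hφ : MemLp φ 2 volume) (hG : ∀ k, MemLp (G k) 2 volume) (hτ : MemLp τ 2 (sphereMeasure R))
    (ht : TendstoWithTrace R f φ G τ) :
    Integrable (fun x => V ‖x‖ * ‖φ x‖ ^ 2) volume ∧
    (∫ x, V ‖x‖ * ‖φ x‖ ^ 2) + C * ∫ x, ‖τ x‖ ^ 2 ∂(sphereMeasure R) ≤
      ∫ x, (‖sigmaGrad G x‖ ^ 2 / (1 + V ‖x‖) + ‖φ x‖ ^ 2) := by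
  -- with the square root of the weight `1 / (1 + V)` the weighted energy is an `L²` norm
  set w : Space → ℝ := fun x => (√(1 + V ‖x‖))⁻¹ with hw
  have hVm := hV.aestronglyMeasurable
  have hwm : AEStronglyMeasurable w volume :=
    ((hVm.aemeasurable.const_add 1).sqrt.inv).aestronglyMeasurable
  have hw1 : ∀ᵐ x, ‖w x‖ ≤ 1 := by
    filter_upwards [hV0] with x hx
    rw [Real.norm_of_nonneg (by positivity)]
    exact inv_le_one_of_one_le₀ (Real.one_le_sqrt.2 (by linarith))
  have hwsq : ∀ u : Space → Spinor,
      (fun x => ‖u x‖ ^ 2 / (1 + V ‖x‖)) =ᵐ[volume] fun x => ‖w x • u x‖ ^ 2 := fun u => by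
    filter_upwards [hV0] with x hx
    rw [norm_smul, Real.norm_of_nonneg (by positivity), mul_pow, hw, inv_pow,
      Real.sq_sqrt (by linarith), div_eq_inv_mul]
  have hwL : ∀ u : Space → Spinor, MemLp u 2 volume → MemLp (fun x => w x • u x) 2 volume :=
    fun u hu => hu.of_le (hwm.smul hu.1) <| by
      filter_upwards [hw1] with x hx
      rw [norm_smul]
      exact mul_le_of_le_one_left (norm_nonneg _) hx
  have hd : ∀ n, MemLp (dirac (f n)) 2 volume := fun n =>
    memLp_of_hasCompactSupport (contDiff_dirac (hf n)).continuous (hasCompactSupport_dirac (hc n))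
  have hs := memLp_sigmaGrad hG
  have t1 := tendsto_integral_norm_sq (fun n => hwL _ (hd n)) (hwL _ hs)
    (tendsto_eLpNorm_smul hw1 (tendsto_eLpNorm_dirac hf hG ht.tendsto_grad))
  have hfL : ∀ n, MemLp (f n) 2 volume := fun n =>
    memLp_of_hasCompactSupport (hf n).continuous (hc n)
  have t2 := tendsto_integral_norm_sq hfL hφ ht.tendsto
  have t3 := tendsto_integral_norm_sq (fun n => memLp_of_hasCompactSupport (hf n).continuous (hc n))
    hτ ht.tendsto_trace
  have hen : ∀ n, ∫ x, (‖dirac (f n) x‖ ^ 2 / (1 + V ‖x‖) + ‖f n x‖ ^ 2)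
      = (∫ x, ‖w x • dirac (f n) x‖ ^ 2) + ∫ x, ‖f n x‖ ^ 2 := fun n => by
    obtain ⟨i1, i2, -⟩ := integrable_energy hV hV0 (hf n) (hc n)
    rw [integral_add i1 i2, integral_congr_ae (hwsq _)]
  have hen' : ∫ x, (‖sigmaGrad G x‖ ^ 2 / (1 + V ‖x‖) + ‖φ x‖ ^ 2)
      = (∫ x, ‖w x • sigmaGrad G x‖ ^ 2) + ∫ x, ‖φ x‖ ^ 2 := by
    have i1 := (hwL _ hs).integrable_norm_pow two_ne_zero
    rw [integral_add (i1.congr (hwsq _).symm) (hφ.integrable_norm_pow two_ne_zero),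
      integral_congr_ae (hwsq _)]
  obtain ⟨hi, hle⟩ := integrable_and_integral_le_of_tendsto hVm hV0 (fun n => (hfL n).1) hφ.1
    ht.tendsto (fun n => integrable_radial_mul_norm_sq hV (hf n).continuous (hc n))
    ((t1.add t2).sub (t3.const_mul C)) fun n => by
      have := h n
      rw [SmoothHardy, hen] at this
      linarith
  refine ⟨hi, ?_⟩
  rw [hen']
  linarith

lemma tendsto_eLpNorm_zero_of_norm_le {μ : Measure Space} [IsFiniteMeasureOnCompacts μ]
    {u : ℕ → Space → Spinor} {b : ℝ} (hb : ∀ n x, b < ‖x‖ → u n x = 0) {ε : ℕ → ℝ}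
    (hε : Tendsto ε atTop (𝓝 0)) (hu : ∀ n x, ‖u n x‖ ≤ ε n) :
    Tendsto (fun n => eLpNorm (u n) 2 μ) atTop (𝓝 0) := by
  set B := Metric.closedBall (0 : Space) b with hB
  have hBm : MeasurableSet B := Metric.isClosed_closedBall.measurableSet
  have hμB : μ B ≠ (∞ : ℝ≥0∞) := (isCompact_closedBall 0 b).measure_lt_top.ne
  have h1 : ∀ n, eLpNorm (u n) 2 μ ≤ μ B ^ (2 : ℝ≥0∞).toReal⁻¹ * ENNReal.ofReal (ε n) :=
      fun n => by
    have : u n = B.indicator (u n) := (indicator_eq_self.2 fun x hx => by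
      by_contra hxB
      exact hx (hb n x (by simpa [hB] using hxB))).symm
    rw [this, eLpNorm_indicator_eq_eLpNorm_restrict hBm]
    refine (eLpNorm_le_of_ae_bound (Eventually.of_forall (hu n))).trans_eq ?_
    rw [Measure.restrict_apply_univ]
  have h2 : Tendsto (fun n => μ B ^ (2 : ℝ≥0∞).toReal⁻¹ * ENNReal.ofReal (ε n)) atTop (𝓝 0) := by
    have := ENNReal.Tendsto.const_mul (a := μ B ^ (2 : ℝ≥0∞).toReal⁻¹) (ENNReal.tendsto_ofReal hε)
      (Or.inr (ENNReal.rpow_ne_top_of_nonneg (by positivity) hμB))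
    simpa using this
  exact tendsto_of_tendsto_of_tendsto_of_le_of_le tendsto_const_nhds h2 (fun _ => zero_le) h1

/-- The inequality holds for smooth compactly supported fields if it does on each eigenspace of the
spin-orbit operator. -/
theorem smoothHardy_of_eigenspaces {V : ℝ → ℝ} {R C : ℝ}
    (hV : LocallyIntegrable (fun x : Space => V ‖x‖) volume) (hV0 : ∀ᵐ x : Space, 0 ≤ V ‖x‖)
    (h : ∀ k : ℤ, k ≠ 0 → ∀ f ∈ spinOrbitEigenspace k, HasCompactSupport f → SmoothHardy V R C f)
    {f : Space → Spinor} (hf : ContDiff ℝ ∞ f) (hc : HasCompactSupport f) :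
    SmoothHardy V R C f := by
  obtain ⟨b, hb⟩ := exists_eigenfunctions_approx hf hc
  choose s P hP hPc hPb hPε using fun n : ℕ => hb (1 / ((n : ℝ) + 1)) (by positivity)
  have hε : Tendsto (fun n : ℕ => 1 / ((n : ℝ) + 1)) atTop (𝓝 0) :=
    tendsto_one_div_add_atTop_nhds_zero_nat
  have hcs : ∀ n, HasCompactSupport fun x => ∑ i ∈ s n, P n i x := fun n => by
    obtain ⟨b', hb'⟩ := hc.isCompact.isBounded.subset_closedBall (0 : Space)
    refine HasCompactSupport.intro (isCompact_closedBall (0 : Space) (max b b')) fun x hx => ?_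
    have hx' : max b b' < ‖x‖ := by simpa using hx
    have h1 := (hPb n x ((le_max_left _ _).trans_lt hx')).1
    have h2 : f x = 0 := image_eq_zero_of_notMem_tsupport fun h =>
      absurd ((le_max_right _ _).trans_lt hx') (not_lt.2 (by simpa using hb' h))
    simpa [h2] using h1
  -- a smooth field is its own limit, gradient and trace
  have key := hardy_of_tendsto (R := R) (C := C) (τ := f) hV hV0
    (f := fun n x => ∑ i ∈ s n, P n i x) (fun n => ContDiff.sum fun i _ => (hP n i).1) hcs
    (fun n => smoothHardy_sum hV hV0 (s n) Subtype.val_injective (hP n) (hPc n)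
      fun i => h i.1 i.2 _ (hP n i) (hPc n i))
    (memLp_of_hasCompactSupport hf.continuous hc)
    (fun k => memLp_of_hasCompactSupport
      ((hf.continuous_fderiv (by simp)).clm_apply (continuous_const (y := basisVec k)))
      (hc.fderiv_apply (𝕜 := ℝ) (basisVec k)))
    (memLp_of_hasCompactSupport hf.continuous hc)
    ⟨tendsto_eLpNorm_zero_of_norm_le (fun n x hx => (hPb n x hx).1) hε fun n x => (hPε n x).1,
      fun k => tendsto_eLpNorm_zero_of_norm_le (fun n x hx => (hPb n x hx).2 k) hε
        fun n x => (hPε n x).2 k,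
      tendsto_eLpNorm_zero_of_norm_le (fun n x hx => (hPb n x hx).1) hε fun n x => (hPε n x).1⟩
  simpa only [SmoothHardy, sigmaGrad_fderiv] using key.2

/-! ### Density of smooth compactly supported fields in `H¹` -/

/-- Continuity of translations in `L²`. -/
lemma exists_eLpNorm_translate_le {u : Space → Spinor} (hu : MemLp u 2 volume) {ε : ℝ≥0∞}
    (hε : ε ≠ 0) : ∃ r : ℝ, 0 < r ∧ ∀ y : Space, ‖y‖ < r →
      eLpNorm (fun x => u (x - y) - u x) 2 volume ≤ ε := by
  have : Fact ((1 : ℝ≥0∞) ≤ 2) := ⟨one_le_two⟩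
  set T : C(Space, C(Space, Space)) :=
    (ContinuousMap.mk (fun p : Space × Space => p.2 - p.1) (by fun_prop)).curry with hT
  have hmp : ∀ y, MeasurePreserving (T y) (volume : Measure Space) volume := fun y =>
    measurePreserving_sub_right volume y
  have hcont : Continuous fun y => Lp.compMeasurePreserving (T y) (hmp y) (hu.toLp u) :=
    (continuous_const (y := hu.toLp u)).compMeasurePreservingLp T.continuous hmp
      ENNReal.ofNat_ne_top
  have h0 : Tendsto (fun y => eLpNorm (fun x => u (x - y) - u x) 2 volume) (𝓝 0) (𝓝 0) := by
    have h1 := (Lp.tendsto_Lp_iff_tendsto_eLpNorm' _ _).1 (hcont.tendsto 0)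
    refine h1.congr fun y => eLpNorm_congr_ae ?_
    have e1 : ∀ z, (Lp.compMeasurePreserving (T z) (hmp z) (hu.toLp u) : Space → Spinor)
        =ᵐ[volume] fun x => u (x - z) := fun z =>
      (Lp.coeFn_compMeasurePreserving _ (hmp z)).trans
        ((hmp z).quasiMeasurePreserving.ae_eq_comp hu.coeFn_toLp)
    filter_upwards [e1 y, e1 0] with x hx hx0
    rw [Pi.sub_apply, hx, hx0, sub_zero]
  obtain ⟨r, hr, hr'⟩ := Metric.eventually_nhds_iff.1
    (h0.eventually (Iic_mem_nhds (pos_iff_ne_zero.2 hε)))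
  exact ⟨r, hr, fun y hy => hr' (by simpa using hy)⟩

/-- Jensen's inequality for the square of an average. -/
lemma enorm_integral_smul_sq_le {ρ : Space → ℝ} (hρ : Measurable ρ) (hρ0 : ∀ y, 0 ≤ ρ y)
    (hρ1 : ∫⁻ y, ENNReal.ofReal (ρ y) = 1) {h : Space → Spinor}
    (hh : AEStronglyMeasurable h volume) :
    ‖∫ y, ρ y • h y‖ₑ ^ 2 ≤ ∫⁻ y, ENNReal.ofReal (ρ y) * ‖h y‖ₑ ^ 2 := by
  have hm : AEMeasurable (fun y => ENNReal.ofReal (ρ y)) volume := hρ.ennreal_ofReal.aemeasurable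
  have h1 : ‖∫ y, ρ y • h y‖ₑ ≤ ∫⁻ y, ENNReal.ofReal (ρ y) * ‖h y‖ₑ := by
    refine (enorm_integral_le_lintegral_enorm _).trans_eq (lintegral_congr fun y => ?_)
    rw [enorm_smul, Real.enorm_of_nonneg (hρ0 y)]
  have h2 := ENNReal.lintegral_mul_norm_pow_le hm (hm.mul (hh.enorm.pow_const 2))
    (show (0 : ℝ) ≤ 1 / 2 by norm_num) (show (0 : ℝ) ≤ 1 / 2 by norm_num) (by norm_num)
  have h3 : ∀ y, ENNReal.ofReal (ρ y) ^ (1 / 2 : ℝ)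
      * (ENNReal.ofReal (ρ y) * ‖h y‖ₑ ^ 2) ^ (1 / 2 : ℝ) = ENNReal.ofReal (ρ y) * ‖h y‖ₑ := by
    intro y
    rw [← ENNReal.mul_rpow_of_nonneg _ _ (by norm_num), ← mul_assoc, ← sq, ← mul_pow,
      ← ENNReal.rpow_natCast, ← ENNReal.rpow_mul]
    norm_num
  simp only [Pi.mul_apply, h3, hρ1, ENNReal.one_rpow, one_mul] at h2
  refine (pow_le_pow_left' (h1.trans h2) 2).trans_eq ?_
  rw [← ENNReal.rpow_natCast, ← ENNReal.rpow_mul]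
  norm_num

section Mollify

open scoped Convolution

variable {ρ : Space → ℝ}

lemma eLpNorm_sq_eq_lintegral {μ : Measure Space} (u : Space → Spinor) :
    eLpNorm u 2 μ ^ 2 = ∫⁻ x, ‖u x‖ₑ ^ 2 ∂μ := by
  rw [eLpNorm_eq_lintegral_rpow_enorm_toReal two_ne_zero ENNReal.ofNat_ne_top,
    ← ENNReal.rpow_natCast, ← ENNReal.rpow_mul]
  simp

/-- Averaging over small translations changes a square integrable field little. -/
lemma eLpNorm_convolution_sub_le (hρ : ContDiff ℝ ∞ ρ) (hρc : HasCompactSupport ρ)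
    (hρ0 : ∀ y, 0 ≤ ρ y) (hρ1 : ∫ y, ρ y = 1) {r : ℝ} (hρr : ∀ y, ρ y ≠ 0 → ‖y‖ < r)
    {u : Space → Spinor} (hu : MemLp u 2 volume) {ε : ℝ≥0∞}
    (h : ∀ y : Space, ‖y‖ < r → eLpNorm (fun x => u (x - y) - u x) 2 volume ≤ ε) :
    eLpNorm (fun x => (ρ ⋆[ContinuousLinearMap.lsmul ℝ ℝ, volume] u) x - u x) 2 volume ≤ ε := by
  have hρi : Integrable ρ := hρ.continuous.integrable_of_hasCompactSupport hρc
  have hρl : ∫⁻ y, ENNReal.ofReal (ρ y) = 1 := by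
    rw [← ofReal_integral_eq_lintegral_ofReal hρi (Eventually.of_forall hρ0), hρ1,
      ENNReal.ofReal_one]
  have hex : ConvolutionExists ρ u (ContinuousLinearMap.lsmul ℝ ℝ) volume :=
    hρc.convolutionExists_left _ hρ.continuous (hu.locallyIntegrable one_le_two)
  have hshift : ∀ x, AEStronglyMeasurable (fun y => u (x - y) - u x) volume := fun x =>
    (hu.1.comp_quasiMeasurePreserving
      (quasiMeasurePreserving_sub_left volume x)).sub aestronglyMeasurable_const
  have hpt : ∀ x, ‖(ρ ⋆[ContinuousLinearMap.lsmul ℝ ℝ, volume] u) x - u x‖ₑ ^ 2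
      ≤ ∫⁻ y, ENNReal.ofReal (ρ y) * ‖u (x - y) - u x‖ₑ ^ 2 := fun x => by
    have e : (ρ ⋆[ContinuousLinearMap.lsmul ℝ ℝ, volume] u) x - u x
        = ∫ y, ρ y • (u (x - y) - u x) := by
      have i1 : Integrable (fun y => ρ y • u (x - y)) volume := hex x
      simp only [smul_sub]
      rw [integral_sub i1 (hρi.smul_const _), integral_smul_const, hρ1, one_smul]
      rfl
    rw [e]
    exact enorm_integral_smul_sq_le hρ.continuous.measurable hρ0 hρl (hshift x)
  have hprod : AEMeasurable (Function.uncurry fun x y =>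
      ENNReal.ofReal (ρ y) * ‖u (x - y) - u x‖ₑ ^ 2) (volume.prod (volume : Measure Space)) := by
    have m1 : AEStronglyMeasurable (fun p : Space × Space => u (p.1 - p.2))
        (volume.prod (volume : Measure Space)) := hu.1.comp_quasiMeasurePreserving
      (quasiMeasurePreserving_sub_of_right_invariant volume volume)
    have m2 : AEStronglyMeasurable (fun p : Space × Space => u p.1)
        (volume.prod (volume : Measure Space)) := hu.1.comp_fst
    exact ((hρ.continuous.measurable.comp measurable_snd).ennreal_ofReal.aemeasurable).mul
      ((m1.sub m2).enorm.pow_const 2)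
  rw [← ENNReal.pow_le_pow_left_iff two_ne_zero, eLpNorm_sq_eq_lintegral]
  refine (lintegral_mono hpt).trans ?_
  rw [lintegral_lintegral_swap hprod]
  calc ∫⁻ y, ∫⁻ x, ENNReal.ofReal (ρ y) * ‖u (x - y) - u x‖ₑ ^ 2
      ≤ ∫⁻ y, ENNReal.ofReal (ρ y) * ε ^ 2 := by
        refine lintegral_mono fun y => ?_
        rw [lintegral_const_mul' _ _ ENNReal.ofReal_ne_top, ← eLpNorm_sq_eq_lintegral]
        by_cases hy : ρ y = 0
        · simp [hy]
        · gcongr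
          exact h y (hρr y hy)
    _ = ε ^ 2 := by
        rw [lintegral_mul_const _ hρ.continuous.measurable.ennreal_ofReal, hρl, one_mul]

/-- Mollification commutes with the weak gradient. -/
lemma fderiv_convolution_of_isH1WithGrad (hρ : ContDiff ℝ ∞ ρ) (hρc : HasCompactSupport ρ)
    {φ : Space → Spinor} {G : Fin 3 → Space → Spinor} (hφ : IsH1WithGrad φ G) (k : Fin 3)
    (x : Space) : fderiv ℝ (ρ ⋆[ContinuousLinearMap.lsmul ℝ ℝ, volume] φ) x (basisVec k)
      = (ρ ⋆[ContinuousLinearMap.lsmul ℝ ℝ, volume] (G k)) x := by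
  have hloc := hφ.memLp.locallyIntegrable one_le_two
  have hd := hρc.hasFDerivAt_convolution_left (ContinuousLinearMap.lsmul ℝ ℝ)
    (hρ.of_le (by norm_num)) hloc x
  have hex : ConvolutionExistsAt (fderiv ℝ ρ) φ x
      ((ContinuousLinearMap.lsmul ℝ ℝ : ℝ →L[ℝ] Spinor →L[ℝ] Spinor).precompL Space) volume :=
    (hρc.fderiv (𝕜 := ℝ)).convolutionExists_left _ (hρ.continuous_fderiv (by simp)) hloc x
  have hψ : ContDiff ℝ ∞ fun y => ρ (x - y) := hρ.comp (contDiff_const.sub contDiff_id)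
  have hψc : HasCompactSupport fun y => ρ (x - y) :=
    hρc.comp_homeomorph (Homeomorph.subLeft x)
  have hw := hφ.weak_deriv k _ hψ hψc
  have hψd : ∀ y, fderiv ℝ (fun y => ρ (x - y)) y (basisVec k)
      = -fderiv ℝ ρ (x - y) (basisVec k) := fun y => by
    have h1 : HasFDerivAt (fun y => ρ (x - y)) _ y :=
      ((hρ.differentiable (by simp) (x - y)).hasFDerivAt).comp y
        ((hasFDerivAt_id y).const_sub x)
    rw [h1.fderiv]
    simp
  simp only [hψd, neg_smul, integral_neg, neg_inj] at hw
  have c1 := integral_sub_left_eq_self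
    (fun t => fderiv ℝ ρ t (basisVec k) • φ (x - t)) volume x
  have c2 := integral_sub_left_eq_self (fun t => ρ t • G k (x - t)) volume x
  simp only [sub_sub_cancel] at c1 c2
  rw [hd.fderiv, convolution_def, ContinuousLinearMap.integral_apply hex, convolution_def]
  exact c1.symm.trans (hw.trans c2)

end Mollify

/-- Approximation by smooth fields through mollification with a bump function whose support is so
small that translations by its elements move `φ` and all `G k` by at most `ε` in `L²`. -/
lemma exists_smooth_approx {φ : Space → Spinor} {G : Fin 3 → Space → Spinor}
    (hφ : IsH1WithGrad φ G) {ε : ℝ≥0∞} (hε : ε ≠ 0) : ∃ g : Space → Spinor, ContDiff ℝ ∞ g ∧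
      eLpNorm (fun x => g x - φ x) 2 volume ≤ ε ∧
      ∀ k, eLpNorm (fun x => fderiv ℝ g x (basisVec k) - G k x) 2 volume ≤ ε := by
  obtain ⟨r, hr, h⟩ := exists_eLpNorm_translate_le hφ.memLp hε
  choose s hs hs' using fun k => exists_eLpNorm_translate_le (hφ.memLp_grad k) hε
  set t := min r (Finset.univ.inf' Finset.univ_nonempty s) with ht
  have ht0 : 0 < t := lt_min hr ((Finset.lt_inf'_iff _).2 fun k _ => hs k)
  have hts : ∀ k, t ≤ s k := fun k =>
    (min_le_right _ _).trans (Finset.inf'_le _ (Finset.mem_univ k))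
  let b : ContDiffBump (0 : Space) := ⟨t / 2, t, by linarith, by linarith⟩
  have hb : ContDiff ℝ ∞ (b.normed volume) := b.contDiff_normed (n := ⊤)
  have hbc : HasCompactSupport (b.normed volume) := b.hasCompactSupport_normed
  have hbr : ∀ y, b.normed volume y ≠ 0 → ‖y‖ < t := fun y hy => by
    have : y ∈ Function.support (b.normed volume) := hy
    rw [b.support_normed_eq] at this
    simpa using this
  refine ⟨_, hbc.contDiff_convolution_left (n := ⊤) (ContinuousLinearMap.lsmul ℝ ℝ) hb
    (hφ.memLp.locallyIntegrable one_le_two),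
    eLpNorm_convolution_sub_le hb hbc b.nonneg_normed b.integral_normed hbr hφ.memLp
      fun y hy => h y (hy.trans_le (min_le_left _ _)), fun k => ?_⟩
  simp only [fderiv_convolution_of_isH1WithGrad hb hbc hφ k]
  exact eLpNorm_convolution_sub_le hb hbc b.nonneg_normed b.integral_normed hbr (hφ.memLp_grad k)
      fun y hy => hs' k y (hy.trans_le (hts k))

/-- The cutoff function at scale `n + 1`. -/
noncomputable def scaledCutoff (n : ℕ) (x : Space) : ℝ := cutoff 1 (((n : ℝ) + 1)⁻¹ • x)

lemma tendsto_eLpNorm_scaledCutoff_smul_sub {u : Space → Spinor} (hu : MemLp u 2 volume) :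
    Tendsto (fun n => eLpNorm (fun x => scaledCutoff n x • u x - u x) 2 volume) atTop (𝓝 0) := by
  rw [ENNReal.tendsto_nhds_zero]
  intro ε hε
  obtain ⟨w, hwc, hw, -, -⟩ :=
    hu.exists_hasCompactSupport_eLpNorm_sub_le ENNReal.ofNat_ne_top hε.ne'
  obtain ⟨b, hb⟩ := hwc.isCompact.isBounded.subset_closedBall (0 : Space)
  filter_upwards [eventually_ge_atTop ⌈b⌉₊] with n hn
  refine (eLpNorm_mono fun x => ?_).trans hw
  have hw0 : (scaledCutoff n x - 1) • w x = 0 := by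
    by_cases hx : w x = 0
    · rw [hx, smul_zero]
    · have h1 : ‖x‖ ≤ b := by simpa using hb (subset_tsupport w hx)
      have h2 : ‖x‖ ≤ (n : ℝ) + 1 :=
        (h1.trans ((Nat.le_ceil b).trans (Nat.cast_le.2 hn))).trans (by linarith)
      have h3 : scaledCutoff n x = 1 := by
        refine cutoff_eq_one ?_
        rw [norm_smul, norm_inv, Real.norm_of_nonneg (by positivity),
          inv_mul_le_iff₀ (by positivity), mul_one]
        exact h2
      rw [h3, sub_self, zero_smul]
  have e : scaledCutoff n x • u x - u x = (scaledCutoff n x - 1) • (u - w) x := by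
    rw [Pi.sub_apply, smul_sub, hw0, sub_zero, sub_smul, one_smul]
  rw [e, norm_smul]
  refine mul_le_of_le_one_left (norm_nonneg _) ?_
  rw [Real.norm_eq_abs, abs_le]
  have h4 := cutoff_nonneg 1 (((n : ℝ) + 1)⁻¹ • x)
  have h5 := cutoff_le_one 1 (((n : ℝ) + 1)⁻¹ • x)
  constructor <;> simp only [scaledCutoff] <;> linarith

lemma contDiff_scaledCutoff (n : ℕ) : ContDiff ℝ ∞ (scaledCutoff n) :=
  (contDiff_cutoff 1).comp (contDiff_const_smul _)

lemma hasCompactSupport_scaledCutoff (n : ℕ) : HasCompactSupport (scaledCutoff n) :=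
  (hasCompactSupport_cutoff 1).comp_smul (by positivity)

lemma exists_norm_fderiv_scaledCutoff_le : ∃ M : ℝ, 0 ≤ M ∧ ∀ (n : ℕ) (x v : Space), ‖v‖ ≤ 1 →
    ‖fderiv ℝ (scaledCutoff n) x v‖ ≤ M * (1 / ((n : ℝ) + 1)) := by
  obtain ⟨M, hM0, hM⟩ := exists_norm_fderiv_cutoff_le 1
  refine ⟨M, hM0, fun n x v hv => ?_⟩
  have h1 : HasFDerivAt (scaledCutoff n) _ x :=
    (((contDiff_cutoff 1).differentiable (by simp) _).hasFDerivAt).comp x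
      ((hasFDerivAt_id x).const_smul (((n : ℝ) + 1)⁻¹))
  rw [h1.fderiv]
  have h2 := hM (((n : ℝ) + 1)⁻¹ • x) v hv
  have h3 : ‖((n : ℝ) + 1)⁻¹‖ = 1 / ((n : ℝ) + 1) := by
    rw [norm_inv, Real.norm_of_nonneg (by positivity), one_div]
  simp only [ContinuousLinearMap.comp_apply, smul_apply,
    ContinuousLinearMap.id_apply, map_smul, norm_smul, h3]
  rw [mul_comm]
  gcongr

/-- Smooth compactly supported fields are dense in `H¹`. -/
theorem exists_seq_tendsto_H1 {φ : Space → Spinor} {G : Fin 3 → Space → Spinor}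
    (hφ : IsH1WithGrad φ G) : ∃ f : ℕ → Space → Spinor,
      (∀ n, ContDiff ℝ ∞ (f n)) ∧ (∀ n, HasCompactSupport (f n)) ∧
      Tendsto (fun n => eLpNorm (fun x => f n x - φ x) 2 volume) atTop (𝓝 0) ∧
      ∀ k, Tendsto (fun n => eLpNorm (fun x => fderiv ℝ (f n) x (basisVec k) - G k x) 2 volume)
        atTop (𝓝 0) := by
  have key : ∀ ε : ℝ≥0∞, ε ≠ 0 → ∃ f : Space → Spinor, ContDiff ℝ ∞ f ∧ HasCompactSupport f ∧
      eLpNorm (fun x => f x - φ x) 2 volume ≤ ε ∧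
      ∀ k, eLpNorm (fun x => fderiv ℝ f x (basisVec k) - G k x) 2 volume ≤ ε := by
    intro ε hε
    have hε2 : ε / 2 ≠ 0 := by simpa using hε
    obtain ⟨g, hg, hgφ, hgG⟩ := exists_smooth_approx hφ
      -- the bound by `1` makes `g` square integrable also when `ε = ∞`
      (ε := min (ε / 2) 1) (by simp [hε])
    have hgL : MemLp g 2 volume := by
      have h1 : MemLp (fun x => g x - φ x) 2 volume :=
        ⟨hg.continuous.aestronglyMeasurable.sub hφ.memLp.1,
          hgφ.trans_lt ((min_le_right _ _).trans_lt ENNReal.one_lt_top)⟩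
      exact (h1.add hφ.memLp).ae_eq (Eventually.of_forall fun x => by simp)
    have hdc : ∀ k, Continuous fun x => fderiv ℝ g x (basisVec k) := fun k =>
      (hg.continuous_fderiv (by simp)).clm_apply continuous_const
    have hdL : ∀ k, MemLp (fun x => fderiv ℝ g x (basisVec k)) 2 volume := fun k => by
      have h1 : MemLp (fun x => fderiv ℝ g x (basisVec k) - G k x) 2 volume :=
        ⟨(hdc k).aestronglyMeasurable.sub (hφ.memLp_grad k).1,
          (hgG k).trans_lt ((min_le_right _ _).trans_lt ENNReal.one_lt_top)⟩
      exact (h1.add (hφ.memLp_grad k)).ae_eq (Eventually.of_forall fun x => by simp)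
    obtain ⟨M, hM0, hM⟩ := exists_norm_fderiv_scaledCutoff_le
    have t1 := tendsto_eLpNorm_scaledCutoff_smul_sub hgL
    have t2 : ∀ k, Tendsto (fun n => eLpNorm
        (fun x => fderiv ℝ (fun x => scaledCutoff n x • g x) x (basisVec k)
          - fderiv ℝ g x (basisVec k)) 2 volume) atTop (𝓝 0) := by
      intro k
      have t3 : Tendsto
          (fun n : ℕ => ENNReal.ofReal (M * (1 / ((n : ℝ) + 1))) * eLpNorm g 2 volume)
          atTop (𝓝 0) := by
        have h1 : Tendsto (fun n : ℕ => M * (1 / ((n : ℝ) + 1))) atTop (𝓝 0) := by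
          simpa using tendsto_one_div_add_atTop_nhds_zero_nat.const_mul M
        simpa using ENNReal.Tendsto.mul_const (b := eLpNorm g 2 volume) (ENNReal.tendsto_ofReal h1)
          (Or.inr hgL.2.ne)
      have t4 := (tendsto_eLpNorm_scaledCutoff_smul_sub (hdL k)).add t3
      rw [add_zero] at t4
      refine tendsto_of_tendsto_of_tendsto_of_le_of_le tendsto_const_nhds t4 (fun _ => zero_le)
        fun n => ?_
      have hχd := fun x => (contDiff_scaledCutoff n).differentiable (by simp) x
      have hgd := fun x => hg.differentiable (by simp) x
      have e : (fun x => fderiv ℝ (fun x => scaledCutoff n x • g x) x (basisVec k)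
          - fderiv ℝ g x (basisVec k))
          = (fun x => scaledCutoff n x • fderiv ℝ g x (basisVec k) - fderiv ℝ g x (basisVec k))
            + fun x => fderiv ℝ (scaledCutoff n) x (basisVec k) • g x := by
        funext x
        rw [fderiv_fun_smul (hχd x) (hgd x)]
        simp
        abel
      have hχ1 : Continuous fun x => fderiv ℝ (scaledCutoff n) x (basisVec k) :=
        ((contDiff_scaledCutoff n).continuous_fderiv (by simp)).clm_apply continuous_const
      rw [e]
      refine (eLpNorm_add_le
        ((((contDiff_scaledCutoff n).continuous.smul (hdc k)).sub (hdc k)).aestronglyMeasurable)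
        (hχ1.smul hg.continuous).aestronglyMeasurable one_le_two).trans (add_le_add le_rfl ?_)
      refine eLpNorm_le_mul_eLpNorm_of_ae_le_mul (Eventually.of_forall fun x => ?_) 2
      rw [Pi.smul_apply', norm_smul]
      gcongr
      exact hM n x _ (norm_basisVec k).le
    have hev := ((ENNReal.tendsto_nhds_zero.1 t1 _ (pos_iff_ne_zero.2 hε2)).and
      (eventually_all.2 fun k => ENNReal.tendsto_nhds_zero.1 (t2 k) _ (pos_iff_ne_zero.2 hε2)))
    obtain ⟨n, hn1, hn2⟩ := hev.exists
    have hfs : ContDiff ℝ ∞ fun x => scaledCutoff n x • g x := (contDiff_scaledCutoff n).smul hg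
    have add_half : ∀ {a b c : Space → Spinor}, Continuous a → Continuous b →
        AEStronglyMeasurable c volume → eLpNorm (fun x => a x - b x) 2 volume ≤ ε / 2 →
        eLpNorm (fun x => b x - c x) 2 volume ≤ min (ε / 2) 1 →
        eLpNorm (fun x => a x - c x) 2 volume ≤ ε := by
      intro a b c ha hb hc h1 h2
      have e : (fun x => a x - c x) = (fun x => a x - b x) + fun x => b x - c x := by
        funext x
        simp
      rw [e, ← ENNReal.add_halves ε]
      exact (eLpNorm_add_le (ha.sub hb).aestronglyMeasurable (hb.aestronglyMeasurable.sub hc)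
        one_le_two).trans (add_le_add h1 (h2.trans (min_le_left _ _)))
    exact ⟨fun x => scaledCutoff n x • g x, hfs, (hasCompactSupport_scaledCutoff n).smul_right,
      add_half hfs.continuous hg.continuous hφ.memLp.1 hn1 hgφ,
      fun k => add_half ((hfs.continuous_fderiv (by simp)).clm_apply continuous_const) (hdc k)
        (hφ.memLp_grad k).1 (hn2 k) (hgG k)⟩
  have hε : Tendsto (fun n : ℕ => ((n : ℝ≥0∞))⁻¹) atTop (𝓝 0) :=
    ENNReal.tendsto_inv_nat_nhds_zero
  choose f hf hc h1 h2 using fun n : ℕ =>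
    key ((n : ℝ≥0∞))⁻¹ (ENNReal.inv_ne_zero.2 (ENNReal.natCast_ne_top n))
  exact ⟨f, hf, hc,
    tendsto_of_tendsto_of_tendsto_of_le_of_le tendsto_const_nhds hε (fun _ => zero_le) h1,
    fun k => tendsto_of_tendsto_of_tendsto_of_le_of_le tendsto_const_nhds hε (fun _ => zero_le)
      fun n => h2 n k⟩

/-! ### Traces on the sphere -/

/-- The indicator function of `(R, ∞)`, whose radial vector field computes traces on the sphere. -/
noncomputable def stepProfile (R r : ℝ) : ℝ := if r ≤ R then 0 else 1

lemma stepProfile_of_le {R r : ℝ} (h : r ≤ R) : stepProfile R r = 0 := if_pos h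

lemma stepProfile_of_lt {R r : ℝ} (h : R < r) : stepProfile R r = 1 := if_neg (not_le.2 h)

lemma tendsto_stepProfile_left (R : ℝ) : Tendsto (stepProfile R) (𝓝[<] R) (𝓝 0) :=
  tendsto_const_nhds.congr' (eventually_nhdsWithin_of_forall fun _ hr =>
    (stepProfile_of_le (le_of_lt hr)).symm)

lemma tendsto_stepProfile_right (R : ℝ) : Tendsto (stepProfile R) (𝓝[>] R) (𝓝 1) :=
  tendsto_const_nhds.congr' (eventually_nhdsWithin_of_forall fun _ hr =>
    (stepProfile_of_lt hr).symm)

lemma jump_stepProfile (R : ℝ) : jump (stepProfile R) R = 1 := by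
  rw [jump, leftLim_eq_of_tendsto (tendsto_stepProfile_left R),
    rightLim_eq_of_tendsto (tendsto_stepProfile_right R), sub_zero]

lemma deriv_stepProfile {R r : ℝ} (h : r ≠ R) : deriv (stepProfile R) r = 0 := by
  rcases lt_or_gt_of_ne h with h | h
  · have : stepProfile R =ᶠ[𝓝 r] fun _ => 0 := by
      filter_upwards [Iio_mem_nhds h] with s hs using stepProfile_of_le (le_of_lt hs)
    rw [this.deriv_eq, deriv_const]
  · have : stepProfile R =ᶠ[𝓝 r] fun _ => 1 := by
      filter_upwards [Ioi_mem_nhds h] with s hs using stepProfile_of_lt hs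
    rw [this.deriv_eq, deriv_const]

lemma isRadialProfile_stepProfile {R : ℝ} (hR : 0 < R) : IsRadialProfile R (stepProfile R) where
  left a b _ hab hb := by
    have : LipschitzOnWith 0 (stepProfile R) (uIcc a b) := fun x hx y hy => by
      rw [uIcc_of_le hab] at hx hy
      simp [stepProfile_of_le (hx.2.trans hb.le), stepProfile_of_le (hy.2.trans hb.le)]
    exact this.absolutelyContinuousOnInterval
  right a b ha hab := by
    have : LipschitzOnWith 0 (stepProfile R) (uIcc a b) := fun x hx y hy => by
      rw [uIcc_of_le hab] at hx hy
      simp [stepProfile_of_lt (ha.trans_le hx.1), stepProfile_of_lt (ha.trans_le hy.1)]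
    exact this.absolutelyContinuousOnInterval
  leftLim := ⟨0, tendsto_stepProfile_left R⟩
  rightLim := ⟨1, tendsto_stepProfile_right R⟩
  zeroLim := ⟨0, tendsto_const_nhds.congr' (by
    filter_upwards [Ioo_mem_nhdsGT hR] with r hr using (stepProfile_of_le hr.2.le).symm)⟩
  integrableOn_deriv b := by
    refine (integrable_zero ℝ ℝ _).congr (ae_restrict_of_ae ?_)
    filter_upwards [measure_eq_zero_iff_ae_notMem.1 (measure_singleton (μ := volume) R)] with r hr
    exact (deriv_stepProfile (by simpa using hr)).symm

/-- The trace inequality for smooth compactly supported fields: the radial integration by parts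
expresses the integral over the sphere by an integral over its exterior. -/
lemma integral_sphere_norm_sq_le {R : ℝ} (hR : 0 < R) {f : Space → Spinor} (hf : ContDiff ℝ ∞ f)
    (hc : HasCompactSupport f) : ∫ x, ‖f x‖ ^ 2 ∂(sphereMeasure R)
      ≤ 3 * (∫ x, ‖f x‖ ^ 2) + ∑ k, ∫ x, ‖fderiv ℝ f x (basisVec k)‖ ^ 2 := by
  obtain ⟨hi, he⟩ := (isRadialProfile_stepProfile hR).integral_radial hR
    ((contDiff_norm_sq hf).of_le (by norm_num)) (hasCompactSupport_norm_sq hc)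
  rw [jump_stepProfile, one_mul] at he
  have hfi : Integrable (fun x => ‖f x‖ ^ 2) volume :=
    (memLp_of_hasCompactSupport hf.continuous hc).integrable_norm_pow two_ne_zero
  have hdi : ∀ k, Integrable (fun x => ‖fderiv ℝ f x (basisVec k)‖ ^ 2) volume := fun k =>
    (memLp_of_hasCompactSupport
      ((hf.continuous_fderiv (by simp)).clm_apply (continuous_const (y := basisVec k)))
      (hc.fderiv_apply (𝕜 := ℝ) (basisVec k))).integrable_norm_pow two_ne_zero
  have hle : ∫ x, -(stepProfile R ‖x‖ / ‖x‖ * fderiv ℝ (fun x => ‖f x‖ ^ 2) x x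
      + (deriv (stepProfile R) ‖x‖ + 2 * (stepProfile R ‖x‖ / ‖x‖)) * ‖f x‖ ^ 2)
      ≤ ∫ x, (3 * ‖f x‖ ^ 2 + ∑ k, ‖fderiv ℝ f x (basisVec k)‖ ^ 2) := by
    refine integral_mono_ae hi.neg ((hfi.const_mul 3).add (integrable_finsetSum _ fun k _ => hdi k))
      ?_
    have hne : ∀ᵐ s : ℝ, s ∈ Ioi (0 : ℝ) → s ≠ R := by
      filter_upwards [measure_eq_zero_iff_ae_notMem.1 (measure_singleton (μ := volume) R)]
        with r hr _ using by simpa using hr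
    filter_upwards [ae_norm_of_ae hne] with x hx
    have hsum : 3 * ‖f x‖ ^ 2 + ∑ k, ‖fderiv ℝ f x (basisVec k)‖ ^ 2
        = ∑ k, (‖fderiv ℝ f x (basisVec k)‖ ^ 2 + ‖f x‖ ^ 2) := by
      simp only [Fin.sum_univ_three]
      ring
    rcases le_or_gt ‖x‖ R with h | h
    · rw [stepProfile_of_le h, deriv_stepProfile hx]
      simp only [zero_div, zero_mul, mul_zero, add_zero, neg_zero]
      positivity
    · have hx0 : 0 < ‖x‖ := hR.trans h
      have h1 : |(inner ℂ (fderiv ℝ f x x) (f x)).re|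
          ≤ ‖x‖ * ∑ k, ‖fderiv ℝ f x (basisVec k)‖ * ‖f x‖ := by
        refine (Complex.abs_re_le_norm _).trans ((norm_inner_le_norm _ _).trans ?_)
        rw [← sum_smul_apply_basisVec (fderiv ℝ f x) x, ← Finset.sum_mul, ← mul_assoc]
        gcongr
        refine (norm_sum_le _ _).trans ?_
        rw [Finset.mul_sum]
        refine Finset.sum_le_sum fun k _ => ?_
        rw [norm_smul]
        gcongr
        exact PiLp.norm_apply_le x k
      have h2 : ∑ k, 2 * (‖fderiv ℝ f x (basisVec k)‖ * ‖f x‖)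
          ≤ ∑ k, (‖fderiv ℝ f x (basisVec k)‖ ^ 2 + ‖f x‖ ^ 2) :=
        Finset.sum_le_sum fun k _ => by
          nlinarith [sq_nonneg (‖fderiv ℝ f x (basisVec k)‖ - ‖f x‖)]
      have h3 : -(1 / ‖x‖ * (2 * (inner ℂ (fderiv ℝ f x x) (f x)).re))
          ≤ ∑ k, 2 * (‖fderiv ℝ f x (basisVec k)‖ * ‖f x‖) := by
        have h4 := neg_le_of_abs_le h1
        rw [← Finset.mul_sum, neg_le, ← mul_neg, ← mul_assoc, mul_comm (1 / ‖x‖), mul_assoc]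
        refine mul_le_mul_of_nonneg_left ?_ zero_le_two
        rw [one_div, ← div_eq_inv_mul, le_div_iff₀ hx0]
        linarith
      have h5 : 0 ≤ 2 * (1 / ‖x‖) * ‖f x‖ ^ 2 := by positivity
      rw [stepProfile_of_lt h, deriv_stepProfile hx, fderiv_norm_sq (hf.differentiable (by simp) x),
        hsum, zero_add]
      linarith
  rw [integral_neg, he, neg_neg, integral_add (hfi.const_mul 3)
    (integrable_finsetSum _ fun k _ => hdi k), integral_const_mul,
    integral_finsetSum _ fun k _ => hdi k] at hle
  exact hle

lemma ofReal_integral_norm_sq {μ : Measure Space} {u : Space → Spinor} (hu : MemLp u 2 μ) :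
    ENNReal.ofReal (∫ x, ‖u x‖ ^ 2 ∂μ) = eLpNorm u 2 μ ^ 2 := by
  rw [integral_norm_sq_eq_norm_toLp_sq hu, ENNReal.ofReal_pow (norm_nonneg _), Lp.norm_toLp,
    ENNReal.ofReal_toReal hu.2.ne]

/-- The trace inequality in terms of `L²` norms. -/
lemma eLpNorm_sphere_le {R : ℝ} (hR : 0 < R) {f : Space → Spinor} (hf : ContDiff ℝ ∞ f)
    (hc : HasCompactSupport f) : eLpNorm f 2 (sphereMeasure R)
      ≤ 2 * (eLpNorm f 2 volume + ∑ k, eLpNorm (fun x => fderiv ℝ f x (basisVec k)) 2 volume) := by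
  have hfL : ∀ (μ : Measure Space) [IsFiniteMeasureOnCompacts μ], MemLp f 2 μ := fun μ _ =>
    memLp_of_hasCompactSupport hf.continuous hc
  have hdL : ∀ k, MemLp (fun x => fderiv ℝ f x (basisVec k)) 2 volume := fun k =>
    memLp_of_hasCompactSupport
      ((hf.continuous_fderiv (by simp)).clm_apply (continuous_const (y := basisVec k)))
      (hc.fderiv_apply (𝕜 := ℝ) (basisVec k))
  have h := ENNReal.ofReal_le_ofReal (integral_sphere_norm_sq_le hR hf hc)
  rw [ofReal_integral_norm_sq (hfL _), ENNReal.ofReal_add (by positivity) (by positivity),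
    ENNReal.ofReal_mul (by norm_num), ofReal_integral_norm_sq (hfL _),
    ENNReal.ofReal_sum_of_nonneg fun k _ => integral_nonneg fun _ => sq_nonneg _] at h
  simp only [fun k => ofReal_integral_norm_sq (hdL k)] at h
  rw [← ENNReal.pow_le_pow_left_iff two_ne_zero]
  refine h.trans ?_
  set a := eLpNorm f 2 volume
  set d := fun k => eLpNorm (fun x => fderiv ℝ f x (basisVec k)) 2 volume
  have h3 : ENNReal.ofReal 3 ≤ 4 := by
    rw [show (4 : ℝ≥0∞) = ENNReal.ofReal 4 by simp]
    exact ENNReal.ofReal_le_ofReal (by norm_num)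
  calc ENNReal.ofReal 3 * a ^ 2 + ∑ k, d k ^ 2 ≤ 4 * a ^ 2 + 4 * (∑ k, d k) ^ 2 := by
        gcongr
        have e : 4 * (∑ k, d k) ^ 2 = ∑ k, d k ^ 2 + (3 * ∑ k, d k ^ 2
            + 8 * (d 0 * d 1 + d 1 * d 2 + d 2 * d 0)) := by
          simp only [Fin.sum_univ_three]
          ring
        rw [e]
        exact le_self_add
    _ ≤ 4 * a ^ 2 + 4 * (∑ k, d k) ^ 2 + 8 * (a * ∑ k, d k) := le_self_add
    _ = (2 * (a + ∑ k, d k)) ^ 2 := by ring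

/-- Traces of `H¹` fields exist: the restrictions of an approximating sequence to the sphere form a
Cauchy sequence in `L²(S_R)`. -/
theorem exists_isSphereTrace {R : ℝ} (hR : 0 < R) {φ : Space → Spinor} {G : Fin 3 → Space → Spinor}
    (hφ : IsH1WithGrad φ G) : ∃ τ, IsSphereTrace R φ G τ := by
  have : Fact ((1 : ℝ≥0∞) ≤ 2) := ⟨one_le_two⟩
  obtain ⟨f, hf, hc, h1, h2⟩ := exists_seq_tendsto_H1 hφ
  have hfL : ∀ n, MemLp (f n) 2 (sphereMeasure R) := fun n =>
    memLp_of_hasCompactSupport (hf n).continuous (hc n)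
  have hdc : ∀ n k, Continuous fun x => fderiv ℝ (f n) x (basisVec k) := fun n k =>
    ((hf n).continuous_fderiv (by simp)).clm_apply continuous_const
  set b : ℕ → ℝ≥0∞ := fun n => 2 * (eLpNorm (fun x => f n x - φ x) 2 volume
    + ∑ k, eLpNorm (fun x => fderiv ℝ (f n) x (basisVec k) - G k x) 2 volume) with hb
  have hb0 : Tendsto b atTop (𝓝 0) := by
    have h3 := h1.add (tendsto_finsetSum Finset.univ fun k _ => h2 k)
    have h4 := ENNReal.Tendsto.const_mul (a := 2) h3 (Or.inr ENNReal.ofNat_ne_top)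
    simpa using h4
  have htri : ∀ {u v w : Space → Spinor}, AEStronglyMeasurable u volume →
      AEStronglyMeasurable v volume → AEStronglyMeasurable w volume →
      eLpNorm (fun x => u x - v x) 2 volume
        ≤ eLpNorm (fun x => u x - w x) 2 volume + eLpNorm (fun x => v x - w x) 2 volume := by
    intro u v w hu hv hw
    have e : (fun x => u x - v x) = (fun x => u x - w x) - fun x => v x - w x := by
      funext x
      simp
    rw [e]
    exact eLpNorm_sub_le (hu.sub hw) (hv.sub hw) one_le_two
  have hcs : CauchySeq fun n => (hfL n).toLp (f n) := by
    rw [Lp.cauchySeq_Lp_iff_cauchySeq_eLpNorm]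
    have hbb : Tendsto (fun n : ℕ × ℕ => b n.1 + b n.2) atTop (𝓝 0) := by
      rw [← prod_atTop_atTop_eq]
      simpa using (hb0.comp tendsto_fst).add (hb0.comp tendsto_snd)
    refine tendsto_of_tendsto_of_tendsto_of_le_of_le tendsto_const_nhds hbb (fun _ => zero_le)
      fun n => ?_
    have e : eLpNorm (⇑((hfL n.1).toLp (f n.1)) - ⇑((hfL n.2).toLp (f n.2))) 2 (sphereMeasure R)
        = eLpNorm (fun x => f n.1 x - f n.2 x) 2 (sphereMeasure R) :=
      eLpNorm_congr_ae ((hfL n.1).coeFn_toLp.sub (hfL n.2).coeFn_toLp)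
    rw [e]
    refine (eLpNorm_sphere_le hR ((hf n.1).sub (hf n.2)) ((hc n.1).sub (hc n.2))).trans ?_
    have hder : ∀ k x, fderiv ℝ (fun x => f n.1 x - f n.2 x) x (basisVec k)
        = fderiv ℝ (f n.1) x (basisVec k) - fderiv ℝ (f n.2) x (basisVec k) := fun k x => by
      rw [fderiv_fun_sub ((hf n.1).differentiable (by simp) x)
        ((hf n.2).differentiable (by simp) x)]
      rfl
    simp only [hder, hb]
    rw [← mul_add]
    refine mul_le_mul' le_rfl ?_
    rw [add_add_add_comm, ← Finset.sum_add_distrib]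
    refine add_le_add (htri (hf _).continuous.aestronglyMeasurable
      (hf _).continuous.aestronglyMeasurable hφ.memLp.1) (Finset.sum_le_sum fun k _ => ?_)
    exact htri (hdc _ k).aestronglyMeasurable (hdc _ k).aestronglyMeasurable (hφ.memLp_grad k).1
  obtain ⟨T, hT⟩ := cauchySeq_tendsto_of_complete hcs
  refine ⟨T, Lp.memLp T, f, hf, hc, h1, h2, ?_⟩
  refine ((Lp.tendsto_Lp_iff_tendsto_eLpNorm' _ _).1 hT).congr fun n => eLpNorm_congr_ae ?_
  filter_upwards [(hfL n).coeFn_toLp] with x hx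
  rw [Pi.sub_apply, hx]

/-! ### The weight `W` -/

/-- A one-sided bound on the derivative suffices: `e = 1` is used for `m₊`, whose derivative is
bounded from below, and `e = -1` for `m₋`, whose derivative is bounded from above. -/
lemma IsPiecewiseAC.isRadialProfile {R e c l : ℝ} {m : ℝ → ℝ} (hR : 0 < R) (hm : IsPiecewiseAC R m)
    (hl : Tendsto m (𝓝[>] 0) (𝓝 l)) (he : e ≠ 0)
    (h : ∀ᵐ s, s ∈ Ioi (0 : ℝ) → c ≤ e * deriv m s) : IsRadialProfile R m where
  toIsPiecewiseAC := hm
  zeroLim := ⟨l, hl⟩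
  integrableOn_deriv b := by
    wlog hb : R < b generalizing b
    · exact (this (R + 1) (by linarith)).mono_set (Ioc_subset_Ioc_right (by linarith))
    have hd : deriv (fun s => e * m s) = fun s => e * deriv m s := funext fun s =>
      deriv_const_mul_field e
    have i1 : IntegrableOn (deriv fun s => e * m s) (Ioc 0 R) :=
      integrableOn_deriv_of_le hR (fun s t hs hst ht => (hm.left s t hs hst ht).const_mul e)
        (hl.const_mul e) (hm.tendsto_left.const_mul e) (by
          filter_upwards [h] with s hs hsm
          rw [hd]
          exact hs hsm.1)
    have i2 : IntegrableOn (deriv fun s => e * m s) (Ioc R b) :=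
      integrableOn_deriv_of_le hb (fun s t hs hst _ => (hm.right s t hs hst).const_mul e)
        (hm.tendsto_right.const_mul e) ((hm.tendsto_of_lt hb).const_mul e) (by
          filter_upwards [h] with s hs hsm
          rw [hd]
          exact hs (hR.trans hsm.1))
    have i3 := i1.union i2
    rw [Ioc_union_Ioc_eq_Ioc hR.le hb.le, hd] at i3
    exact (integrable_const_mul_iff he.isUnit _).1 i3

section Weight

variable {mp mm : ℝ → ℝ}

lemma ae_one_le_Wplus (hW : ∀ᵐ s, s ∈ Ioi (0 : ℝ) → 1 ≤ Wmin mp mm s) :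
    ∀ᵐ s, s ∈ Ioi (0 : ℝ) → 1 ≤ Wplus mp s := by
  filter_upwards [hW] with s hs h0 using (hs h0).trans (min_le_left _ _)

lemma ae_one_le_Wminus (hW : ∀ᵐ s, s ∈ Ioi (0 : ℝ) → 1 ≤ Wmin mp mm s) :
    ∀ᵐ s, s ∈ Ioi (0 : ℝ) → 1 ≤ Wminus mm s := by
  filter_upwards [hW] with s hs h0 using (hs h0).trans (min_le_right _ _)

lemma Wmin_div_mul_le_Wplus {s : ℝ} (hs : 0 < s) : Wmin mp mm s / s * (1 + mp s ^ 2)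
    ≤ 2 * (mp s / s) + deriv mp s - mp s ^ 2 + 1 := by
  have h1 : Wmin mp mm s * (1 + mp s ^ 2) ≤ 2 * mp s + s * deriv mp s - s * mp s ^ 2 + s := by
    rw [← le_div_iff₀ (by positivity)]
    exact min_le_left _ _
  have e : 2 * (mp s / s) + deriv mp s - mp s ^ 2 + 1
      = (2 * mp s + s * deriv mp s - s * mp s ^ 2 + s) / s := by
    field_simp
  rw [e, div_mul_eq_mul_div]
  exact div_le_div_of_nonneg_right h1 hs.le

lemma Wmin_div_mul_le_Wminus {s : ℝ} (hs : 0 < s) : Wmin mp mm s / s * (1 + mm s ^ 2)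
    ≤ 2 * (mm s / s) - deriv mm s - mm s ^ 2 + 1 := by
  have h1 : Wmin mp mm s * (1 + mm s ^ 2) ≤ 2 * mm s - s * deriv mm s - s * mm s ^ 2 + s := by
    rw [← le_div_iff₀ (by positivity)]
    exact min_le_right _ _
  have e : 2 * (mm s / s) - deriv mm s - mm s ^ 2 + 1
      = (2 * mm s - s * deriv mm s - s * mm s ^ 2 + s) / s := by
    field_simp
  rw [e, div_mul_eq_mul_div]
  exact div_le_div_of_nonneg_right h1 hs.le

/-- Since `W ≥ 0`, it is dominated by the numerator of `W^{+,m₊}`. -/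
lemma locallyIntegrable_Wmin_div {R : ℝ} (hR : 0 < R) (hmp : IsRadialProfile R mp)
    (hmm : IsPiecewiseAC R mm) (hW : ∀ᵐ s, s ∈ Ioi (0 : ℝ) → 1 ≤ Wmin mp mm s) :
    LocallyIntegrable (fun x : Space => Wmin mp mm ‖x‖ / ‖x‖) volume := by
  refine locallyIntegrable_radial (w := fun s => Wmin mp mm s / s) fun b => ?_
  have hpm := hmp.toIsPiecewiseAC.aestronglyMeasurable.aemeasurable
  have hmm' := hmm.aestronglyMeasurable.aemeasurable
  have hdp : AEMeasurable (deriv mp) (volume.restrict (Ioi 0)) := (measurable_deriv mp).aemeasurable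
  have hdm : AEMeasurable (deriv mm) (volume.restrict (Ioi 0)) := (measurable_deriv mm).aemeasurable
  have hid : AEMeasurable (fun s : ℝ => s) (volume.restrict (Ioi 0)) := measurable_id.aemeasurable
  have hmeas : AEMeasurable (fun s => s ^ 2 * (Wmin mp mm s / s)) (volume.restrict (Ioi 0)) := by
    have h1 : AEMeasurable (Wplus mp) (volume.restrict (Ioi 0)) :=
      ((((hpm.const_mul 2).add (hid.mul hdp)).sub (hid.mul (hpm.pow_const 2))).add hid).div
        ((hpm.pow_const 2).const_add 1)
    have h2 : AEMeasurable (Wminus mm) (volume.restrict (Ioi 0)) :=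
      ((((hmm'.const_mul 2).sub (hid.mul hdm)).sub (hid.mul (hmm'.pow_const 2))).add hid).div
        ((hmm'.pow_const 2).const_add 1)
    exact (hid.pow_const 2).mul ((h1.min h2).div hid)
  have hsub : Ioc (0 : ℝ) b ⊆ Ioi 0 := fun s hs => hs.1
  have i1 := hmp.integrableOn_continuous_mul hR (p := fun s => 2 * s) (by fun_prop) b
  have i2 := hmp.integrableOn_continuous_mul_deriv (p := fun s => s ^ 2) (by fun_prop) b
  have i3 : IntegrableOn (fun s : ℝ => s ^ 2) (Ioc 0 b) :=
    (Continuous.integrableOn_Icc (by fun_prop)).mono_set Ioc_subset_Icc_self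
  refine Integrable.mono' ((i1.add i2).add i3)
    (hmeas.mono_measure (Measure.restrict_mono hsub le_rfl)).aestronglyMeasurable ?_
  filter_upwards [ae_restrict_mem measurableSet_Ioc, ae_restrict_of_ae hW] with s hs hWs
  have hs0 : 0 < s := hs.1
  have hW1 := hWs hs0
  have hv : 0 ≤ Wmin mp mm s / s := div_nonneg (zero_le_one.trans hW1) hs0.le
  have h1 := Wmin_div_mul_le_Wplus (mp := mp) (mm := mm) hs0
  have h2 : Wmin mp mm s / s ≤ 2 * (mp s / s) + deriv mp s + 1 := by
    nlinarith [sq_nonneg (mp s), mul_nonneg hv (sq_nonneg (mp s))]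
  rw [Real.norm_of_nonneg (mul_nonneg (sq_nonneg s) hv)]
  refine (mul_le_mul_of_nonneg_left h2 (sq_nonneg s)).trans_eq ?_
  simp only [Pi.add_apply]
  field_simp

/-- The inequality of Hardy–Dirac type, once the profiles are known to be nonnegative. -/
theorem hardyDiracInequality {R : ℝ} (hR : 0 < R) (hmp : IsRadialProfile R mp)
    (hmm : IsRadialProfile R mm)
    (hW : ∀ᵐ s, s ∈ Ioi (0 : ℝ) → 1 ≤ Wmin mp mm s)
    (h0 : ∀ s, 0 < s → s ≠ R → 0 ≤ mp s ∧ 0 ≤ mm s) :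
    HardyDiracInequality (Wmin mp mm) R (-max (jump mm R) (-jump mp R)) := by
  have hV := locallyIntegrable_Wmin_div hR hmp hmm.toIsPiecewiseAC hW
  have hpos : ∀ᵐ x : Space, 0 < ‖x‖ := by
    filter_upwards [ae_norm_of_ae (P := fun s => s ≠ 0)
      (Eventually.of_forall fun s hs => ne_of_gt hs)] with x hx
    exact (norm_nonneg x).lt_of_ne' hx
  have hne : ∀ᵐ s : ℝ, s ∈ Ioi (0 : ℝ) → s ≠ R := by
    filter_upwards [measure_eq_zero_iff_ae_notMem.1 (measure_singleton (μ := volume) R)]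
      with s hs _ using by simpa using hs
  have hV0 : ∀ᵐ x : Space, 0 ≤ Wmin mp mm ‖x‖ / ‖x‖ := by
    filter_upwards [ae_norm_of_ae hW, hpos] with x hx hx0
    exact div_nonneg (zero_le_one.trans hx) hx0.le
  have hp0 : ∀ᵐ x : Space, 0 ≤ mp ‖x‖ := by
    filter_upwards [ae_norm_of_ae hne, hpos] with x hx hx0 using (h0 _ hx0 hx).1
  have hm0 : ∀ᵐ x : Space, 0 ≤ mm ‖x‖ := by
    filter_upwards [ae_norm_of_ae hne, hpos] with x hx hx0 using (h0 _ hx0 hx).2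
  have hsmooth : ∀ f : Space → Spinor, ContDiff ℝ ∞ f → HasCompactSupport f →
      SmoothHardy (fun s => Wmin mp mm s / s) R (-max (jump mm R) (-jump mp R)) f := by
    intro f hf hc
    refine smoothHardy_of_eigenspaces hV hV0 (fun k hk f hf hc => ?_) hf hc
    -- the sectors `k ≥ 1` use `m₊`, the sectors `k ≤ -1` use `m₋`
    rcases lt_or_gt_of_ne hk with hk | hk
    · refine (smoothHardy_of_neg hR hmm hV hV0 hm0 ?_ (by omega) hf hc).mono
        (neg_le_neg (le_max_left _ _))
      filter_upwards [hpos] with x hx using Wmin_div_mul_le_Wminus hx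
    · refine (smoothHardy_of_pos hR hmp hV hV0 hp0 ?_ (by omega) hf hc).mono
        (neg_le.1 (le_max_right _ _))
      filter_upwards [hpos] with x hx using Wmin_div_mul_le_Wplus hx
  intro φ G hφ
  have hlim : ∀ τ, IsSphereTrace R φ G τ →
      Integrable (fun x => Wmin mp mm ‖x‖ / ‖x‖ * ‖φ x‖ ^ 2) volume ∧
      (∫ x, Wmin mp mm ‖x‖ / ‖x‖ * ‖φ x‖ ^ 2)
        + -max (jump mm R) (-jump mp R) * ∫ x, ‖τ x‖ ^ 2 ∂(sphereMeasure R) ≤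
        ∫ x, (‖sigmaGrad G x‖ ^ 2 / (1 + Wmin mp mm ‖x‖ / ‖x‖) + ‖φ x‖ ^ 2) := by
    rintro τ ⟨hτL, f, hf, hc, t1, t2, t3⟩
    exact hardy_of_tendsto hV hV0 hf hc (fun n => hsmooth _ (hf n) (hc n)) hφ.memLp
      hφ.memLp_grad hτL ⟨t1, t2, t3⟩
  obtain ⟨τ, hτ⟩ := exists_isSphereTrace hR hφ
  exact ⟨(hlim τ hτ).1, ⟨τ, hτ⟩, fun τ' hτ' => (hlim τ' hτ').2⟩

end Weight

end DiracHardy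


theorem mainTheorem10
    (R δ : ℝ) (hR : 0 < R) (hδ : 0 < δ) (mp mm : ℝ → ℝ)
    (hmp : DiracHardy.IsPiecewiseAC R mp) (hmm : DiracHardy.IsPiecewiseAC R mm)
    (hmp0 : ContinuousOn mp (Ico 0 δ)) (hmm0 : ContinuousOn mm (Ico 0 δ))
    (hW : ∀ᵐ s ∂(volume.restrict (Ioi (0 : ℝ))), 1 ≤ DiracHardy.Wmin mp mm s) :
    ((∀ s, 0 < s → s ≠ R → 0 ≤ mp s ∧ 0 ≤ mm s) →
      DiracHardy.HardyDiracInequality (DiracHardy.Wmin mp mm) R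
        (-max (DiracHardy.jump mm R) (-DiracHardy.jump mp R))) ∧
    -max (DiracHardy.jump mm R) (-DiracHardy.jump mp R) ≤ 0 ∧
    mp 0 = 1 ∧ mm 0 = 1 ∧
    (∀ᶠ s in 𝓝[>] (0 : ℝ), 1 ≤ mp s) ∧
    (∀ᶠ s in 𝓝[>] (0 : ℝ), mm s ≤ 1) ∧
    (∃ M : ℝ, ∀ᶠ s in 𝓝[>] (0 : ℝ), |(mp s - 1) * Real.log s| ≤ M) ∧
    (∃ M : ℝ, ∀ᶠ s in 𝓝[>] (0 : ℝ), |(mm s - 1) * Real.log s| ≤ M) := by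
  rw [ae_restrict_iff' measurableSet_Ioi] at hW
  have hWp := DiracHardy.ae_one_le_Wplus hW
  have hWm := DiracHardy.ae_one_le_Wminus hW
  have hlim : ∀ {m : ℝ → ℝ}, ContinuousOn m (Ico 0 δ) → Tendsto m (𝓝[>] 0) (𝓝 (m 0)) :=
    fun {m} hm => ((hm 0 ⟨le_rfl, hδ⟩).mono Ioo_subset_Ico_self).tendsto.mono_left
      (nhdsWithin_le_of_mem (Ioo_mem_nhdsGT hδ))
  have hp1 : mp 0 = 1 := by
    refine DiracHardy.eq_one_of_tendsto (e := 1) hR hmp.left (hlim hmp0) ?_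
    filter_upwards [hWp] with s hs hsm
    rw [one_mul]
    exact DiracHardy.le_mul_deriv_of_one_le_Wplus (hs hsm.1)
  have hm1 : mm 0 = 1 := by
    refine DiracHardy.eq_one_of_tendsto (e := -1) hR hmm.left (hlim hmm0) ?_
    filter_upwards [hWm] with s hs hsm
    rw [neg_one_mul, mul_neg]
    exact DiracHardy.le_mul_deriv_of_one_le_Wminus (hs hsm.1)
  have hlp : Tendsto mp (𝓝[>] 0) (𝓝 1) := hp1 ▸ hlim hmp0
  have hlm : Tendsto mm (𝓝[>] 0) (𝓝 1) := hm1 ▸ hlim hmm0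
  have hjp := DiracHardy.jump_nonpos_of_Wplus hR hmp hlp hWp
  refine ⟨DiracHardy.hardyDiracInequality hR ?_ ?_ hW,
    neg_nonpos.2 (le_max_of_le_right (neg_nonneg.2 hjp)), hp1, hm1, ?_, ?_,
    DiracHardy.exists_abs_mul_log_le_of_Wplus hR hmp hlp hWp,
    DiracHardy.exists_abs_mul_log_le_of_Wminus hR hmm hlm hWm⟩
  · refine hmp.isRadialProfile hR hlp one_ne_zero (c := -1) ?_
    filter_upwards [hWp] with s hs h0
    have h1 := DiracHardy.deriv_ge_of_one_le_Wplus h0 (hs h0)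
    have h2 : 0 ≤ (mp s - 1) ^ 2 / s := div_nonneg (sq_nonneg _) (le_of_lt h0)
    linarith [sq_nonneg (mp s)]
  · refine hmm.isRadialProfile hR hlm (neg_ne_zero.2 one_ne_zero) (c := -1) ?_
    filter_upwards [hWm] with s hs h0
    have h1 := DiracHardy.deriv_le_of_one_le_Wminus h0 (hs h0)
    have h2 : 0 ≤ (mm s - 1) ^ 2 / s := div_nonneg (sq_nonneg _) (le_of_lt h0)
    linarith [sq_nonneg (mm s)]
  · filter_upwards [Ioo_mem_nhdsGT hR] with s hs using
      DiracHardy.one_le_of_Wplus hmp hlp hWp s hs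
  · filter_upwards [Ioo_mem_nhdsGT hR] with s hs using
      DiracHardy.le_one_of_Wminus hmm hlm hWm s hs
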